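/- **Theorem 3.1.** Let $T>0$, let $u\in L^\infty(0,T)$ (complex-valued; in particular $u$ may be real), put $\mathbb R_+=(0,\infty)$, and let all functions be complex-valued. *Spaces.* For $s=1,2$ let $H_0^s$ be the space of $\varphi\in L^2(\mathbb R_+\times\mathbb R)$ with weak derivatives up to order $s$ in $L^2(\mathbb R_+\times\mathbb R)$ and $\partial_1^k\varphi(0^+,\cdot)=0$ for $0\le k\le s-1$, and let $H_0^{-s}=(H_0^s)^*$. Let $H^{-s}(\mathbb R^n)=(H^s(\mathbb R^n))^*$. Functions in $L^2$ and their distributional derivatives of order at most $s$ are regarded as elements of these dual spaces. *Value on a line.* Let $f\in H_0^{-1}$. For $\alpha>0$, $\varphi\in H^1(\mathbb R)$ and $\psi\in C_c^\infty(\mathbb R_+)$ put $$f_\alpha(\varphi,\psi)=\Big\langle f,\ \tfrac1\alpha\,\psi\big(\tfrac{x_1}{\alpha}\big)\varphi(x_2)\Big\rangle .$$ Then $f$ has the value $f_0\in H^{-1}(\mathbb R)$ on the line $x_1=0$, written $f(0^+,\cdot)=f_0$, if $f_\alpha(\varphi,\psi)\to\langle f_0,\varphi\rangle\int\psi$ as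 $\alpha\to0^+$ for all such $\varphi$ and $\psi$. *System (A).* For $w^0\in L^2(\mathbb R_+\times\mathbb R)$, a solution of $$w_t=\Delta w\ \ (x_1>0,\ 0<t<T),\qquad w_{x_1}(0^+,\cdot,t)=u(t)\,\delta\ \ (0<t<T),\qquad w(\cdot,0)=w^0$$ is a function $w\in C([0,T];L^2(\mathbb R_+\times\mathbb R))$ with $w(0)=w^0$ such that 1. for every $t\in(0,T)$, $w$ is differentiable at $t$ in the norm of $H_0^{-2}$, with derivative $\Delta w(\cdot,t)$; 2. for almost every $t\in(0,T)$ the distribution $w_{x_1}(\cdot,t)\in H_0^{-1}$ has the value $u(t)\delta\in H^{-1}(\mathbb R)$ on the line $x_1=0$, and the limit defining this value also holds in the sense of distributions in $t$: for all $\varphi\in H^1(\mathbb R)$, $\psi\in C_c^\infty(\mathbb R_+)$ and $\theta\in C_c^\infty(0,T)$, $$\int_0^T\theta(t)\,\big(w_{x_1}(\cdot,t)\big)_\alpha(\varphi,\psi)\,dt\ \longrightarrow\ \varphi(0)\int_0^\infty\psi(x)\,dx\int_0^T\theta(t)u(t)\,dt\qquad(\alpha\to0^+).$$ *System (B).* For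 $W^0\in L^2(\mathbb R^2)$ even in $x_1$, a solution of $$W_t=\Delta W-2\delta u(t)\ \ (0<t<T),\qquad W(\cdot,0)=W^0$$ is a function $W\in C([0,T];L^2(\mathbb R^2))$ with $W(0)=W^0$, with $W(\cdot,t)$ even in $x_1$ for all $t\in[0,T]$, which is absolutely continuous on $[0,T]$ with values in $H^{-2}(\mathbb R^2)$ and for almost every $t\in(0,T)$ has there the derivative $\Delta W(\cdot,t)-2u(t)\delta$, where $\delta$ is the Dirac distribution at the origin of $\mathbb R^2$. Then systems (A) and (B) are equivalent: 1. Let $w^0\in L^2(\mathbb R_+\times\mathbb R)$. If $w$ is a solution of (A), then its even extension $W$ with respect to $x_1$ is a solution of (B), with $W^0$ the even extension of $w^0$. 2. Let $W^0\in L^2(\mathbb R^2)$ be even in $x_1$. If $W$ is a solution of (B), then its restriction $w$ to $\mathbb R_+\times\mathbb R\times[0,T]$ is a solution of (A), with $w^0$ the restriction of $W^0$. -/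

import Mathlib

open MeasureTheory Set Filter Topology TopologicalSpace
open scoped Distributions LineDeriv ENNReal

noncomputable section
namespace HalfPlaneHeat

/-- The space `L²(U)` of complex-valued functions on the open set `U`. -/
abbrev L2 {E : Type*} [NormedAddCommGroup E] [MeasureSpace E] (U : Opens E) : Type _ :=
  Lp ℂ 2 (volume.restrict (U : Set E))

/-- The bilinear pairing `⟨f, g⟩ = ∫_U f g` on `L²(U)`. -/
def pairing {E : Type*} [NormedAddCommGroup E] [MeasureSpace E] (U : Opens E) :
    L2 U →L[ℂ] L2 U →L[ℂ] ℂ :=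
  (ContinuousLinearMap.mul ℂ ℂ).lpPairing (volume.restrict (U : Set E)) 2 2

theorem pairing_apply {E : Type*} [NormedAddCommGroup E] [MeasureSpace E] (U : Opens E)
    (f g : L2 U) : pairing U f g = ∫ x in (U : Set E), f x * g x := by
  simp [pairing, ContinuousLinearMap.lpPairing_eq_integral]

theorem memLp_testFunction {E : Type*} [NormedAddCommGroup E] [NormedSpace ℝ E] [MeasureSpace E]
    [OpensMeasurableSpace E] [IsFiniteMeasureOnCompacts (volume : Measure E)]
    {U : Opens E} (p : ℝ≥0∞) (η : 𝓓(U, ℂ)) (μ : Measure E) [IsFiniteMeasureOnCompacts μ] : MemLp η p μ :=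
  η.continuous.memLp_of_hasCompactSupport η.hasCompactSupport

/-- `∂^(a,b) η = ∂₁^a ∂₂^b η` for a test function `η` of two variables. -/
def testDeriv {U : Opens (ℝ × ℝ)} (a b : ℕ) (η : 𝓓(U, ℂ)) : 𝓓(U, ℂ) :=
  (fun ζ : 𝓓(U, ℂ) => ∂_{((1, 0) : ℝ × ℝ)} ζ)^[a] ((fun ζ : 𝓓(U, ℂ) => ∂_{((0, 1) : ℝ × ℝ)} ζ)^[b] η)

/-- The `k`-th derivative of a test function of one variable. -/
def testDeriv₁ {U : Opens ℝ} (k : ℕ) (η : 𝓓(U, ℂ)) : 𝓓(U, ℂ) :=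
  (fun ζ : 𝓓(U, ℂ) => ∂_{(1 : ℝ)} ζ)^[k] η

/-- `g` is the weak (distributional) derivative `∂^(a,b) f` on `U`. -/
def IsWeakDeriv {U : Opens (ℝ × ℝ)} (a b : ℕ) (f g : L2 U) : Prop :=
  ∀ η : 𝓓(U, ℂ), ∫ x in (U : Set (ℝ × ℝ)), f x * testDeriv a b η x =
    (-1) ^ (a + b) * ∫ x in (U : Set (ℝ × ℝ)), g x * η x

/-- `g` is the `k`-th weak derivative of `f` on `U`. -/
def IsWeakDeriv₁ {U : Opens ℝ} (k : ℕ) (f g : L2 U) : Prop :=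
  ∀ η : 𝓓(U, ℂ), ∫ x in (U : Set ℝ), f x * testDeriv₁ k η x =
    (-1) ^ k * ∫ x in (U : Set ℝ), g x * η x

/-- Multi-indices `(a, b)` with `a + b ≤ s`. -/
abbrev MultiIndex (s : ℕ) : Type := {α : Fin (s + 1) × Fin (s + 1) // (α.1 : ℕ) + α.2 ≤ s}

def multiIndex {s : ℕ} (a b : ℕ) (h : a + b ≤ s) : MultiIndex s :=
  ⟨(⟨a, by omega⟩, ⟨b, by omega⟩), h⟩

theorem integrable_mul_test {E : Type*} [NormedAddCommGroup E] [NormedSpace ℝ E] [MeasureSpace E]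
    [OpensMeasurableSpace E] [IsFiniteMeasureOnCompacts (volume : Measure E)]
    {U : Opens E} (f : L2 U) (η : 𝓓(U, ℂ)) : 
    Integrable (fun x => f x * η x) (volume.restrict (U : Set E)) := 
  (Lp.memLp f).integrable_mul (memLp_testFunction 2 η _)

theorem integral_add_mul_test {E : Type*} [NormedAddCommGroup E] [NormedSpace ℝ E] [MeasureSpace E]
    [OpensMeasurableSpace E] [IsFiniteMeasureOnCompacts (volume : Measure E)]
    {U : Opens E} (f g : L2 U) (η : 𝓓(U, ℂ)) : 
    ∫ x in (U : Set E), (f + g : L2 U) x * η x =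
      (∫ x in (U : Set E), f x * η x) + ∫ x in (U : Set E), g x * η x := by
  rw [← integral_add (integrable_mul_test f η) (integrable_mul_test g η)]
  refine integral_congr_ae ?_
  filter_upwards [Lp.coeFn_add f g] with x hx
  rw [hx, Pi.add_apply, add_mul]

theorem integral_smul_mul_test {E : Type*} [NormedAddCommGroup E] [NormedSpace ℝ E] [MeasureSpace E]
    {U : Opens E} (c : ℂ) (f : L2 U) (η : 𝓓(U, ℂ)) : 
    ∫ x in (U : Set E), (c • f : L2 U) x * η x = c * ∫ x in (U : Set E), f x * η x := by
  rw [← integral_const_mul]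
  refine integral_congr_ae ?_
  filter_upwards [Lp.coeFn_smul c f] with x hx
  rw [hx, Pi.smul_apply, smul_eq_mul, mul_assoc]

theorem integral_zero_mul_test {E : Type*} [NormedAddCommGroup E] [NormedSpace ℝ E] [MeasureSpace E]
    {U : Opens E} (η : 𝓓(U, ℂ)) : 
    ∫ x in (U : Set E), (0 : L2 U) x * η x = 0 := by
  rw [← integral_zero E ℂ (μ := volume.restrict (U : Set E))]
  refine integral_congr_ae ?_
  filter_upwards [Lp.coeFn_zero ℂ 2 (volume.restrict (U : Set E))] with x hx
  rw [hx]; simp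

/-- The Sobolev space `H^s(U)`, for `U` open in the plane: families `(F_α)` in `L²(U)` indexed by
`|α| ≤ s` such that `F_α = ∂^α F_0` weakly. The family is determined by the function `F_0`, and the
norm is `(∑_α ‖∂^α F_0‖²)^(1/2)`, equivalent to the one with binomial weights. -/
def Sobolev (U : Opens (ℝ × ℝ)) (s : ℕ) : Submodule ℂ (PiLp 2 fun _ : MultiIndex s => L2 U) where
  carrier := {F | ∀ α : MultiIndex s,
    IsWeakDeriv α.1.1 α.1.2 (F (multiIndex 0 0 (Nat.zero_le s))) (F α)}
  zero_mem' α η := by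
    simp only [PiLp.zero_apply]
    rw [integral_zero_mul_test, integral_zero_mul_test, mul_zero]
  add_mem' hF hG α η := by
    simp only [PiLp.add_apply, integral_add_mul_test, hF α η, hG α η, mul_add]
  smul_mem' c F hF α η := by
    simp only [PiLp.smul_apply, integral_smul_mul_test, hF α η]; ring

/-- The Sobolev space `H^s(U)` for `U` open in the line. -/
def Sobolev₁ (U : Opens ℝ) (s : ℕ) : Submodule ℂ (PiLp 2 fun _ : Fin (s + 1) => L2 U) where
  carrier := {F | ∀ k : Fin (s + 1), IsWeakDeriv₁ k (F 0) (F k)}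
  zero_mem' k η := by
    simp only [PiLp.zero_apply]
    rw [integral_zero_mul_test, integral_zero_mul_test, mul_zero]
  add_mem' hF hG k η := by
    simp only [PiLp.add_apply, integral_add_mul_test, hF k η, hG k η, mul_add]
  smul_mem' c F hF k η := by
    simp only [PiLp.smul_apply, integral_smul_mul_test, hF k η]; ring

/-- The open half-plane `x₁ > 0`. -/
def halfPlane : Opens (ℝ × ℝ) := ⟨{x | 0 < x.1}, isOpen_lt continuous_const continuous_fst⟩

/-- The trace of `f` on the line `x₁ = 0` is zero: the mean over `0 < x₁ < ε` of
`‖f(x₁, ·)‖²` in `L²(ℝ)` tends to zero. For `f` in `H¹` of the half-plane,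
`x₁ ↦ f(x₁, ·)` is continuous on `[0, ∞)` into `L²(ℝ)`, so this says `f(0⁺, ·) = 0`. -/
def VanishesOnLine (f : L2 halfPlane) : Prop :=
  Tendsto (fun ε : ℝ => ε⁻¹ * ∫ x in {x : ℝ × ℝ | 0 < x.1 ∧ x.1 < ε}, ‖f x‖ ^ 2)
    (𝓝[>] 0) (𝓝 0)

theorem restrict_strip_le (ε : ℝ) : (volume.restrict {x : ℝ × ℝ | 0 < x.1 ∧ x.1 < ε}) ≤
    volume.restrict (halfPlane : Set (ℝ × ℝ)) :=
  Measure.restrict_mono (fun _ hx => hx.1) le_rfl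

theorem integrable_sq_strip (f : L2 halfPlane) (ε : ℝ) :
    Integrable (fun x => ‖f x‖ ^ 2) (volume.restrict {x : ℝ × ℝ | 0 < x.1 ∧ x.1 < ε}) :=
  (((Lp.memLp f).mono_measure (restrict_strip_le ε)).norm).integrable_sq

theorem vanishesOnLine_zero : VanishesOnLine 0 := by
  refine tendsto_const_nhds.congr fun ε => ?_
  have : ∫ x in {x : ℝ × ℝ | 0 < x.1 ∧ x.1 < ε}, ‖(0 : L2 halfPlane) x‖ ^ 2 = 0 := by
    refine integral_eq_zero_of_ae (ae_mono (restrict_strip_le ε) ?_)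
    filter_upwards [Lp.coeFn_zero ℂ 2 (volume.restrict (halfPlane : Set (ℝ × ℝ)))] with x hx
    rw [hx]; simp
  rw [this, mul_zero]

theorem VanishesOnLine.add {f g : L2 halfPlane} (hf : VanishesOnLine f) (hg : VanishesOnLine g) :
    VanishesOnLine (f + g) := by
  have h := (hf.const_mul 2).add (hg.const_mul 2)
  rw [mul_zero, add_zero] at h
  refine squeeze_zero' ?_ ?_ h
  · filter_upwards [self_mem_nhdsWithin] with ε hε
    have : (0 : ℝ) < ε := hε
    positivity
  · filter_upwards [self_mem_nhdsWithin] with ε hε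
    have hε' : (0 : ℝ) < ε := hε
    have : ∫ x in {x : ℝ × ℝ | 0 < x.1 ∧ x.1 < ε}, ‖(f + g : L2 halfPlane) x‖ ^ 2 ≤
        ∫ x in {x : ℝ × ℝ | 0 < x.1 ∧ x.1 < ε}, (2 * ‖f x‖ ^ 2 + 2 * ‖g x‖ ^ 2) := by
      refine integral_mono_ae (integrable_sq_strip _ ε)
        (((integrable_sq_strip f ε).const_mul 2).add ((integrable_sq_strip g ε).const_mul 2)) ?_
      refine ae_mono (restrict_strip_le ε) ?_
      filter_upwards [Lp.coeFn_add f g] with x hx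
      rw [hx, Pi.add_apply]
      nlinarith [norm_add_le (f x) (g x), norm_nonneg (f x), norm_nonneg (g x),
        norm_nonneg (f x + g x), sq_nonneg (‖f x‖ - ‖g x‖)]
    rw [integral_add ((integrable_sq_strip f ε).const_mul 2)
      ((integrable_sq_strip g ε).const_mul 2), integral_const_mul, integral_const_mul] at this
    calc _ ≤ ε⁻¹ * _ := mul_le_mul_of_nonneg_left this (by positivity)
      _ = _ := by ring

theorem VanishesOnLine.smul (c : ℂ) {f : L2 halfPlane} (hf : VanishesOnLine f) :
    VanishesOnLine (c • f) := by
  have h := hf.const_mul (‖c‖ ^ 2)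
  rw [mul_zero] at h
  refine h.congr fun ε => ?_
  have : ∫ x in {x : ℝ × ℝ | 0 < x.1 ∧ x.1 < ε}, ‖(c • f : L2 halfPlane) x‖ ^ 2 =
      ‖c‖ ^ 2 * ∫ x in {x : ℝ × ℝ | 0 < x.1 ∧ x.1 < ε}, ‖f x‖ ^ 2 := by
    rw [← integral_const_mul]
    refine integral_congr_ae (ae_mono (restrict_strip_le ε) ?_)
    filter_upwards [Lp.coeFn_smul c f] with x hx
    rw [hx, Pi.smul_apply, norm_smul, mul_pow]
  rw [this]; ring

/-- The space `H₀^s` on the half-plane: functions `φ` in `H^s` with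
`∂₁^k φ(0⁺, ·) = 0` for `k = 0, …, s - 1`. Its dual is the space of order `-s`. -/
def SobolevZero (s : ℕ) : Submodule ℂ (PiLp 2 fun _ : MultiIndex s => L2 halfPlane) where
  carrier := {F | F ∈ Sobolev halfPlane s ∧
    ∀ (k : ℕ) (hk : k < s), VanishesOnLine (F (multiIndex k 0 (by omega)))}
  zero_mem' := ⟨Submodule.zero_mem _, fun k hk => by simpa using vanishesOnLine_zero⟩
  add_mem' hF hG := ⟨Submodule.add_mem _ hF.1 hG.1, fun k hk => by
    simpa using (hF.2 k hk).add (hG.2 k hk)⟩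
  smul_mem' c F hF := ⟨Submodule.smul_mem _ c hF.1, fun k hk => by
    simpa using (hF.2 k hk).smul c⟩

/-- The normed space with underlying set the submodule `K`. -/
def Space {X : Type*} [NormedAddCommGroup X] [NormedSpace ℂ X] (K : Submodule ℂ X) : Type _ := K

instance {X : Type*} [NormedAddCommGroup X] [NormedSpace ℂ X] (K : Submodule ℂ X) :
    NormedAddCommGroup (Space K) := inferInstanceAs (NormedAddCommGroup K)

instance {X : Type*} [NormedAddCommGroup X] [NormedSpace ℂ X] (K : Submodule ℂ X) :
    NormedSpace ℂ (Space K) := inferInstanceAs (NormedSpace ℂ K)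

/-- The inclusion of `K` in the ambient space. -/
def Space.incl {X : Type*} [NormedAddCommGroup X] [NormedSpace ℂ X] (K : Submodule ℂ X) :
    Space K →L[ℂ] X := K.subtypeL

/-- `Φ ↦ ∂^(a,b) Φ`, from a Sobolev space of order `s ≥ a + b` to `L²`. -/
def coord {U : Opens (ℝ × ℝ)} {s : ℕ} (K : Submodule ℂ (PiLp 2 fun _ : MultiIndex s => L2 U))
    (a b : ℕ) (h : a + b ≤ s) : Space K →L[ℂ] L2 U :=
  (PiLp.proj 2 (fun _ : MultiIndex s => L2 U) (multiIndex a b h)) ∘L Space.incl K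

/-- `φ ↦ φ^(k)`, from a Sobolev space on the line to `L²`. -/
def coord₁ {U : Opens ℝ} {s : ℕ} (K : Submodule ℂ (PiLp 2 fun _ : Fin (s + 1) => L2 U))
    (k : Fin (s + 1)) : Space K →L[ℂ] L2 U :=
  (PiLp.proj 2 (fun _ : Fin (s + 1) => L2 U) k) ∘L Space.incl K

/-- The distributional derivative `∂^(a,b) f` of `f` in `L²(U)`, as an element of the dual of the
space `K` of order `s ≥ a + b`; for `a = b = 0` it is the embedding of `L²(U)` in this dual space. -/
def distDeriv {U : Opens (ℝ × ℝ)} {s : ℕ}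
    (K : Submodule ℂ (PiLp 2 fun _ : MultiIndex s => L2 U)) (a b : ℕ) (h : a + b ≤ s) :
    L2 U →L[ℂ] StrongDual ℂ (Space K) :=
  (-1 : ℂ) ^ (a + b) • ((coord K a b h).precomp ℂ ∘L pairing U)

theorem distDeriv_apply {U : Opens (ℝ × ℝ)} {s : ℕ}
    (K : Submodule ℂ (PiLp 2 fun _ : MultiIndex s => L2 U)) (a b : ℕ) (h : a + b ≤ s)
    (f : L2 U) (Φ : Space K) : distDeriv K a b h f Φ =
      (-1) ^ (a + b) * ∫ x in (U : Set (ℝ × ℝ)), f x * coord K a b h Φ x := by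
  simp [distDeriv, pairing_apply]

theorem coe_top_restrict {E : Type*} [NormedAddCommGroup E] [MeasureSpace E] :
    (volume : Measure E).restrict ((⊤ : Opens E) : Set E) = volume := by simp

theorem map_abs_volume :
    Measure.map (fun x : ℝ => |x|) volume = (2 : ℝ≥0∞) • volume.restrict (Ioi (0 : ℝ)) := by
  ext s hs
  rw [Measure.map_apply measurable_abs hs, Measure.smul_apply, Measure.restrict_apply hs, smul_eq_mul,
    two_mul]
  have h1 : volume ((fun x : ℝ => |x|) ⁻¹' s) =
      volume ((s ∩ Ioi 0) ∪ Neg.neg ⁻¹' (s ∩ Ioi (0 : ℝ))) := by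
    refine measure_congr ?_
    have h0 : ∀ᵐ x : ℝ, x ≠ 0 := by simp [ae_iff]
    filter_upwards [h0] with x hx
    refine propext ?_
    change |x| ∈ s ↔ ((x ∈ s ∧ 0 < x) ∨ (-x ∈ s ∧ 0 < -x))
    rcases lt_or_gt_of_ne hx with h | h
    · rw [abs_of_neg h]
      constructor
      · intro h'; exact Or.inr ⟨h', by linarith⟩
      · rintro (h' | h')
        · linarith [h'.2]
        · exact h'.1
    · rw [abs_of_pos h]
      constructor
      · intro h'; exact Or.inl ⟨h', h⟩
      · rintro (h' | h')
        · exact h'.1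
        · linarith [h'.2]
  rw [h1, measure_union]
  · rw [Measure.measure_preimage_neg]
  · rw [Set.disjoint_left]
    rintro x hx hx'
    have a := hx.2
    have b := hx'.2
    simp only [mem_Ioi] at a b
    linarith
  · exact (hs.inter measurableSet_Ioi).preimage measurable_neg

theorem map_fold_volume :
    Measure.map (fun x : ℝ × ℝ => (|x.1|, x.2)) volume =
      (2 : ℝ≥0∞) • volume.restrict (halfPlane : Set (ℝ × ℝ)) := by
  have h := Measure.map_prod_map (volume : Measure ℝ) (volume : Measure ℝ)
    measurable_abs measurable_id
  have e : (halfPlane : Set (ℝ × ℝ)) = Ioi 0 ×ˢ univ := by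
    ext x; simp [halfPlane]
  rw [e, Measure.volume_eq_prod, ← Measure.prod_restrict, Measure.restrict_univ,
    ← Measure.prod_smul_left, ← map_abs_volume, Measure.map_id] at *
  exact h.symm

theorem memLp_fold (f : L2 halfPlane) :
    MemLp (fun x : ℝ × ℝ => f (|x.1|, x.2)) 2
      (volume.restrict ((⊤ : Opens (ℝ × ℝ)) : Set (ℝ × ℝ))) := by
  rw [coe_top_restrict]
  have h : MemLp f 2 (Measure.map (fun x : ℝ × ℝ => (|x.1|, x.2)) volume) := by
    rw [map_fold_volume]
    exact (Lp.memLp f).smul_measure (by simp)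
  exact h.comp_of_map (by fun_prop)

theorem ae_top_iff {E : Type*} [NormedAddCommGroup E] [MeasureSpace E] {p : E → Prop} :
    (∀ᵐ x ∂(volume.restrict ((⊤ : Opens E) : Set E)), p x) ↔ ∀ᵐ x : E, p x := by
  rw [coe_top_restrict]

/-- The even extension with respect to `x₁`, `x ↦ f(|x₁|, x₂)`. -/
def evenExtension (f : L2 halfPlane) : L2 (⊤ : Opens (ℝ × ℝ)) := (memLp_fold f).toLp _

/-- The restriction of a function on the plane to the half-plane. -/
def restriction (f : L2 (⊤ : Opens (ℝ × ℝ))) : L2 halfPlane :=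
  ((Lp.memLp f).mono_measure (Measure.restrict_mono (subset_univ _) le_rfl)).toLp f

/-- Evenness with respect to `x₁`. -/
def IsEven (f : L2 (⊤ : Opens (ℝ × ℝ))) : Prop :=
  ∀ᵐ x : ℝ × ℝ, f (-x.1, x.2) = f x

/-- The ray `(0, ∞)`. -/
def posRay : Opens ℝ := ⟨Ioi 0, isOpen_Ioi⟩

theorem memLp_tensor {p g : ℝ → ℂ} (hp : MemLp p 2 volume) (hg : MemLp g 2 volume) :
    MemLp (fun x : ℝ × ℝ => p x.1 * g x.2) 2 volume := by
  rw [memLp_two_iff_integrable_sq_norm]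
  · have := (hp.norm.integrable_sq).mul_prod (hg.norm.integrable_sq)
    rw [← Measure.volume_eq_prod] at this
    simpa [mul_pow] using this
  · exact (hp.1.comp_fst).mul (hg.1.comp_snd)

theorem memLp_of_top {h : ℝ → ℂ} (hh : MemLp h 2 (volume.restrict ((⊤ : Opens ℝ) : Set ℝ))) :
    MemLp h 2 volume := by
  rwa [coe_top_restrict] at hh

theorem integral_top {E : Type*} [NormedAddCommGroup E] [MeasureSpace E] (h : E → ℂ) :
    ∫ x in ((⊤ : Opens E) : Set E), h x = ∫ x, h x := by
  rw [coe_top_restrict]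

theorem memLp_line (g : L2 (⊤ : Opens ℝ)) : MemLp g 2 (volume : Measure ℝ) := by
  exact memLp_of_top (Lp.memLp g)

theorem isClosedEmbedding_slice_snd (x : ℝ) :
    IsClosedEmbedding (fun y : ℝ => ((x, y) : ℝ × ℝ)) :=
  (Isometry.of_dist_eq fun a b => by simp [Prod.dist_eq]).isClosedEmbedding

theorem isClosedEmbedding_slice_fst (y : ℝ) :
    IsClosedEmbedding (fun x : ℝ => ((x, y) : ℝ × ℝ)) :=
  (Isometry.of_dist_eq fun a b => by simp [Prod.dist_eq]).isClosedEmbedding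

theorem contDiff_testFunction {E : Type*} [NormedAddCommGroup E] [NormedSpace ℝ E] {U : Opens E}
    (η : 𝓓(U, ℂ)) : ContDiff ℝ ((⊤ : ℕ∞) : WithTop ℕ∞) η := η.contDiff

/-- The slice `y ↦ ζ(x, y)` of a test function. -/
def sliceTest {U : Opens (ℝ × ℝ)} (ζ : 𝓓(U, ℂ)) (x : ℝ) : 𝓓((⊤ : Opens ℝ), ℂ) where
  toFun y := ζ (x, y)
  contDiff' := (contDiff_testFunction ζ).comp (contDiff_prodMk_right x)
  hasCompactSupport' := ζ.hasCompactSupport.comp_isClosedEmbedding (isClosedEmbedding_slice_snd x)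
  tsupport_subset' := subset_univ _

theorem lineDeriv_testFunction_apply {E : Type*} [NormedAddCommGroup E] [NormedSpace ℝ E]
    {U : Opens E} (η : 𝓓(U, ℂ)) (v x : E) : (∂_{v} η) x = fderiv ℝ η x v := by
  rw [TestFunction.lineDerivOp_eq_lineDerivCLM ℝ, TestFunction.lineDerivCLM_apply_of_le (by simp)]
  exact ((contDiff_testFunction η).differentiable (by simp)).differentiableAt.lineDeriv_eq_fderiv

theorem hasDerivAt_slice_fst {U : Opens (ℝ × ℝ)} (ζ : 𝓓(U, ℂ)) (x y : ℝ) :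
    HasDerivAt (fun t : ℝ => ζ (t, y)) ((∂_{((1, 0) : ℝ × ℝ)} ζ) (x, y)) x := by
  rw [lineDeriv_testFunction_apply]
  have h := ((contDiff_testFunction ζ).differentiable (by simp) (x, y)).hasFDerivAt
  exact h.comp_hasDerivAt x ((hasDerivAt_id x).prodMk (hasDerivAt_const x y))

theorem hasDerivAt_slice_snd {U : Opens (ℝ × ℝ)} (ζ : 𝓓(U, ℂ)) (x y : ℝ) :
    HasDerivAt (fun t : ℝ => ζ (x, t)) ((∂_{((0, 1) : ℝ × ℝ)} ζ) (x, y)) y := by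
  rw [lineDeriv_testFunction_apply]
  have h := ((contDiff_testFunction ζ).differentiable (by simp) (x, y)).hasFDerivAt
  exact h.comp_hasDerivAt y ((hasDerivAt_const y x).prodMk (hasDerivAt_id y))

theorem hasDerivAt_testFunction {U : Opens ℝ} (ψ : 𝓓(U, ℂ)) (x : ℝ) :
    HasDerivAt ψ ((∂_{(1 : ℝ)} ψ) x) x := by
  rw [lineDeriv_testFunction_apply]
  exact ((contDiff_testFunction ψ).differentiable (by simp) x).hasFDerivAt.hasDerivAt

theorem lineDeriv_sliceTest {U : Opens (ℝ × ℝ)} (ζ : 𝓓(U, ℂ)) (x : ℝ) :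
    ∂_{(1 : ℝ)} (sliceTest ζ x) = sliceTest (∂_{((0, 1) : ℝ × ℝ)} ζ) x := by
  ext y
  exact (hasDerivAt_testFunction (sliceTest ζ x) y).unique (hasDerivAt_slice_snd ζ x y)

theorem testDeriv₁_sliceTest {U : Opens (ℝ × ℝ)} (b : ℕ) (ζ : 𝓓(U, ℂ)) (x : ℝ) :
    testDeriv₁ b (sliceTest ζ x) = sliceTest (testDeriv 0 b ζ) x := by
  induction b with
  | zero => rfl
  | succ b ih =>
    simp only [testDeriv₁, testDeriv, Function.iterate_succ', Function.iterate_zero, id_eq,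
      Function.comp_apply] at ih ⊢
    rw [ih, lineDeriv_sliceTest]

theorem integrable_tensor_mul {U : Opens (ℝ × ℝ)} (ψ : 𝓓(posRay, ℂ)) (g : L2 (⊤ : Opens ℝ))
    (ζ : 𝓓(U, ℂ)) : Integrable (fun x : ℝ × ℝ => ψ x.1 * g x.2 * ζ x) volume :=
  (memLp_tensor (memLp_testFunction 2 ψ _) (memLp_line g)).integrable_mul
    (memLp_testFunction 2 ζ _)

theorem integral_halfPlane_tensor (ψ : 𝓓(posRay, ℂ)) (g : ℝ → ℂ) (h : ℝ × ℝ → ℂ) :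
    ∫ x in (halfPlane : Set (ℝ × ℝ)), ψ x.1 * g x.2 * h x = ∫ x : ℝ × ℝ, ψ x.1 * g x.2 * h x := by
  refine setIntegral_eq_integral_of_forall_compl_eq_zero fun x hx => ?_
  have : x.1 ∉ tsupport ψ := fun h => hx (ψ.tsupport_subset h)
  rw [image_eq_zero_of_notMem_tsupport this]; simp

theorem tensor_deriv_fst (ψ : 𝓓(posRay, ℂ)) (g : L2 (⊤ : Opens ℝ)) (ζ : 𝓓(halfPlane, ℂ)) :
    ∫ x : ℝ × ℝ, ψ x.1 * g x.2 * (∂_{((1, 0) : ℝ × ℝ)} ζ) x =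
      -∫ x : ℝ × ℝ, (∂_{(1 : ℝ)} ψ) x.1 * g x.2 * ζ x := by
  have h1 := integrable_tensor_mul ψ g (∂_{((1, 0) : ℝ × ℝ)} ζ)
  have h2 := integrable_tensor_mul (∂_{(1 : ℝ)} ψ) g ζ
  rw [Measure.volume_eq_prod] at h1 h2 ⊢
  rw [integral_prod_symm _ h1, integral_prod_symm _ h2, ← integral_neg]
  refine integral_congr_ae (Eventually.of_forall fun y => ?_)
  dsimp only
  have hc : Continuous ψ := ψ.continuous
  set ψ' : 𝓓(posRay, ℂ) := ∂_{(1 : ℝ)} ψ with hψ'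
  have hc' : Continuous ψ' := ψ'.continuous
  have hs : ∀ ξ : 𝓓(halfPlane, ℂ), Continuous fun x : ℝ => ξ (x, y) := fun ξ =>
    ξ.continuous.comp (by fun_prop)
  have key : ∫ x : ℝ, ψ x * (∂_{((1, 0) : ℝ × ℝ)} ζ) (x, y) =
      -∫ x : ℝ, ψ' x * ζ (x, y) := by
    refine integral_mul_deriv_eq_deriv_mul_of_integrable
      (fun x _ => hasDerivAt_testFunction ψ x) (fun x _ => hasDerivAt_slice_fst ζ x y) ?_ ?_ ?_
    · exact (hc.mul (hs _)).integrable_of_hasCompactSupport (ψ.hasCompactSupport.mul_right)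
    · exact (hc'.mul (hs _)).integrable_of_hasCompactSupport
        (ψ'.hasCompactSupport.mul_right)
    · exact (hc.mul (hs _)).integrable_of_hasCompactSupport (ψ.hasCompactSupport.mul_right)
  calc ∫ x : ℝ, ψ x * g y * (∂_{((1, 0) : ℝ × ℝ)} ζ) (x, y)
      = g y * ∫ x : ℝ, ψ x * (∂_{((1, 0) : ℝ × ℝ)} ζ) (x, y) := by
        rw [← integral_const_mul]; congr 1; ext x; ring
    _ = -∫ x : ℝ, ψ' x * g y * ζ (x, y) := by
        rw [key, mul_neg, ← integral_const_mul]; congr 2; ext x; ring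

theorem tensor_deriv_fst_iterate (a : ℕ) (ψ : 𝓓(posRay, ℂ)) (g : L2 (⊤ : Opens ℝ))
    (ζ : 𝓓(halfPlane, ℂ)) :
    ∫ x : ℝ × ℝ, ψ x.1 * g x.2 * testDeriv a 0 ζ x =
      (-1) ^ a * ∫ x : ℝ × ℝ, testDeriv₁ a ψ x.1 * g x.2 * ζ x := by
  induction a generalizing ψ with
  | zero => simp [testDeriv, testDeriv₁]
  | succ a ih =>
    have e1 : testDeriv (a + 1) 0 ζ = ∂_{((1, 0) : ℝ × ℝ)} (testDeriv a 0 ζ) := by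
      simp only [testDeriv, Function.iterate_succ', Function.comp_apply, Function.iterate_zero, id_eq]
    have e2 : testDeriv₁ (a + 1) ψ = testDeriv₁ a (∂_{(1 : ℝ)} ψ) := by
      simp only [testDeriv₁, Function.iterate_succ, Function.comp_apply]
    rw [e1, e2, tensor_deriv_fst, ih]
    ring

theorem tensor_deriv_snd {s : ℕ} (ψ : 𝓓(posRay, ℂ)) (φ : Space (Sobolev₁ ⊤ s)) (b : Fin (s + 1))
    (ζ : 𝓓(halfPlane, ℂ)) :
    ∫ x : ℝ × ℝ, ψ x.1 * coord₁ (Sobolev₁ ⊤ s) 0 φ x.2 * testDeriv 0 b ζ x =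
      (-1) ^ (b : ℕ) * ∫ x : ℝ × ℝ, ψ x.1 * coord₁ (Sobolev₁ ⊤ s) b φ x.2 * ζ x := by
  have h1 := integrable_tensor_mul ψ (coord₁ (Sobolev₁ ⊤ s) 0 φ) (testDeriv 0 b ζ)
  have h2 := integrable_tensor_mul ψ (coord₁ (Sobolev₁ ⊤ s) b φ) ζ
  rw [Measure.volume_eq_prod] at h1 h2 ⊢
  rw [integral_prod _ h1, integral_prod _ h2, ← integral_const_mul]
  refine integral_congr_ae (Eventually.of_forall fun x => ?_)
  dsimp only
  have key : ∫ y in ((⊤ : Opens ℝ) : Set ℝ), coord₁ (Sobolev₁ ⊤ s) 0 φ y *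
      testDeriv₁ b (sliceTest ζ x) y = (-1) ^ (b : ℕ) *
        ∫ y in ((⊤ : Opens ℝ) : Set ℝ), coord₁ (Sobolev₁ ⊤ s) b φ y * sliceTest ζ x y :=
    φ.2 b (sliceTest ζ x)
  rw [testDeriv₁_sliceTest, integral_top, integral_top] at key
  calc ∫ y : ℝ, ψ x * coord₁ (Sobolev₁ ⊤ s) 0 φ y * testDeriv 0 b ζ (x, y)
      = ψ x * ∫ y : ℝ, coord₁ (Sobolev₁ ⊤ s) 0 φ y * sliceTest (testDeriv 0 b ζ) x y := by
        rw [← integral_const_mul]; congr 1; ext y; rw [mul_assoc]; rfl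
    _ = (-1) ^ (b : ℕ) * ∫ y : ℝ, ψ x * coord₁ (Sobolev₁ ⊤ s) b φ y * ζ (x, y) := by
        rw [key, mul_left_comm, ← integral_const_mul]; congr 2; ext y; rw [mul_assoc]; rfl

/-- The function `ψ^(a)(x₁) φ^(b)(x₂)` on the half-plane. -/
def tensorCoord {s : ℕ} (ψ : 𝓓(posRay, ℂ)) (φ : Space (Sobolev₁ ⊤ s)) (α : MultiIndex s) : L2 halfPlane :=
  ((memLp_tensor (memLp_testFunction 2 (testDeriv₁ α.1.1 ψ) _) (memLp_line (coord₁ (Sobolev₁ ⊤ s) α.1.2 φ))).mono_measure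
    Measure.restrict_le_self).toLp (fun x : ℝ × ℝ => testDeriv₁ α.1.1 ψ x.1 * coord₁ (Sobolev₁ ⊤ s) α.1.2 φ x.2)

theorem tensorCoord_ae {s : ℕ} (ψ : 𝓓(posRay, ℂ)) (φ : Space (Sobolev₁ ⊤ s)) (α : MultiIndex s) :
    tensorCoord ψ φ α =ᵐ[volume.restrict (halfPlane : Set (ℝ × ℝ))]
      fun x : ℝ × ℝ => testDeriv₁ α.1.1 ψ x.1 * coord₁ (Sobolev₁ ⊤ s) α.1.2 φ x.2 := MemLp.coeFn_toLp _

theorem isWeakDeriv_tensorCoord {s : ℕ} (ψ : 𝓓(posRay, ℂ)) (φ : Space (Sobolev₁ ⊤ s)) (α : MultiIndex s) :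
    IsWeakDeriv α.1.1 α.1.2 (tensorCoord ψ φ (multiIndex 0 0 (Nat.zero_le s)))
      (tensorCoord ψ φ α) := by
  intro η
  have e (β : MultiIndex s) (h : 𝓓(halfPlane, ℂ)) :
      ∫ x in (halfPlane : Set (ℝ × ℝ)), tensorCoord ψ φ β x * h x =
        ∫ x : ℝ × ℝ, testDeriv₁ β.1.1 ψ x.1 * coord₁ (Sobolev₁ ⊤ s) β.1.2 φ x.2 * h x := by
    rw [← integral_halfPlane_tensor]
    refine integral_congr_ae ?_
    filter_upwards [tensorCoord_ae ψ φ β] with x hx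
    rw [hx]
  have e0 : testDeriv α.1.1 α.1.2 η = testDeriv α.1.1 0 (testDeriv 0 α.1.2 η) := rfl
  rw [e, e, e0]
  have := tensor_deriv_fst_iterate α.1.1 ψ (coord₁ (Sobolev₁ ⊤ s) 0 φ) (testDeriv 0 α.1.2 η)
  rw [tensor_deriv_snd] at this
  rw [pow_add, mul_assoc]
  exact this

theorem vanishesOnLine_tensorCoord {s : ℕ} (ψ : 𝓓(posRay, ℂ)) (φ : Space (Sobolev₁ ⊤ s))
    (α : MultiIndex s) : VanishesOnLine (tensorCoord ψ φ α) := by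
  set ψ' := testDeriv₁ α.1.1 ψ with hψ'
  have h0 : (0 : ℝ) ∈ (tsupport ψ')ᶜ := fun h => lt_irrefl (0 : ℝ) (ψ'.tsupport_subset h)
  have hn : (tsupport ψ')ᶜ ∈ 𝓝 (0 : ℝ) := (isClosed_tsupport ψ').isOpen_compl.mem_nhds h0
  obtain ⟨δ, hδ, hb⟩ := Metric.mem_nhds_iff.1 hn
  refine tendsto_const_nhds.congr' ?_
  filter_upwards [Ioo_mem_nhdsGT hδ] with ε hε
  have : ∫ x in {x : ℝ × ℝ | 0 < x.1 ∧ x.1 < ε}, ‖tensorCoord ψ φ α x‖ ^ 2 = 0 := by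
    refine integral_eq_zero_of_ae ?_
    have hm : MeasurableSet {x : ℝ × ℝ | 0 < x.1 ∧ x.1 < ε} :=
      (measurableSet_lt measurable_const measurable_fst).inter
        (measurableSet_lt measurable_fst measurable_const)
    filter_upwards [ae_mono (restrict_strip_le ε) (tensorCoord_ae ψ φ α), ae_restrict_mem hm]
      with x hx hx0
    have : x.1 ∈ (tsupport ψ')ᶜ := hb (by
      rw [Metric.mem_ball, Real.dist_eq, sub_zero, abs_of_pos hx0.1]; exact hx0.2.trans hε.2)
    rw [hx, ← hψ', image_eq_zero_of_notMem_tsupport this]; simp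
  rw [this, mul_zero]

/-- The function `ψ(x₁) φ(x₂)`, `ψ` a test function on `(0, ∞)` and `φ` in `H^s(ℝ)`, as an element
of the space `H₀^s` on the half-plane. -/
def tensor {s : ℕ} (ψ : 𝓓(posRay, ℂ)) (φ : Space (Sobolev₁ ⊤ s)) : Space (SobolevZero s) :=
  ⟨WithLp.toLp 2 fun α => tensorCoord ψ φ α,
    fun α => isWeakDeriv_tensorCoord ψ φ α, fun _ _ => vanishesOnLine_tensorCoord ψ φ _⟩

/-- The test function `x ↦ α⁻¹ ψ(x / α)`, for `α > 0`. -/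
def dilate (α : ℝ) (ψ : 𝓓(posRay, ℂ)) : 𝓓(posRay, ℂ) :=
  if hα : 0 < α then
    { toFun := fun x => (α : ℂ)⁻¹ * ψ (α⁻¹ * x)
      contDiff' := contDiff_const.mul ((contDiff_testFunction ψ).comp (contDiff_const.mul contDiff_id))
      hasCompactSupport' := (ψ.hasCompactSupport.comp_homeomorph
        (Homeomorph.mulLeft₀ α⁻¹ (inv_ne_zero hα.ne'))).mul_left
      tsupport_subset' := by
        refine (tsupport_mul_subset_right).trans fun x hx => ?_
        have h := tsupport_comp_subset_preimage ψ (f := fun x : ℝ => α⁻¹ * x) (by fun_prop) hx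
        have h' : 0 < α⁻¹ * x := ψ.tsupport_subset h
        exact (mul_pos_iff_of_pos_left (inv_pos.2 hα)).1 h' }
  else 0

/-- The distribution `f` in the dual of `H₀^s` has the value `f₀`, an element of the dual of `H^s(ℝ)`,
on the line `x₁ = 0`: for all `φ` in `H^s(ℝ)` and all test functions `ψ` on `(0, ∞)`,
`⟨⟨f(α x₁, x₂), φ(x₂)⟩, ψ(x₁)⟩ → ⟨f₀, φ⟩ ∫ ψ` as `α → 0⁺`, where `f(α x₁, x₂)` is tested with
`ψ(x₁)` by testing `f` with `α⁻¹ ψ(x₁ / α)`. -/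
def HasValueOnLine {s : ℕ} (f : StrongDual ℂ (Space (SobolevZero s))) (f₀ : StrongDual ℂ (Space (Sobolev₁ ⊤ s))) :
    Prop :=
  ∀ (φ : Space (Sobolev₁ ⊤ s)) (ψ : 𝓓(posRay, ℂ)),
    Tendsto (fun α : ℝ => f (tensor (dilate α ψ) φ)) (𝓝[>] 0) (𝓝 (f₀ φ * ∫ x : ℝ, ψ x))

/-- The function equal to `exp x` for `x ≤ 0` and to `0` for `x > 0`. -/
def expRay (x : ℝ) : ℂ := (Iic (0 : ℝ)).indicator (fun t => (Real.exp t : ℂ)) x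

theorem memLp_expRay : MemLp expRay 2 volume := by
  have hm : AEStronglyMeasurable expRay volume := by
    refine (StronglyMeasurable.indicator ?_ measurableSet_Iic).aestronglyMeasurable
    exact (by fun_prop : Continuous fun t : ℝ => (Real.exp t : ℂ)).stronglyMeasurable
  rw [memLp_two_iff_integrable_sq_norm hm]
  have h : Integrable ((Iic (0 : ℝ)).indicator fun t => Real.exp (2 * t)) volume :=
    (integrableOn_exp_mul_Iic (by norm_num) 0).integrable_indicator measurableSet_Iic
  refine h.congr (Eventually.of_forall fun x => ?_)
  by_cases hx : x ∈ Iic (0 : ℝ)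
  · simp only [expRay, indicator_of_mem hx, Complex.norm_real, Real.norm_eq_abs, Real.abs_exp]
    rw [← Real.exp_nat_mul]; norm_num
  · simp [expRay, indicator_of_notMem hx]

/-- The Dirac distribution at `0` in the dual of `H¹(ℝ)`. On `H¹(ℝ)` it is
`φ ↦ ∫_{x < 0} e^x (φ + φ')`; that this is `φ(0)` for test functions is `delta₁_apply`. -/
def delta₁ : StrongDual ℂ (Space (Sobolev₁ ⊤ 1)) :=
  (pairing ⊤ ((memLp_expRay.mono_measure Measure.restrict_le_self).toLp expRay)) ∘L
    (coord₁ (Sobolev₁ ⊤ 1) 0 + coord₁ (Sobolev₁ ⊤ 1) 1)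

/-- The Dirac distribution at the origin in the dual of `H²(ℝ²)`. On `H²(ℝ²)` it is
`Φ ↦ ∫_{x₁, x₂ < 0} e^(x₁ + x₂) (Φ + ∂₁Φ + ∂₂Φ + ∂₁∂₂Φ)`; that this is `Φ(0)` for test functions is
`delta_apply`. -/
def delta : StrongDual ℂ (Space (Sobolev ⊤ 2)) :=
  (pairing ⊤ (((memLp_tensor memLp_expRay memLp_expRay).mono_measure
      Measure.restrict_le_self).toLp fun x : ℝ × ℝ => expRay x.1 * expRay x.2)) ∘L
    (coord (Sobolev ⊤ 2) 0 0 (by norm_num) + coord (Sobolev ⊤ 2) 1 0 (by norm_num) +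
      coord (Sobolev ⊤ 2) 0 1 (by norm_num) + coord (Sobolev ⊤ 2) 1 1 (by norm_num))

theorem integral_expRay_mul {f f' : ℝ → ℂ} (hd : ∀ x, HasDerivAt f (f' x) x)
    (hf' : Continuous f') (hf : HasCompactSupport f) :
    ∫ x, expRay x * (f x + f' x) = f 0 := by
  have hg : ∀ x, HasDerivAt (fun x : ℝ => (Real.exp x : ℂ) * f x)
      ((Real.exp x : ℂ) * (f x + f' x)) x := fun x => by
    have := ((Real.hasDerivAt_exp x).ofReal_comp).mul (hd x)
    rw [← mul_add] at this
    exact this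
  have hc : Continuous f := continuous_iff_continuousAt.2 fun x => (hd x).continuousAt
  have hde : deriv (fun x : ℝ => (Real.exp x : ℂ) * f x) =
      fun x => (Real.exp x : ℂ) * (f x + f' x) := funext fun x => (hg x).deriv
  have h1 : ContDiff ℝ 1 (fun x : ℝ => (Real.exp x : ℂ) * f x) := by
    rw [contDiff_one_iff_deriv, hde]
    exact ⟨fun x => (hg x).differentiableAt, by fun_prop⟩
  have h2 := HasCompactSupport.integral_Iic_deriv_eq h1 hf.mul_left 0
  rw [hde] at h2
  simp only [Real.exp_zero, Complex.ofReal_one, one_mul] at h2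
  rw [← h2, ← integral_indicator measurableSet_Iic]
  congr 1
  ext x
  by_cases hx : x ∈ Iic (0 : ℝ)
  · simp only [expRay, indicator_of_mem hx]
  · simp only [expRay, indicator_of_notMem hx, zero_mul]

theorem delta₁_apply (φ : Space (Sobolev₁ ⊤ 1)) (η : 𝓓((⊤ : Opens ℝ), ℂ))
    (h : ∀ k : Fin 2, coord₁ (Sobolev₁ ⊤ 1) k φ =ᵐ[volume] testDeriv₁ k η) : delta₁ φ = η 0 := by
  have e : delta₁ φ = pairing ⊤ ((memLp_expRay.mono_measure Measure.restrict_le_self).toLp expRay)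
      (coord₁ (Sobolev₁ ⊤ 1) 0 φ + coord₁ (Sobolev₁ ⊤ 1) 1 φ) := rfl
  rw [e, pairing_apply, integral_top, ← integral_expRay_mul (fun x => hasDerivAt_testFunction η x)
    (TestFunction.continuous _) η.hasCompactSupport]
  refine integral_congr_ae ?_
  filter_upwards [ae_top_iff.1 (Lp.coeFn_add (coord₁ (Sobolev₁ ⊤ 1) 0 φ) (coord₁ (Sobolev₁ ⊤ 1) 1 φ)), h 0, h 1, ae_top_iff.1
    (MemLp.coeFn_toLp (memLp_expRay.mono_measure Measure.restrict_le_self))] with x h0 h1 h2 h3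
  rw [h0, h3, Pi.add_apply, h1, h2]
  rfl

theorem delta_apply (Φ : Space (Sobolev ⊤ 2)) (η : 𝓓((⊤ : Opens (ℝ × ℝ)), ℂ))
    (h : ∀ (a b : ℕ) (hab : a + b ≤ 2), coord (Sobolev ⊤ 2) a b hab Φ =ᵐ[volume] testDeriv a b η) :
    delta Φ = η 0 := by
  have hm := (memLp_tensor memLp_expRay memLp_expRay).mono_measure
      (Measure.restrict_le_self (s := ((⊤ : Opens (ℝ × ℝ)) : Set (ℝ × ℝ))))
  have e : delta Φ = pairing ⊤ (hm.toLp fun x : ℝ × ℝ => expRay x.1 * expRay x.2)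
      (coord (Sobolev ⊤ 2) 0 0 (by norm_num) Φ + coord (Sobolev ⊤ 2) 1 0 (by norm_num) Φ +
        coord (Sobolev ⊤ 2) 0 1 (by norm_num) Φ + coord (Sobolev ⊤ 2) 1 1 (by norm_num) Φ) := rfl
  set ξ : 𝓓((⊤ : Opens (ℝ × ℝ)), ℂ) := η + ∂_{((0, 1) : ℝ × ℝ)} η with hξ
  set ξ' : 𝓓((⊤ : Opens (ℝ × ℝ)), ℂ) := ∂_{((1, 0) : ℝ × ℝ)} ξ with hξ'
  have hsum : ∫ x in ((⊤ : Opens (ℝ × ℝ)) : Set (ℝ × ℝ)),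
      (hm.toLp fun x : ℝ × ℝ => expRay x.1 * expRay x.2) x *
      (coord (Sobolev ⊤ 2) 0 0 (by norm_num) Φ + coord (Sobolev ⊤ 2) 1 0 (by norm_num) Φ +
        coord (Sobolev ⊤ 2) 0 1 (by norm_num) Φ + coord (Sobolev ⊤ 2) 1 1 (by norm_num) Φ : L2 ⊤) x =
      ∫ x : ℝ × ℝ, expRay x.1 * expRay x.2 * (ξ + ξ') x := by
    rw [integral_top]
    refine integral_congr_ae ?_
    filter_upwards [ae_top_iff.1 (MemLp.coeFn_toLp hm),
      ae_top_iff.1 (Lp.coeFn_add (coord (Sobolev ⊤ 2) 0 0 (by norm_num) Φ +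
        coord (Sobolev ⊤ 2) 1 0 (by norm_num) Φ + coord (Sobolev ⊤ 2) 0 1 (by norm_num) Φ)
        (coord (Sobolev ⊤ 2) 1 1 (by norm_num) Φ)),
      ae_top_iff.1 (Lp.coeFn_add (coord (Sobolev ⊤ 2) 0 0 (by norm_num) Φ +
        coord (Sobolev ⊤ 2) 1 0 (by norm_num) Φ) (coord (Sobolev ⊤ 2) 0 1 (by norm_num) Φ)),
      ae_top_iff.1 (Lp.coeFn_add (coord (Sobolev ⊤ 2) 0 0 (by norm_num) Φ)
        (coord (Sobolev ⊤ 2) 1 0 (by norm_num) Φ)),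
      h 0 0 (by norm_num), h 1 0 (by norm_num),
      h 0 1 (by norm_num), h 1 1 (by norm_num)]
      with x h1 h2 h3 h4 h5 h6 h7 h8
    rw [h1, h2, Pi.add_apply, h3, Pi.add_apply, h4, Pi.add_apply, h5, h6, h7, h8]
    have a : ξ' = ∂_{((1, 0) : ℝ × ℝ)} η + ∂_{((1, 0) : ℝ × ℝ)} (∂_{((0, 1) : ℝ × ℝ)} η) := by
      rw [hξ', hξ, LineDeriv.lineDerivOp_add]
    rw [a, hξ]
    change _ * (η x + (∂_{((1, 0) : ℝ × ℝ)} η) x + (∂_{((0, 1) : ℝ × ℝ)} η) x +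
      (∂_{((1, 0) : ℝ × ℝ)} (∂_{((0, 1) : ℝ × ℝ)} η)) x) = _ * ((η x + (∂_{((0, 1) : ℝ × ℝ)} η) x) +
      ((∂_{((1, 0) : ℝ × ℝ)} η) x + (∂_{((1, 0) : ℝ × ℝ)} (∂_{((0, 1) : ℝ × ℝ)} η)) x))
    ring
  have hi : Integrable (fun x : ℝ × ℝ => expRay x.1 * expRay x.2 * (ξ + ξ') x) volume :=
    (memLp_tensor memLp_expRay memLp_expRay).integrable_mul (memLp_testFunction 2 (ξ + ξ') _)
  rw [e, pairing_apply, hsum]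
  rw [Measure.volume_eq_prod] at hi ⊢
  rw [integral_prod_symm _ hi]
  have hinner : ∀ y : ℝ, ∫ x : ℝ, expRay x * expRay y * (ξ + ξ') (x, y) = expRay y * ξ (0, y) := by
    intro y
    have h1 := integral_expRay_mul (f := fun x => ξ (x, y)) (f' := fun x => ξ' (x, y))
      (fun x => hasDerivAt_slice_fst ξ x y) (ξ'.continuous.comp (by fun_prop))
      (ξ.hasCompactSupport.comp_isClosedEmbedding (isClosedEmbedding_slice_fst y))
    rw [← h1, ← integral_const_mul]
    congr 1
    ext x
    change _ * (ξ (x, y) + ξ' (x, y)) = _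
    ring
  simp only [hinner]
  have h2 := integral_expRay_mul (f := fun y => η (0, y))
    (f' := fun y => (∂_{((0, 1) : ℝ × ℝ)} η) (0, y))
    (fun y => hasDerivAt_slice_snd η 0 y)
    ((TestFunction.continuous (∂_{((0, 1) : ℝ × ℝ)} η)).comp (by fun_prop))
    (η.hasCompactSupport.comp_isClosedEmbedding (isClosedEmbedding_slice_snd 0))
  exact h2

/-- The interval `(0, T)`. -/
def timeInterval (T : ℝ) : Opens ℝ := ⟨Ioo 0 T, isOpen_Ioo⟩

/-- The distributional Laplacian of `f` in `L²(U)`, as an element of the dual of `K`, a space of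
order `2`. -/
def laplacian {U : Opens (ℝ × ℝ)} (K : Submodule ℂ (PiLp 2 fun _ : MultiIndex 2 => L2 U)) :
    L2 U →L[ℂ] StrongDual ℂ (Space K) :=
  distDeriv K 2 0 (by norm_num) + distDeriv K 0 2 (by norm_num)

/-- `w` is a solution on `[0, T]` of `w_t = Δ w` for `x₁ > 0`, `w_{x₁}(0⁺, ·, t) = δ u(t)`,
`w(·, 0) = w₀`. Here `w` is continuous into `L²`, the time derivative is taken in the norm of the dual
of `H₀²`, and `w_{x₁}(·, t)` is an element of the dual of `H₀¹`. The boundary condition holds for almost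
every `t`, as an equality between values of distributions on the line `x₁ = 0`, and the limit that
defines this value also exists, with the same value, in the sense of distributions in `t`.
(The almost-everywhere condition alone does not see a flux through the boundary that is singular in
time, such as one given by the Cantor measure.) -/
structure IsHalfPlaneSolution (T : ℝ) (u : ℝ → ℂ) (w₀ : L2 halfPlane) (w : ℝ → L2 halfPlane) :
    Prop where
  continuousOn : ContinuousOn w (Icc 0 T)
  heat : ∀ t ∈ Ioo 0 T,
    HasDerivAt (fun τ => distDeriv (SobolevZero 2) 0 0 (by norm_num) (w τ))
      (laplacian (SobolevZero 2) (w t)) t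
  boundary_ae : ∀ᵐ t ∂(volume.restrict (Ioo 0 T)),
    HasValueOnLine (distDeriv (SobolevZero 1) 1 0 (by norm_num) (w t)) (u t • delta₁)
  boundary_distrib : ∀ (φ : Space (Sobolev₁ ⊤ 1)) (ψ : 𝓓(posRay, ℂ)) (θ : 𝓓(timeInterval T, ℂ)),
    Tendsto (fun α : ℝ => ∫ t in Ioo 0 T,
        θ t * distDeriv (SobolevZero 1) 1 0 (by norm_num) (w t) (tensor (dilate α ψ) φ))
      (𝓝[>] 0) (𝓝 (∫ t in Ioo 0 T, θ t * ((u t • delta₁) φ * ∫ x : ℝ, ψ x)))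
  initial : w 0 = w₀

/-- `W` is a solution on `[0, T]` of `W_t = Δ W - 2 δ u(t)` on the plane, `W(·, 0) = W₀`: `W(·, t)` is
even with respect to `x₁` and continuous in `t` into `L²`; it is absolutely continuous in `t` into
`H^(-2)(ℝ²)`, the dual of `H²(ℝ²)`, and its derivative in this space is `Δ W - 2 δ u(t)` for almost
every `t`. -/
structure IsPlaneSolution (T : ℝ) (u : ℝ → ℂ) (W₀ : L2 (⊤ : Opens (ℝ × ℝ)))
    (W : ℝ → L2 (⊤ : Opens (ℝ × ℝ))) : Prop where
  even : ∀ t ∈ Icc 0 T, IsEven (W t)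
  continuousOn : ContinuousOn W (Icc 0 T)
  absolutelyContinuous : AbsolutelyContinuousOnInterval
    (fun τ => distDeriv (Sobolev ⊤ 2) 0 0 (by norm_num) (W τ)) 0 T
  heat : ∀ᵐ t ∂(volume.restrict (Ioo 0 T)),
    HasDerivAt (fun τ => distDeriv (Sobolev ⊤ 2) 0 0 (by norm_num) (W τ))
      (laplacian (Sobolev ⊤ 2) (W t) - (2 * u t) • delta) t
  initial : W 0 = W₀

end HalfPlaneHeat

end

open HalfPlaneHeat

set_option linter.unusedSectionVars false

/-! The source `-2 u δ` is the jump of `∂₁W` across the line `x₁ = 0`: an even function has opposite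
normal derivatives on the two sides, so the prescribed flux `u δ` is counted twice.

From the half-plane to the plane. Pairing the even extension of `w` with a test function `ζ` amounts
to pairing `w` with `ζ(x₁, x₂) + ζ(-x₁, x₂)` on the half-plane. The normal derivative of this sum
vanishes on the line, but its trace `q` does not, so it is not admissible in `H₀²`. Subtract the
corrector `g(x₁/α) q(x₂)`, where `g` is even, `g' = -ψ` for positive arguments and `∫ ψ = 1`, so
that `g(0) = 1` and `g'(0) = 0`. The heat equation can be tested with the difference. As `α → 0` the
corrector is `O(√α)` in `L²`, while `w` paired with its second normal derivative is exactly the flux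
averaged by `α⁻¹ ψ(x₁/α)`, which tends to `u q(0) = 2 u ζ(0)` in the sense of distributions in time.
Hence `⟨W, ζ⟩` has the weak time derivative `⟨W, Δζ⟩ - 2 u ζ(0)` (`IsHalfPlaneSolution.weak_deriv`).
A continuous function with integrable weak derivative is its integral
(`sub_eq_integral_of_weak_deriv`), and mollification (`Mollifies.eq_zero`) carries the resulting
identity from test functions to all of `H²`. This integrated identity is what the plane system says
(`IsPlaneSolution.sub_eq_planePrimitive`, `isPlaneSolution_of_sub_eq`).

From the plane to the half-plane. Extension by zero maps `H₀²` into `H²(ℝ²)`, and `delta` vanishes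
on its image; so the integrated equation restricts to the half-plane without source
(`IsPlaneSolution.restriction_sub_eq`), and continuity of the integrand gives the time derivative at
every `t`. For the boundary value, testing with the backward heat kernel gives Duhamel's formula
(`IsPlaneSolution.integral_mul_tensor`). After parabolic scaling the averaged flux at time `t` is a
term `O(√α)` from the initial value minus `∫₀^∞ u(t - α² r) N(r) H(α² r) dr`
(`IsPlaneSolution.flux_restriction`). Here `H(τ)` is the value at `0` of the heat flow of `φ` on the
line, which tends to `φ(0)`, and `N` is the same for `g''`. Since `N` is the time derivative of the
heat flow of `g` at `0` and is `O(r^(-3/2))`, it is integrable with integral `-g(0) = -∫ ψ`. At a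
Lebesgue point of `u` the flux therefore tends to `u(t) φ(0) ∫ ψ`. The same formula bounds the flux
uniformly in `α` for `t` away from `0`, and dominated convergence gives the limit in the sense of
distributions in time. -/

noncomputable section
namespace HalfPlaneHeat

/-! ### Correlations of square integrable functions and approximate identities -/

section Correlation

variable {E : Type*} [NormedAddCommGroup E] [NormedSpace ℝ E] [FiniteDimensional ℝ E]
  [MeasureSpace E] [BorelSpace E] [(volume : Measure E).IsAddHaarMeasure]

theorem integral_norm_mul_le {α : Type*} {m : MeasurableSpace α} {μ : Measure α} {f g : α → ℂ}
    (hf : MemLp f 2 μ) (hg : MemLp g 2 μ) :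
    ∫ y, ‖f y * g y‖ ∂μ ≤ lpNorm f 2 μ * lpNorm g 2 μ := by
  have h1 := eLpNorm_smul_le_mul_eLpNorm (p := 2) (q := 2) (r := 1) hg.1 hf.1
  rw [← toReal_eLpNorm hf.1, ← toReal_eLpNorm hg.1, ← ENNReal.toReal_mul,
    integral_norm_eq_lintegral_enorm (f := fun y => f y * g y) (hf.1.mul hg.1)]
  refine ENNReal.toReal_mono (ENNReal.mul_ne_top hf.2.ne hg.2.ne) ?_
  rw [eLpNorm_one_eq_lintegral_enorm] at h1
  exact h1

theorem norm_integral_mul_le {α : Type*} {m : MeasurableSpace α} {μ : Measure α} {f g : α → ℂ}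
    (hf : MemLp f 2 μ) (hg : MemLp g 2 μ) :
    ‖∫ y, f y * g y ∂μ‖ ≤ lpNorm f 2 μ * lpNorm g 2 μ :=
  (norm_integral_le_integral_norm _).trans (integral_norm_mul_le hf hg)

/-- The correlation `z ↦ ∫ f(y + z) g(y) dy` of two functions. -/
def corr (f g : E → ℂ) (z : E) : ℂ := ∫ y, f (y + z) * g y

theorem memLp_translate {f : E → ℂ} {p : ℝ≥0∞} (hf : MemLp f p volume) (z : E) :
    MemLp (fun y => f (y + z)) p volume :=
  hf.comp_measurePreserving (measurePreserving_add_right volume z)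

theorem lpNorm_translate {f : E → ℂ} (hf : MemLp f 2 volume) (z : E) :
    lpNorm (fun y => f (y + z)) 2 volume = lpNorm f 2 volume := by
  rw [← toReal_eLpNorm hf.1, ← toReal_eLpNorm (memLp_translate hf z).1]
  congr 1
  exact eLpNorm_comp_measurePreserving hf.1 (measurePreserving_add_right volume z)

theorem integral_norm_corr_le {f g : E → ℂ} (hf : MemLp f 2 volume) (hg : MemLp g 2 volume) (z : E) :
    ∫ y, ‖f (y + z) * g y‖ ≤ lpNorm f 2 volume * lpNorm g 2 volume := by
  rw [← lpNorm_translate hf z]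
  exact integral_norm_mul_le (memLp_translate hf z) hg

theorem norm_corr_le {f g : E → ℂ} (hf : MemLp f 2 volume) (hg : MemLp g 2 volume) (z : E) :
    ‖corr f g z‖ ≤ lpNorm f 2 volume * lpNorm g 2 volume :=
  (norm_integral_le_integral_norm _).trans (integral_norm_corr_le hf hg z)

theorem corr_zero (f g : E → ℂ) : corr f g 0 = ∫ y, f y * g y := by simp [corr]

/-- Translation is strongly continuous on `L²` because the exponent is finite, and the correlation
is a fixed continuous functional applied to the translates of `f`. -/
theorem continuous_corr {f g : E → ℂ} (hf : MemLp f 2 volume) (hg : MemLp g 2 volume) :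
    Continuous (corr f g) := by
  let L : Lp ℂ 2 (volume : Measure E) →L[ℂ] ℂ :=
    (ContinuousLinearMap.mul ℂ ℂ).lpPairing volume 2 2 |>.flip (hg.toLp g)
  have h2 : Fact ((2 : ℝ≥0∞) ≠ ∞) := ⟨by norm_num⟩
  have hc : Continuous fun z : E => L (DomAddAct.mk z +ᵥ hf.toLp f) := by
    refine L.continuous.comp ?_
    exact DomAddAct.continuous_mk.vadd continuous_const
  refine hc.congr fun z => ?_
  simp only [L, ContinuousLinearMap.flip_apply, ContinuousLinearMap.lpPairing_eq_integral, corr]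
  refine integral_congr_ae ?_
  have h1 : ∀ᵐ y : E, (hf.toLp f) (z + y) = f (z + y) :=
    (quasiMeasurePreserving_add_left volume z).ae hf.coeFn_toLp
  filter_upwards [DomAddAct.vadd_Lp_ae_eq (DomAddAct.mk z) (hf.toLp f), hg.coeFn_toLp, h1]
    with y h1 h2 h3
  rw [h1, h2]
  simp only [ContinuousLinearMap.mul_apply', Equiv.symm_apply_apply, vadd_eq_add]
  rw [h3, add_comm]

theorem integrable_corr_kernel {f g K : E → ℂ} (hf : MemLp f 2 volume) (hg : MemLp g 2 volume)
    (hK : Integrable K volume) :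
    Integrable (Function.uncurry fun z y : E => K z * (f (y + z) * g y))
      ((volume : Measure E).prod volume) := by
  have hm : AEStronglyMeasurable (Function.uncurry fun z y : E => K z * (f (y + z) * g y))
      ((volume : Measure E).prod volume) := by
    have h1 : AEStronglyMeasurable (fun p : E × E => f (p.2 + p.1))
        ((volume : Measure E).prod volume) := by
      have := (hf.1.comp_fst (ν := (volume : Measure E))).comp_measurePreserving
        (measurePreserving_add_prod (volume : Measure E) volume)
      refine this.congr (Eventually.of_forall fun p => ?_)
      simp [Function.comp, add_comm]
    exact hK.1.comp_fst.mul (h1.mul hg.1.comp_snd)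
  rw [integrable_prod_iff hm]
  refine ⟨Eventually.of_forall fun z => ?_, ?_⟩
  · change Integrable (fun y => K z * (f (y + z) * g y)) volume
    exact ((memLp_translate hf z).integrable_mul hg).const_mul _
  · refine (hK.norm.mul_const (lpNorm f 2 volume * lpNorm g 2 volume)).mono'
      hm.norm.integral_prod_right' (Eventually.of_forall fun z => ?_)
    rw [Real.norm_of_nonneg (integral_nonneg fun _ => norm_nonneg _)]
    simp only [Function.uncurry, norm_mul (K z), integral_const_mul]
    exact mul_le_mul_of_nonneg_left (integral_norm_corr_le hf hg z) (norm_nonneg _)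

theorem integral_mul_kernel_translate (f K : E → ℂ) (y : E) :
    ∫ z, f (y + z) * K z = ∫ x, f x * K (x - y) := by
  rw [← integral_add_right_eq_self (fun x => f x * K (x - y)) y]
  simp [add_comm]

theorem integrable_mul_conv {f g K : E → ℂ} (hf : MemLp f 2 volume) (hg : MemLp g 2 volume)
    (hK : Integrable K volume) :
    Integrable (fun y => g y * ∫ x, f x * K (x - y)) volume := by
  refine (integrable_corr_kernel hf hg hK).integral_prod_right.congr
    (Eventually.of_forall fun y => ?_)
  simp only [Function.uncurry]
  rw [← integral_mul_kernel_translate, ← integral_const_mul]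
  congr 1; ext z; ring

/-- Fubini and translation invariance. Smoothing by an integrable kernel thereby becomes an average
of the correlation, a bounded continuous function, so that limits and bounds in the kernel need no
further property of `f` and `g`. -/
theorem integral_mul_conv {f g K : E → ℂ} (hf : MemLp f 2 volume) (hg : MemLp g 2 volume)
    (hK : Integrable K volume) :
    ∫ y, g y * ∫ x, f x * K (x - y) = ∫ z, K z * corr f g z := by
  have h := integral_integral_swap (integrable_corr_kernel hf hg hK)
  simp only [integral_const_mul] at h
  unfold corr
  rw [h]
  congr 1; ext y
  rw [← integral_mul_kernel_translate, ← integral_const_mul]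
  congr 1; ext z; ring

theorem corr_neg (f g : E → ℂ) (z : E) : corr g f (-z) = corr f g z := by
  unfold corr
  rw [← integral_add_right_eq_self (fun y => g (y + -z) * f y) z]
  congr 1; ext y; rw [add_neg_cancel_right, mul_comm]

/-- The same average with the convolution placed on the other factor. Passing between the two forms
is how derivatives of a kernel are moved from one function to the other. -/
theorem integral_mul_conv' {f g K : E → ℂ} (hf : MemLp f 2 volume) (hg : MemLp g 2 volume)
    (hK : Integrable K volume) :
    ∫ x, f x * ∫ y, g y * K (x - y) = ∫ z, K z * corr f g z := by
  have h := integral_mul_conv hg hf (K := fun z => K (-z)) hK.comp_neg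
  simp only [neg_sub] at h
  rw [h, ← integral_neg_eq_self]
  simp only [neg_neg, corr_neg]

/-- Dominated convergence with majorant `C ‖K‖`. It serves both for kernels concentrating at a
point, after rescaling, and for cutoffs `R` flattened by a small factor `c`. -/
theorem tendsto_integral_approx {K R : E → ℂ} {C : ℝ} (hK : Integrable K volume)
    (hR : Continuous R) (hC : ∀ z, ‖R z‖ ≤ C) {ι : Type*} {l : Filter ι} [l.IsCountablyGenerated]
    {c : ι → ℝ} (hc : Tendsto c l (𝓝 0)) :
    Tendsto (fun i => ∫ z, K z * R (c i • z)) l (𝓝 ((∫ z, K z) * R 0)) := by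
  rw [← integral_mul_const]
  refine tendsto_integral_filter_of_dominated_convergence (fun z => ‖K z‖ * C) ?_ ?_
    (hK.norm.mul_const C) ?_
  · exact Eventually.of_forall fun i => hK.1.mul (hR.comp (by fun_prop)).aestronglyMeasurable
  · refine Eventually.of_forall fun i => Eventually.of_forall fun z => ?_
    rw [norm_mul]
    exact mul_le_mul_of_nonneg_left (hC _) (norm_nonneg _)
  · refine Eventually.of_forall fun z => Tendsto.const_mul _ ?_
    have : Tendsto (fun i => c i • z) l (𝓝 0) := by simpa using hc.smul_const z
    exact (hR.tendsto 0).comp this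

end Correlation

/-! ### Dominated convergence and differentiation in L² -/

section Dominated

variable {α : Type*} {m : MeasurableSpace α} {μ : Measure α}

theorem tendsto_toLp_of_dominated {ι : Type*} {l : Filter ι} [l.IsCountablyGenerated]
    {F : ι → α → ℂ} {f : α → ℂ} {B : α → ℝ} (hF : ∀ i, MemLp (F i) 2 μ) (hf : MemLp f 2 μ)
    (hB : MemLp B 2 μ) (hb : ∀ᶠ i in l, ∀ᵐ x ∂μ, ‖F i x‖ ≤ B x)
    (hlim : ∀ᵐ x ∂μ, Tendsto (fun i => F i x) l (𝓝 (f x))) :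
    Tendsto (fun i => (hF i).toLp (F i)) l (𝓝 (hf.toLp f)) := by
  rw [Lp.tendsto_Lp_iff_tendsto_eLpNorm'']
  have e : ∀ g : α → ℂ, eLpNorm g 2 μ = (∫⁻ x, ‖g x‖ₑ ^ (2 : ℝ) ∂μ) ^ (1 / (2 : ℝ)) := fun g => by
    rw [eLpNorm_eq_lintegral_rpow_enorm_toReal (by norm_num) (by norm_num)]; simp
  simp only [e]
  have hS : MemLp (fun x => ‖B x‖ + ‖f x‖) 2 μ := hB.norm.add hf.norm
  have h0 : Tendsto (fun i => ∫⁻ x, ‖(F i - f) x‖ₑ ^ (2 : ℝ) ∂μ) l (𝓝 (∫⁻ _, 0 ∂μ)) := by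
    refine tendsto_lintegral_filter_of_dominated_convergence'
      (fun x => ‖‖B x‖ + ‖f x‖‖ₑ ^ (2 : ℝ)) ?_ ?_ ?_ ?_
    · exact Eventually.of_forall fun i => ((hF i).sub hf).1.enorm.pow_const _
    · filter_upwards [hb] with i hi
      filter_upwards [hi] with x hx
      refine ENNReal.rpow_le_rpow ?_ (by norm_num)
      rw [enorm_le_iff_norm_le, Real.norm_of_nonneg (by positivity)]
      exact (norm_sub_le _ _).trans (add_le_add (hx.trans (le_abs_self _)) le_rfl)
    · have := lintegral_rpow_enorm_lt_top_of_eLpNorm_lt_top (by norm_num) (by norm_num) hS.2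
      simpa using this.ne
    · filter_upwards [hlim] with x hx
      have h1 : Tendsto (fun i => ‖(F i - f) x‖ₑ) l (𝓝 0) := by
        have := (hx.sub_const (f x)).enorm
        simpa using this
      have := (ENNReal.continuous_rpow_const (y := (2 : ℝ))).tendsto 0 |>.comp h1
      simpa [Function.comp_def] using this
  rw [lintegral_zero] at h0
  have := (ENNReal.continuous_rpow_const (y := (1 / (2 : ℝ)))).tendsto 0 |>.comp h0
  simpa [Function.comp_def] using this

/-- The Lipschitz bound makes `B` a square integrable majorant of all difference quotients near `τ`,
so their pointwise convergence is also convergence in `L²`. -/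
theorem hasDerivAt_toLp_of_dominated {F : ℝ → α → ℂ} {F' : α → ℂ} {B : α → ℝ} {τ : ℝ}
    (hF : ∀ σ, MemLp (F σ) 2 μ) (hF' : MemLp F' 2 μ) (hB : MemLp B 2 μ)
    (hb : ∀ᶠ σ in 𝓝 τ, ∀ x, ‖F σ x - F τ x‖ ≤ B x * |σ - τ|)
    (hd : ∀ x, HasDerivAt (fun σ => F σ x) (F' x) τ) :
    HasDerivAt (fun σ => (hF σ).toLp (F σ)) (hF'.toLp F') τ := by
  rw [hasDerivAt_iff_tendsto_slope]
  have hS : ∀ σ, MemLp (fun x => slope (fun σ => F σ x) τ σ) 2 μ := fun σ => by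
    simp only [slope_def_module]
    exact ((hF σ).sub (hF τ)).const_smul (σ - τ)⁻¹
  have h := tendsto_toLp_of_dominated (l := 𝓝[≠] τ) hS hF' hB ?_ ?_
  · refine h.congr fun σ => ?_
    rw [slope_def_module, ← MemLp.toLp_sub, ← MemLp.toLp_const_smul]
    congr 1
  · filter_upwards [hb.filter_mono nhdsWithin_le_nhds, self_mem_nhdsWithin] with σ hσ hne
    refine Eventually.of_forall fun x => ?_
    have h1 : 0 < |σ - τ| := abs_pos.2 (sub_ne_zero.2 hne)
    rw [slope_def_module, norm_smul, norm_inv, Real.norm_eq_abs, inv_mul_le_iff₀ h1, mul_comm]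
    exact hσ x
  · exact Eventually.of_forall fun x => hasDerivAt_iff_tendsto_slope.1 (hd x)

end Dominated

/-! ### Comparison of absolutely continuous functions -/

section AbsolutelyContinuous

/-- The identity map is absolutely continuous, so a Lipschitz part of `f` may be charged to `dist x
y` and the rest to the increments of `g`. -/
theorem absolutelyContinuousOnInterval_of_dist_le {X Y : Type*} [PseudoMetricSpace X]
    [PseudoMetricSpace Y] {f : ℝ → X} {g : ℝ → Y} {a b C : ℝ}
    (hg : AbsolutelyContinuousOnInterval g a b)
    (h : ∀ x ∈ uIcc a b, ∀ y ∈ uIcc a b, dist (f x) (f y) ≤ C * (dist (g x) (g y) + dist x y)) :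
    AbsolutelyContinuousOnInterval f a b := by
  have hid : AbsolutelyContinuousOnInterval (fun x : ℝ => x) a b :=
    (LipschitzWith.id.lipschitzOnWith).absolutelyContinuousOnInterval
  have := (Tendsto.add hg hid).const_mul C
  rw [add_zero, mul_zero] at this
  refine squeeze_zero' (Eventually.of_forall fun E => Finset.sum_nonneg fun _ _ => dist_nonneg) ?_ this
  filter_upwards [mem_inf_of_right (mem_principal_self _)] with E hE
  rw [← Finset.sum_add_distrib, Finset.mul_sum]
  refine Finset.sum_le_sum fun i hi => ?_
  have := hE.1 i hi
  exact h _ this.1 _ this.2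

end AbsolutelyContinuous

/-! ### Continuous functions of time with an integrable weak derivative -/

section WeakDerivative

theorem testFunction_eq_zero {E : Type*} [NormedAddCommGroup E] [NormedSpace ℝ E] {U : Opens E}
    (η : 𝓓(U, ℂ)) {x : E} (hx : x ∉ (U : Set E)) : η x = 0 :=
  image_eq_zero_of_notMem_tsupport fun h => hx (η.tsupport_subset h)

open Real in
theorem smoothTransition_deriv_zero {x : ℝ} (hx : x ∉ Icc (0 : ℝ) 1) :
    deriv smoothTransition x = 0 := by
  have : ∃ c : ℝ, smoothTransition =ᶠ[𝓝 x] fun _ => c := by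
    by_cases h : x < 0
    · exact ⟨0, (gt_mem_nhds h).mono fun y hy => smoothTransition.zero_of_nonpos (le_of_lt hy)⟩
    · have h' : 1 < x := by
        by_contra h'
        exact hx ⟨not_lt.1 h, not_lt.1 h'⟩
      exact ⟨1, (lt_mem_nhds h').mono fun y hy => smoothTransition.one_of_one_le (le_of_lt hy)⟩
  obtain ⟨c, hc⟩ := this
  rw [hc.deriv_eq, deriv_const]

theorem differentiable_smoothTransition : Differentiable ℝ Real.smoothTransition :=
  (Real.smoothTransition.contDiff (n := 1)).differentiable (by simp)

theorem continuous_deriv_smoothTransition : Continuous (deriv Real.smoothTransition) :=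
  (Real.smoothTransition.contDiff (n := 1)).continuous_deriv le_rfl

/-- The derivative of the smooth transition function, with complex values. -/
def transitionDeriv (x : ℝ) : ℂ := ((deriv Real.smoothTransition x : ℝ) : ℂ)

theorem hasDerivAt_smoothTransition (x : ℝ) :
    HasDerivAt (fun x => (Real.smoothTransition x : ℂ)) (transitionDeriv x) x :=
  ((differentiable_smoothTransition x).hasDerivAt).ofReal_comp

theorem integrable_transitionDeriv : Integrable transitionDeriv volume := by
  have h : HasCompactSupport (deriv Real.smoothTransition) :=
    HasCompactSupport.intro isCompact_Icc fun x hx => smoothTransition_deriv_zero hx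
  exact (continuous_deriv_smoothTransition.integrable_of_hasCompactSupport h).ofReal

theorem integral_transitionDeriv : ∫ x, transitionDeriv x = 1 := by
  have h := integral_of_hasDerivAt_of_tendsto (f := fun x => (Real.smoothTransition x : ℂ))
    (m := 0) (n := 1) hasDerivAt_smoothTransition integrable_transitionDeriv ?_ ?_
  · simpa using h
  · refine tendsto_const_nhds.congr' ?_
    filter_upwards [eventually_le_atBot 0] with x hx
    simp [Real.smoothTransition.zero_of_nonpos hx]
  · refine tendsto_const_nhds.congr' ?_
    filter_upwards [eventually_ge_atTop 1] with x hx
    simp [Real.smoothTransition.one_of_one_le hx]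

/-- The kernels `c χ'(c (r - s))`, with `χ` the smooth transition, have integral one and shrink to
the point `s`; substitution turns them into the fixed kernel `χ'` with a contracted argument of `M`.
-/
theorem tendsto_integral_transitionDeriv {M : ℝ → ℂ} (hM : Continuous M) {C : ℝ}
    (hC : ∀ x, ‖M x‖ ≤ C) (s : ℝ) :
    Tendsto (fun c : ℝ => ∫ r, M r * (c * transitionDeriv (c * (r - s)))) atTop (𝓝 (M s)) := by
  have h := tendsto_integral_approx (K := transitionDeriv)
    (R := fun z => M (s + z)) (C := C) integrable_transitionDeriv (by fun_prop)
    (fun z => hC _) (tendsto_inv_atTop_zero (𝕜 := ℝ))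
  rw [integral_transitionDeriv, one_mul, add_zero] at h
  refine h.congr' ?_
  filter_upwards [eventually_gt_atTop 0] with c hc
  have e := Measure.integral_comp_smul volume
    (fun z : ℝ => transitionDeriv z * M (s + c⁻¹ • z)) c
  rw [Module.finrank_self, pow_one, abs_of_pos (inv_pos.2 hc)] at e
  have e2 := integral_sub_right_eq_self (μ := (volume : Measure ℝ)) (fun r : ℝ =>
    M (s + r) * (c * transitionDeriv (c * r))) s
  simp only [add_sub_cancel] at e2
  rw [e2]
  simp only [smul_eq_mul, inv_mul_cancel_left₀ hc.ne'] at e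
  have e3 : ∫ r : ℝ, M (s + r) * (c * transitionDeriv (c * r)) =
      c * ∫ x : ℝ, transitionDeriv (c * x) * M (s + x) := by
    rw [← integral_const_mul]; congr 1; ext r; ring
  rw [e3, e]
  simp only [smul_eq_mul, Complex.real_smul]
  push_cast
  rw [mul_inv_cancel_left₀ (by exact_mod_cast hc.ne')]

/-- A smooth function close to the indicator function of `(s, t)` for large `c`. -/
def smoothIndicator {T s t c : ℝ} (hs : 0 < s) (hst : s < t) (hc : 0 < c) (ht : t + c⁻¹ < T) :
    𝓓(timeInterval T, ℂ) :=
  have h0 : ∀ r, r ∉ Icc s (t + c⁻¹) → Real.smoothTransition (c * (r - s)) -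
      Real.smoothTransition (c * (r - t)) = 0 := fun r hr => by
    by_cases h : r < s
    · rw [Real.smoothTransition.zero_of_nonpos (by nlinarith),
        Real.smoothTransition.zero_of_nonpos (by nlinarith), sub_zero]
    · have h' : t + c⁻¹ < r := by
        by_contra h'
        exact hr ⟨not_lt.1 h, not_lt.1 h'⟩
      have h1 : 1 ≤ c * (r - t) := by
        rw [← mul_inv_cancel₀ hc.ne']
        exact mul_le_mul_of_nonneg_left (by linarith) hc.le
      rw [Real.smoothTransition.one_of_one_le h1,
        Real.smoothTransition.one_of_one_le (h1.trans (by nlinarith)), sub_self]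
  { toFun := fun r => ((Real.smoothTransition (c * (r - s)) -
      Real.smoothTransition (c * (r - t)) : ℝ) : ℂ)
    contDiff' := by
      refine Complex.ofRealCLM.contDiff.comp (ContDiff.sub ?_ ?_)
      · exact Real.smoothTransition.contDiff.comp (by fun_prop)
      · exact Real.smoothTransition.contDiff.comp (by fun_prop)
    hasCompactSupport' := HasCompactSupport.intro isCompact_Icc fun r hr => by
      rw [h0 r hr, Complex.ofReal_zero]
    tsupport_subset' := by
      have h1 : Icc s (t + c⁻¹) ⊆ Ioo 0 T := fun r hr => ⟨hs.trans_le hr.1, hr.2.trans_lt ht⟩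
      refine (closure_minimal (fun r hr => ?_) isClosed_Icc).trans h1
      by_contra h2
      exact hr ((congrArg Complex.ofReal (h0 r h2)).trans Complex.ofReal_zero) }

theorem smoothIndicator_apply {T s t c : ℝ} (hs : 0 < s) (hst : s < t) (hc : 0 < c)
    (ht : t + c⁻¹ < T) (r : ℝ) : smoothIndicator hs hst hc ht r =
      ((Real.smoothTransition (c * (r - s)) - Real.smoothTransition (c * (r - t)) : ℝ) : ℂ) := rfl

theorem deriv_smoothIndicator {T s t c : ℝ} (hs : 0 < s) (hst : s < t) (hc : 0 < c)
    (ht : t + c⁻¹ < T) (r : ℝ) : (∂_{(1 : ℝ)} (smoothIndicator hs hst hc ht)) r =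
      c * transitionDeriv (c * (r - s)) - c * transitionDeriv (c * (r - t)) := by
  have h1 : ∀ a : ℝ, HasDerivAt (fun r => (Real.smoothTransition (c * (r - a)) : ℂ))
      (c * transitionDeriv (c * (r - a))) r := fun a => by
    have h2 : HasDerivAt (fun r : ℝ => c * (r - a)) c r := by
      simpa using ((hasDerivAt_id r).sub_const a).const_mul c
    have := (hasDerivAt_smoothTransition (c * (r - a))).scomp r h2
    rw [Complex.real_smul] at this
    exact this
  refine (hasDerivAt_testFunction (smoothIndicator hs hst hc ht) r).unique ?_
  refine ((h1 s).sub (h1 t)).congr_of_eventuallyEq (Eventually.of_forall fun r => ?_)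
  rw [smoothIndicator_apply]
  simp

theorem tendsto_smoothTransition_mul (x : ℝ) :
    Tendsto (fun c : ℝ => Real.smoothTransition (c * x)) atTop
      (𝓝 ((Ioi (0 : ℝ)).indicator (fun _ => (1 : ℝ)) x)) := by
  refine tendsto_const_nhds.congr' ?_
  by_cases hx : 0 < x
  · filter_upwards [eventually_ge_atTop x⁻¹] with c hc
    rw [indicator_of_mem (by exact hx), Real.smoothTransition.one_of_one_le]
    rw [← inv_mul_cancel₀ hx.ne']
    exact mul_le_mul_of_nonneg_right hc hx.le
  · filter_upwards [eventually_ge_atTop 0] with c hc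
    rw [indicator_of_notMem (by exact hx), Real.smoothTransition.zero_of_nonpos]
    exact mul_nonpos_of_nonneg_of_nonpos hc (not_lt.1 hx)

/-- The test functions are smooth versions of the indicator of `(s, t)`. Their derivatives are
differences of approximate identities at `s` and at `t`, so one side tends to `m s - m t`, and the
other to `-∫ v` over `(s, t)`. -/
theorem sub_eq_integral_of_weak_deriv_Ioo {T : ℝ} {m v : ℝ → ℂ} (hm : ContinuousOn m (Icc 0 T))
    (hv : IntegrableOn v (Ioo 0 T))
    (h : ∀ θ : 𝓓(timeInterval T, ℂ), ∫ r in Ioo 0 T, m r * (∂_{(1 : ℝ)} θ) r =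
      -∫ r in Ioo 0 T, θ r * v r) {s t : ℝ} (hs : 0 < s) (hst : s < t) (ht : t < T) :
    m t - m s = ∫ r in s..t, v r := by
  have hT : (0 : ℝ) ≤ T := by linarith
  -- Extension by constants beyond `[0, T]` gives a bounded continuous function on the line, to
  -- which the approximate identities apply.
  set M : ℝ → ℂ := IccExtend hT ((Icc 0 T).domRestrict m) with hM
  have hMc : Continuous M := (continuousOn_iff_continuous_domRestrict.1 hm).Icc_extend'
  have hMm : ∀ r ∈ Icc 0 T, M r = m r := fun r hr => IccExtend_of_mem hT _ hr
  obtain ⟨C, hC⟩ : ∃ C, ∀ x, ‖M x‖ ≤ C := by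
    obtain ⟨C, hC⟩ := isCompact_Icc.exists_bound_of_continuousOn hm
    exact ⟨C, fun x => hC _ (projIcc 0 T hT x).2⟩
  have hlarge : ∀ᶠ c : ℝ in atTop, 0 < c ∧ t + c⁻¹ < T := by
    refine (eventually_gt_atTop 0).and ?_
    have : Tendsto (fun c : ℝ => t + c⁻¹) atTop (𝓝 (t + 0)) :=
      tendsto_inv_atTop_zero.const_add t
    exact this.eventually (gt_mem_nhds (by simpa using ht))
  have hI : ∀ a c : ℝ, 0 < c → Integrable (fun r => M r * (c * transitionDeriv (c * (r - a))))
      volume := fun a c hc => by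
    have h1 := integrable_transitionDeriv.comp_mul_left' hc.ne'
    have h2 := (h1.comp_sub_right a).const_mul (c : ℂ)
    exact h2.bdd_mul hMc.aestronglyMeasurable (Eventually.of_forall hC)
  have l1 := (tendsto_integral_transitionDeriv hMc hC s).sub
    (tendsto_integral_transitionDeriv hMc hC t)
  have l2 : Tendsto (fun c : ℝ => -∫ r in Ioo 0 T, ((Real.smoothTransition (c * (r - s)) -
      Real.smoothTransition (c * (r - t)) : ℝ) : ℂ) * v r) atTop (𝓝 (-∫ r in s..t, v r)) := by
    refine Tendsto.neg ?_
    have e : ∫ r in s..t, v r = ∫ r in Ioo 0 T, (((Ioi (0 : ℝ)).indicator (fun _ => (1 : ℝ)) (r - s) -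
        (Ioi (0 : ℝ)).indicator (fun _ => (1 : ℝ)) (r - t) : ℝ) : ℂ) * v r := by
      rw [intervalIntegral.integral_of_le hst.le, ← integral_indicator measurableSet_Ioc,
        ← integral_indicator measurableSet_Ioo]
      congr 1
      ext r
      by_cases h1 : s < r <;> by_cases h2 : t < r <;> by_cases h3 : r ∈ Ioo 0 T <;>
        simp [indicator, h1, h2, h3]
      · exact fun h4 => absurd ⟨hs.trans h1, h4.trans_lt ht⟩ h3
      · exact absurd (hst.trans h2) h1
    rw [e]
    refine tendsto_integral_filter_of_dominated_convergence (fun r => ‖v r‖) ?_ ?_ hv.norm ?_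
    · refine Eventually.of_forall fun c => AEStronglyMeasurable.mul ?_ hv.1
      refine Continuous.aestronglyMeasurable ?_
      have := differentiable_smoothTransition.continuous
      fun_prop
    · refine Eventually.of_forall fun c => Eventually.of_forall fun r => ?_
      rw [norm_mul, Complex.norm_real, Real.norm_eq_abs]
      refine mul_le_of_le_one_left (norm_nonneg _) ?_
      rw [abs_le]
      constructor <;> linarith [Real.smoothTransition.nonneg (c * (r - s)),
        Real.smoothTransition.nonneg (c * (r - t)), Real.smoothTransition.le_one (c * (r - s)),
        Real.smoothTransition.le_one (c * (r - t))]
    · refine Eventually.of_forall fun r => Tendsto.mul_const _ ?_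
      refine (Complex.continuous_ofReal.tendsto _).comp ?_
      exact (tendsto_smoothTransition_mul _).sub (tendsto_smoothTransition_mul _)
  have l3 := tendsto_nhds_unique (l1.congr' ?_) l2
  · rw [hMm s ⟨hs.le, by linarith⟩, hMm t ⟨by linarith, ht.le⟩] at l3
    rw [← neg_sub, l3, neg_neg]
  · filter_upwards [hlarge] with c hc
    have e := h (smoothIndicator hs hst hc.1 hc.2)
    refine Eq.trans ?_ e
    rw [← integral_sub (hI s c hc.1) (hI t c hc.1)]
    rw [← setIntegral_eq_integral_of_forall_compl_eq_zero (s := Ioo 0 T)]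
    · refine setIntegral_congr_fun measurableSet_Ioo fun r hr => ?_
      rw [deriv_smoothIndicator, hMm r ⟨hr.1.le, hr.2.le⟩]; ring
    · intro r hr
      rw [← mul_sub, ← deriv_smoothIndicator hs hst hc.1 hc.2]
      rw [testFunction_eq_zero _ hr, mul_zero]

/-- A continuous function on `[0, T]` with an integrable weak derivative is its integral. -/
theorem sub_eq_integral_of_weak_deriv {T : ℝ} (hT : 0 < T) {m v : ℝ → ℂ}
    (hm : ContinuousOn m (Icc 0 T)) (hv : IntegrableOn v (Ioo 0 T))
    (h : ∀ θ : 𝓓(timeInterval T, ℂ), ∫ r in Ioo 0 T, m r * (∂_{(1 : ℝ)} θ) r =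
      -∫ r in Ioo 0 T, θ r * v r) {t : ℝ} (ht : t ∈ Icc 0 T) :
    m t - m 0 = ∫ r in (0 : ℝ)..t, v r := by
  have hv' : IntervalIntegrable v volume 0 T := by
    rwa [intervalIntegrable_iff_integrableOn_Ioo_of_le hT.le]
  have hsub : ∀ {a b}, a ∈ Icc 0 T → b ∈ Icc 0 T → IntervalIntegrable v volume a b :=
    fun ha hb => hv'.mono_set (by rw [uIcc_of_le hT.le]; exact ordConnected_Icc.uIcc_subset ha hb)
  have hc : ContinuousOn (fun t => m t - ∫ r in (0 : ℝ)..t, v r) (Icc 0 T) := by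
    refine hm.sub ?_
    have := intervalIntegral.continuousOn_primitive_interval (a := 0) (b := T) (f := v) (μ := volume)
      (by rw [uIcc_of_le hT.le, integrableOn_Icc_iff_integrableOn_Ioo]; exact hv)
    rwa [uIcc_of_le hT.le] at this
  have key : EqOn (fun t => m t - ∫ r in (0 : ℝ)..t, v r)
      (fun _ => m (T / 2) - ∫ r in (0 : ℝ)..(T / 2), v r) (Icc 0 T) := by
    -- Test functions only reach interior times; both sides are continuous on `[0, T]`, so the
    -- identity passes to the end points.
    refine EqOn.of_subset_closure (s := Ioo 0 T) ?_ hc continuousOn_const Ioo_subset_Icc_self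
      (by rw [closure_Ioo hT.ne])
    intro r hr
    have hr' : r ∈ Icc 0 T := ⟨hr.1.le, hr.2.le⟩
    have h2 : T / 2 ∈ Icc 0 T := ⟨by linarith, by linarith⟩
    have h0 : (0 : ℝ) ∈ Icc 0 T := ⟨le_rfl, hT.le⟩
    have e := intervalIntegral.integral_add_adjacent_intervals (hsub h0 hr') (hsub hr' h2)
    rcases lt_trichotomy r (T / 2) with hlt | heq | hgt
    · have := sub_eq_integral_of_weak_deriv_Ioo hm hv h hr.1 hlt (by linarith)
      simp only
      rw [← e, ← this]; ring
    · rw [heq]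
    · have := sub_eq_integral_of_weak_deriv_Ioo hm hv h (by linarith) hgt hr.2
      rw [intervalIntegral.integral_symm (T / 2) r, ← this] at e
      simp only
      rw [← e]; ring
  have e1 := key ht
  have e2 := key (⟨le_rfl, hT.le⟩ : (0 : ℝ) ∈ Icc 0 T)
  simp only [intervalIntegral.integral_same, sub_zero] at e1 e2
  rw [e2, ← e1]; ring

end WeakDerivative

/-! ### Smooth functions as elements of Sobolev spaces -/

section SmoothFamily

/-- The class in `L²(U)` of a square integrable function. -/
def toL2 {E : Type*} [NormedAddCommGroup E] [MeasureSpace E] (U : Opens E) {f : E → ℂ}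
    (hf : MemLp f 2 volume) : L2 U :=
  (hf.mono_measure Measure.restrict_le_self).toLp f

theorem toL2_ae {E : Type*} [NormedAddCommGroup E] [MeasureSpace E] (U : Opens E) {f : E → ℂ}
    (hf : MemLp f 2 volume) : toL2 U hf =ᵐ[volume.restrict (U : Set E)] f :=
  MemLp.coeFn_toLp _

theorem setIntegral_mul_test {E : Type*} [NormedAddCommGroup E] [NormedSpace ℝ E] [MeasureSpace E]
    {U : Opens E} (f : E → ℂ) (η : 𝓓(U, ℂ)) :
    ∫ x in (U : Set E), f x * η x = ∫ x, f x * η x :=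
  setIntegral_eq_integral_of_forall_compl_eq_zero fun x hx => by
    rw [testFunction_eq_zero η hx, mul_zero]

theorem integral_mul_fst_deriv {U : Opens (ℝ × ℝ)} {f f' : ℝ × ℝ → ℂ} (hf : Continuous f)
    (hf' : Continuous f') (hd : ∀ x y, HasDerivAt (fun t => f (t, y)) (f' (x, y)) x) (η : 𝓓(U, ℂ)) :
    ∫ x, f x * (∂_{((1, 0) : ℝ × ℝ)} η) x = -∫ x, f' x * η x := by
  have h1 : Integrable (fun x => f x * (∂_{((1, 0) : ℝ × ℝ)} η) x) volume := by
    set ξ : 𝓓(U, ℂ) := ∂_{((1, 0) : ℝ × ℝ)} η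
    exact (hf.mul ξ.continuous).integrable_of_hasCompactSupport ξ.hasCompactSupport.mul_left
  have h2 : Integrable (fun x => f' x * η x) volume :=
    (hf'.mul η.continuous).integrable_of_hasCompactSupport η.hasCompactSupport.mul_left
  rw [Measure.volume_eq_prod] at h1 h2 ⊢
  rw [integral_prod_symm _ h1, integral_prod_symm _ h2, ← integral_neg]
  refine integral_congr_ae (Eventually.of_forall fun y => ?_)
  dsimp only
  have hs : ∀ ξ : 𝓓(U, ℂ), HasCompactSupport fun x : ℝ => ξ (x, y) := fun ξ =>
    ξ.hasCompactSupport.comp_isClosedEmbedding (isClosedEmbedding_slice_fst y)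
  have hc : ∀ ξ : 𝓓(U, ℂ), Continuous fun x : ℝ => ξ (x, y) := fun ξ =>
    ξ.continuous.comp (by fun_prop)
  refine integral_mul_deriv_eq_deriv_mul_of_integrable (u := fun x => f (x, y))
      (u' := fun x => f' (x, y)) (fun x _ => hd x y) (fun x _ => hasDerivAt_slice_fst η x y) ?_ ?_ ?_
  · exact ((hf.comp (by fun_prop)).mul (hc _)).integrable_of_hasCompactSupport (hs _).mul_left
  · exact ((hf'.comp (by fun_prop)).mul (hc _)).integrable_of_hasCompactSupport (hs _).mul_left
  · exact ((hf.comp (by fun_prop)).mul (hc _)).integrable_of_hasCompactSupport (hs _).mul_left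

theorem integral_mul_snd_deriv {U : Opens (ℝ × ℝ)} {f f' : ℝ × ℝ → ℂ} (hf : Continuous f)
    (hf' : Continuous f') (hd : ∀ x y, HasDerivAt (fun t => f (x, t)) (f' (x, y)) y) (η : 𝓓(U, ℂ)) :
    ∫ x, f x * (∂_{((0, 1) : ℝ × ℝ)} η) x = -∫ x, f' x * η x := by
  have h1 : Integrable (fun x => f x * (∂_{((0, 1) : ℝ × ℝ)} η) x) volume := by
    set ξ : 𝓓(U, ℂ) := ∂_{((0, 1) : ℝ × ℝ)} η
    exact (hf.mul ξ.continuous).integrable_of_hasCompactSupport ξ.hasCompactSupport.mul_left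
  have h2 : Integrable (fun x => f' x * η x) volume :=
    (hf'.mul η.continuous).integrable_of_hasCompactSupport η.hasCompactSupport.mul_left
  rw [Measure.volume_eq_prod] at h1 h2 ⊢
  rw [integral_prod _ h1, integral_prod _ h2, ← integral_neg]
  refine integral_congr_ae (Eventually.of_forall fun x => ?_)
  dsimp only
  have hs : ∀ ξ : 𝓓(U, ℂ), HasCompactSupport fun y : ℝ => ξ (x, y) := fun ξ =>
    ξ.hasCompactSupport.comp_isClosedEmbedding (isClosedEmbedding_slice_snd x)
  have hc : ∀ ξ : 𝓓(U, ℂ), Continuous fun y : ℝ => ξ (x, y) := fun ξ =>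
    ξ.continuous.comp (by fun_prop)
  refine integral_mul_deriv_eq_deriv_mul_of_integrable (u := fun y => f (x, y))
      (u' := fun y => f' (x, y)) (fun y _ => hd x y) (fun y _ => hasDerivAt_slice_snd η x y) ?_ ?_ ?_
  · exact ((hf.comp (by fun_prop)).mul (hc _)).integrable_of_hasCompactSupport (hs _).mul_left
  · exact ((hf'.comp (by fun_prop)).mul (hc _)).integrable_of_hasCompactSupport (hs _).mul_left
  · exact ((hf.comp (by fun_prop)).mul (hc _)).integrable_of_hasCompactSupport (hs _).mul_left

/-- `D a b`, `a + b ≤ s`, are the derivatives `∂₁^a ∂₂^b D₀₀`, continuous and square integrable. -/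
structure SmoothFamily (s : ℕ) (D : ℕ → ℕ → ℝ × ℝ → ℂ) : Prop where
  continuous : ∀ a b, a + b ≤ s → Continuous (D a b)
  memLp : ∀ a b, a + b ≤ s → MemLp (D a b) 2 volume
  deriv_fst : ∀ a b, a + 1 + b ≤ s → ∀ x y,
    HasDerivAt (fun t => D a b (t, y)) (D (a + 1) b (x, y)) x
  deriv_snd : ∀ a b, a + (b + 1) ≤ s → ∀ x y,
    HasDerivAt (fun t => D a b (x, t)) (D a (b + 1) (x, y)) y

theorem testDeriv_succ_left {U : Opens (ℝ × ℝ)} (a b : ℕ) (η : 𝓓(U, ℂ)) :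
    testDeriv (a + 1) b η = ∂_{((1, 0) : ℝ × ℝ)} (testDeriv a b η) := by
  simp only [testDeriv, Function.iterate_succ', Function.comp_apply]

theorem testDeriv_zero_succ {U : Opens (ℝ × ℝ)} (b : ℕ) (η : 𝓓(U, ℂ)) :
    testDeriv 0 (b + 1) η = ∂_{((0, 1) : ℝ × ℝ)} (testDeriv 0 b η) := by
  simp only [testDeriv, Function.iterate_succ', Function.comp_apply, Function.iterate_zero, id_eq]

theorem SmoothFamily.integral_mul_testDeriv {s : ℕ} {D : ℕ → ℕ → ℝ × ℝ → ℂ}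
    (h : SmoothFamily s D) {U : Opens (ℝ × ℝ)} (η : 𝓓(U, ℂ)) (a b : ℕ) (hab : a + b ≤ s) :
    ∫ x, D 0 0 x * testDeriv a b η x = (-1) ^ (a + b) * ∫ x, D a b x * η x := by
  have h1 : ∀ a c, a + c + b ≤ s → ∫ x, D c 0 x * testDeriv a b η x =
      (-1) ^ a * ∫ x, D (c + a) 0 x * testDeriv 0 b η x := by
    intro a
    induction a with
    | zero => intro c _; simp
    | succ a ih =>
      intro c hc
      rw [testDeriv_succ_left, integral_mul_fst_deriv (h.continuous c 0 (by omega))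
        (h.continuous (c + 1) 0 (by omega)) (h.deriv_fst c 0 (by omega)), ih (c + 1) (by omega)]
      rw [show c + 1 + a = c + (a + 1) by omega]
      ring
  have h2 : ∀ b d, a + b + d ≤ s → ∫ x, D a d x * testDeriv 0 b η x =
      (-1) ^ b * ∫ x, D a (d + b) x * η x := by
    intro b
    induction b with
    | zero => intro d _; simp [testDeriv]
    | succ b ih =>
      intro d hd
      rw [testDeriv_zero_succ, integral_mul_snd_deriv (h.continuous a d (by omega))
        (h.continuous a (d + 1) (by omega)) (h.deriv_snd a d (by omega)), ih (d + 1) (by omega)]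
      rw [show d + 1 + b = d + (b + 1) by omega]
      ring
  rw [h1 a 0 (by omega), zero_add, h2 b 0 (by omega), zero_add, pow_add, mul_assoc]

theorem SmoothFamily.isWeakDeriv {s : ℕ} {D : ℕ → ℕ → ℝ × ℝ → ℂ} (h : SmoothFamily s D)
    (U : Opens (ℝ × ℝ)) (a b : ℕ) (hab : a + b ≤ s) :
    IsWeakDeriv a b (toL2 U (h.memLp 0 0 (by omega))) (toL2 U (h.memLp a b hab)) := by
  intro η
  have e : ∀ {f : ℝ × ℝ → ℂ} (hf : MemLp f 2 volume) (ξ : 𝓓(U, ℂ)),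
      ∫ x in (U : Set (ℝ × ℝ)), toL2 U hf x * ξ x = ∫ x, f x * ξ x := fun hf ξ => by
    rw [← setIntegral_mul_test]
    refine integral_congr_ae ?_
    filter_upwards [toL2_ae U hf] with x hx
    rw [hx]
  rw [e, e, h.integral_mul_testDeriv η a b hab]

/-- The element of `H^s(U)` given by a smooth function. -/
def SmoothFamily.elt {s : ℕ} {D : ℕ → ℕ → ℝ × ℝ → ℂ} (h : SmoothFamily s D) (U : Opens (ℝ × ℝ)) :
    Space (Sobolev U s) :=
  ⟨WithLp.toLp 2 fun α => toL2 U (h.memLp α.1.1 α.1.2 α.2), fun α => h.isWeakDeriv U _ _ α.2⟩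

theorem SmoothFamily.coord_elt {s : ℕ} {D : ℕ → ℕ → ℝ × ℝ → ℂ} (h : SmoothFamily s D)
    (U : Opens (ℝ × ℝ)) (a b : ℕ) (hab : a + b ≤ s) :
    coord (Sobolev U s) a b hab (h.elt U) = toL2 U (h.memLp a b hab) := rfl

/-- The element of `H₀^s` given by a smooth function whose normal derivatives of order less than `s`
vanish on the line `x₁ = 0`. -/
def SmoothFamily.zeroElt {s : ℕ} {D : ℕ → ℕ → ℝ × ℝ → ℂ} (h : SmoothFamily s D)
    (hv : ∀ k (hk : k < s), VanishesOnLine (toL2 halfPlane (h.memLp k 0 (by omega)))) :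
    Space (SobolevZero s) :=
  ⟨WithLp.toLp 2 fun α => toL2 halfPlane (h.memLp α.1.1 α.1.2 α.2),
    fun α => h.isWeakDeriv halfPlane _ _ α.2, hv⟩

theorem SmoothFamily.coord_zeroElt {s : ℕ} {D : ℕ → ℕ → ℝ × ℝ → ℂ} (h : SmoothFamily s D)
    (hv : ∀ k (hk : k < s), VanishesOnLine (toL2 halfPlane (h.memLp k 0 (by omega))))
    (a b : ℕ) (hab : a + b ≤ s) :
    coord (SobolevZero s) a b hab (h.zeroElt hv) = toL2 halfPlane (h.memLp a b hab) := rfl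

/-- Symmetry of the second derivative. It is needed because `testDeriv` applies `∂₂` innermost,
whereas an induction on the second index adds `∂₂` on the outside. -/
theorem lineDeriv_comm {U : Opens (ℝ × ℝ)} (ζ : 𝓓(U, ℂ)) :
    ∂_{((1, 0) : ℝ × ℝ)} (∂_{((0, 1) : ℝ × ℝ)} ζ) = ∂_{((0, 1) : ℝ × ℝ)} (∂_{((1, 0) : ℝ × ℝ)} ζ) := by
  have key : ∀ (v w x : ℝ × ℝ), (∂_{v} (∂_{w} ζ)) x = fderiv ℝ (fderiv ℝ ζ) x v w := fun v w x => by
    rw [lineDeriv_testFunction_apply]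
    have h1 : ⇑(∂_{w} ζ : 𝓓(U, ℂ)) = fun x => fderiv ℝ ζ x w :=
      funext fun x => lineDeriv_testFunction_apply ζ w x
    have h2 : DifferentiableAt ℝ (fderiv ℝ ζ) x :=
      ((contDiff_testFunction ζ).fderiv_right (m := 1) (by norm_cast)).differentiable (by simp) x
    rw [h1, fderiv_clm_apply h2 (differentiableAt_const w)]
    simp
  ext x
  rw [key, key]
  exact ((contDiff_testFunction ζ).contDiffAt.isSymmSndFDerivAt (by simp; norm_cast)).eq _ _

theorem testDeriv_succ_right {U : Opens (ℝ × ℝ)} (a b : ℕ) (η : 𝓓(U, ℂ)) :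
    testDeriv a (b + 1) η = ∂_{((0, 1) : ℝ × ℝ)} (testDeriv a b η) := by
  induction a with
  | zero => exact testDeriv_zero_succ b η
  | succ a ih => rw [testDeriv_succ_left, ih, lineDeriv_comm, ← testDeriv_succ_left]

theorem smoothFamily_testDeriv (s : ℕ) {U : Opens (ℝ × ℝ)} (ζ : 𝓓(U, ℂ)) :
    SmoothFamily s fun a b => testDeriv a b ζ where
  continuous a b _ := (testDeriv a b ζ).continuous
  memLp a b _ := memLp_testFunction 2 (testDeriv a b ζ) volume
  deriv_fst a b _ x y := by
    rw [testDeriv_succ_left]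
    exact hasDerivAt_slice_fst _ x y
  deriv_snd a b _ x y := by
    rw [testDeriv_succ_right]
    exact hasDerivAt_slice_snd _ x y

/-- A test function on the plane as an element of `H²(ℝ²)`. -/
def ofTest (ζ : 𝓓((⊤ : Opens (ℝ × ℝ)), ℂ)) : Space (Sobolev ⊤ 2) := (smoothFamily_testDeriv 2 ζ).elt ⊤

theorem coord_ofTest (ζ : 𝓓((⊤ : Opens (ℝ × ℝ)), ℂ)) (a b : ℕ) (hab : a + b ≤ 2) :
    coord (Sobolev ⊤ 2) a b hab (ofTest ζ) =
      toL2 ⊤ (memLp_testFunction 2 (testDeriv a b ζ) volume) := rfl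

theorem delta_ofTest (ζ : 𝓓((⊤ : Opens (ℝ × ℝ)), ℂ)) : delta (ofTest ζ) = ζ 0 :=
  delta_apply _ _ fun a b hab => by
    rw [coord_ofTest]
    exact ae_top_iff.1 (toL2_ae ⊤ _)

theorem pairing_toL2 {E : Type*} [NormedAddCommGroup E] [MeasureSpace E] (U : Opens E) (c : L2 U)
    {f : E → ℂ} (hf : MemLp f 2 volume) :
    pairing U c (toL2 U hf) = ∫ x in (U : Set E), c x * f x := by
  rw [pairing_apply]
  refine integral_congr_ae ?_
  filter_upwards [toL2_ae U hf] with x hx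
  rw [hx]

theorem memLp_volume_of_top {E : Type*} [NormedAddCommGroup E] [MeasureSpace E] {h : E → ℂ}
    (hh : MemLp h 2 (volume.restrict ((⊤ : Opens E) : Set E))) : MemLp h 2 volume := by
  rwa [coe_top_restrict] at hh

theorem memLp_top {E : Type*} [NormedAddCommGroup E] [MeasureSpace E] (f : L2 (⊤ : Opens E)) :
    MemLp f 2 (volume : Measure E) := memLp_volume_of_top (Lp.memLp f)

theorem eLpNorm_restrict_top {E : Type*} [NormedAddCommGroup E] [MeasureSpace E] (h : E → ℂ) :
    eLpNorm h 2 (volume.restrict ((⊤ : Opens E) : Set E)) = eLpNorm h 2 volume := by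
  rw [coe_top_restrict]

theorem lpNorm_top {E : Type*} [NormedAddCommGroup E] [MeasureSpace E] (f : L2 (⊤ : Opens E)) :
    lpNorm f 2 (volume : Measure E) = ‖f‖ := by
  rw [Lp.norm_def, eLpNorm_restrict_top, toReal_eLpNorm (memLp_top f).1]

end SmoothFamily

/-! ### Affine changes of variables -/

section Affine

/-- The test function `x ↦ ζ(e₁ x₁ + c₁, e₂ x₂ + c₂)`. -/
def affTest (ζ : 𝓓((⊤ : Opens (ℝ × ℝ)), ℂ)) (e c : ℝ × ℝ) (h1 : e.1 ≠ 0) (h2 : e.2 ≠ 0) :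
    𝓓((⊤ : Opens (ℝ × ℝ)), ℂ) where
  toFun x := ζ (e.1 * x.1 + c.1, e.2 * x.2 + c.2)
  contDiff' := (contDiff_testFunction ζ).comp (by fun_prop)
  hasCompactSupport' := ζ.hasCompactSupport.comp_homeomorph
    (((Homeomorph.mulLeft₀ e.1 h1).trans (Homeomorph.addRight c.1)).prodCongr
      ((Homeomorph.mulLeft₀ e.2 h2).trans (Homeomorph.addRight c.2)))
  tsupport_subset' := subset_univ _

theorem testDeriv_affTest (ζ : 𝓓((⊤ : Opens (ℝ × ℝ)), ℂ)) (e c : ℝ × ℝ) (h1 : e.1 ≠ 0)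
    (h2 : e.2 ≠ 0) (a b : ℕ) (x : ℝ × ℝ) : testDeriv a b (affTest ζ e c h1 h2) x =
      (e.1 : ℂ) ^ a * (e.2 : ℂ) ^ b * testDeriv a b ζ (e.1 * x.1 + c.1, e.2 * x.2 + c.2) := by
  induction a generalizing x with
  | zero =>
    induction b generalizing x with
    | zero => simp [testDeriv]; rfl
    | succ b ih =>
      rw [testDeriv_succ_right, testDeriv_succ_right]
      refine (hasDerivAt_slice_snd _ x.1 x.2).unique ?_
      have h3 : HasDerivAt (fun t : ℝ => e.2 * t + c.2) e.2 x.2 := by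
        simpa using ((hasDerivAt_id x.2).const_mul e.2).add_const c.2
      have h4 := ((hasDerivAt_slice_snd (testDeriv 0 b ζ) (e.1 * x.1 + c.1)
        (e.2 * x.2 + c.2)).scomp x.2 h3).const_mul ((e.1 : ℂ) ^ 0 * (e.2 : ℂ) ^ b)
      rw [Complex.real_smul] at h4
      exact (h4.congr_of_eventuallyEq (Eventually.of_forall fun t => ih (x.1, t))).congr_deriv
        (by ring)
  | succ a ih =>
    rw [testDeriv_succ_left, testDeriv_succ_left]
    refine (hasDerivAt_slice_fst _ x.1 x.2).unique ?_
    have h3 : HasDerivAt (fun t : ℝ => e.1 * t + c.1) e.1 x.1 := by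
      simpa using ((hasDerivAt_id x.1).const_mul e.1).add_const c.1
    have h4 := ((hasDerivAt_slice_fst (testDeriv a b ζ) (e.1 * x.1 + c.1)
      (e.2 * x.2 + c.2)).scomp x.1 h3).const_mul ((e.1 : ℂ) ^ a * (e.2 : ℂ) ^ b)
    rw [Complex.real_smul] at h4
    exact (h4.congr_of_eventuallyEq (Eventually.of_forall fun t => ih (t, x.2))).congr_deriv
      (by ring)

end Affine

/-! ### Mollifiers -/

section Mollification

variable {E : Type*} [NormedAddCommGroup E] [NormedSpace ℝ E] [FiniteDimensional ℝ E]
  [MeasureSpace E] [BorelSpace E] [(volume : Measure E).IsAddHaarMeasure]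

/-- Bump functions concentrating at the origin. -/
def shrinkingBump (n : ℕ) : ContDiffBump (0 : E) where
  rIn := (n + 2 : ℝ)⁻¹
  rOut := (n + 1 : ℝ)⁻¹
  rIn_pos := by positivity
  rIn_lt_rOut := by gcongr; norm_num

/-- A sequence of normalized test functions concentrating at the origin. -/
def mollifier (n : ℕ) : 𝓓((⊤ : Opens E), ℂ) where
  toFun x := (((shrinkingBump n : ContDiffBump (0 : E)).normed volume x : ℝ) : ℂ)
  contDiff' := Complex.ofRealCLM.contDiff.comp (shrinkingBump n).contDiff_normed
  hasCompactSupport' := (shrinkingBump n).hasCompactSupport_normed.comp_left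
    (g := fun r : ℝ => (r : ℂ)) rfl
  tsupport_subset' := subset_univ _

theorem tendsto_integral_mollifier {R : E → ℂ} (hR : Continuous R) :
    Tendsto (fun n => ∫ z, (mollifier n : 𝓓((⊤ : Opens E), ℂ)) z * R z) atTop (𝓝 (R 0)) := by
  have h := ContDiffBump.convolution_tendsto_right_of_continuous (μ := (volume : Measure E))
    (φ := fun n : ℕ => (shrinkingBump n : ContDiffBump (0 : E))) (l := atTop)
    (by simpa [one_div, shrinkingBump] using tendsto_one_div_add_atTop_nhds_zero_nat (𝕜 := ℝ)) hR 0
  refine h.congr fun n => ?_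
  -- A convolution evaluated at the origin pairs the bump with the reflected function; the
  -- reflection is harmless since the bumps are even.
  rw [convolution_def, ← integral_neg_eq_self]
  congr 1
  ext z
  simp [mollifier, ContDiffBump.normed_neg]
  exact Or.inl rfl

end Mollification

/-! ### Functionals on H² determined by test functions -/

section Density

/-- The translate `x ↦ ζ(x - y)`. -/
def translateTest (ζ : 𝓓((⊤ : Opens (ℝ × ℝ)), ℂ)) (y : ℝ × ℝ) : 𝓓((⊤ : Opens (ℝ × ℝ)), ℂ) :=
  affTest ζ (1, 1) (-y) one_ne_zero one_ne_zero

theorem testDeriv_translateTest (ζ : 𝓓((⊤ : Opens (ℝ × ℝ)), ℂ)) (a b : ℕ) (x y : ℝ × ℝ) :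
    testDeriv a b (translateTest ζ y) x = testDeriv a b ζ (x - y) := by
  rw [translateTest, testDeriv_affTest]
  simp only [Complex.ofReal_one, one_pow, one_mul, Prod.fst_neg, Prod.snd_neg, ← sub_eq_add_neg]
  rfl

/-- The weak derivative is tested with `y ↦ ζ(x - y)`. The sign in the definition of the weak
derivative and the sign from the chain rule are both `(-1) ^ (a + b)` and cancel. -/
theorem integral_coord_mul_kernel (F : Space (Sobolev ⊤ 2)) (ζ : 𝓓((⊤ : Opens (ℝ × ℝ)), ℂ))
    (a b : ℕ) (hab : a + b ≤ 2) (x : ℝ × ℝ) :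
    ∫ y, coord (Sobolev ⊤ 2) 0 0 (by norm_num) F y * testDeriv a b ζ (x - y) =
      ∫ y, coord (Sobolev ⊤ 2) a b hab F y * ζ (x - y) := by
  have h := F.2 (multiIndex a b hab) (affTest ζ (-1, -1) x (by norm_num) (by norm_num))
  rw [integral_top, integral_top] at h
  have e : ∀ y : ℝ × ℝ, ((-1 : ℝ) * y.1 + x.1, (-1 : ℝ) * y.2 + x.2) = x - y := fun y => by
    ext <;> simp <;> ring
  have h2 : ∀ y, testDeriv a b (affTest ζ (-1, -1) x (by norm_num) (by norm_num)) y =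
      (-1) ^ (a + b) * testDeriv a b ζ (x - y) := fun y => by
    rw [testDeriv_affTest, e, pow_add]; simp
  have h3 : ∀ y, affTest ζ (-1, -1) x (by norm_num) (by norm_num) y = ζ (x - y) := fun y => by
    rw [← e]; rfl
  have h4 : ((-1 : ℂ) ^ (a + b)) * (-1) ^ (a + b) = 1 := by
    rw [← mul_pow]; simp
  change ∫ y, coord (Sobolev ⊤ 2) 0 0 (by norm_num) F y *
    testDeriv a b (affTest ζ (-1, -1) x (by norm_num) (by norm_num)) y = (-1) ^ (a + b) *
    ∫ y, coord (Sobolev ⊤ 2) a b hab F y *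
      affTest ζ (-1, -1) x (by norm_num) (by norm_num) y at h
  simp only [h2, h3] at h
  simp only [mul_left_comm _ ((-1 : ℂ) ^ (a + b)), integral_const_mul] at h
  have := congrArg (fun z => (-1 : ℂ) ^ (a + b) * z) h
  simpa only [← mul_assoc, h4, one_mul] using this

/-- `ℓ` is the limit of its mollifications. -/
def Mollifies (ℓ : StrongDual ℂ (Space (Sobolev (⊤ : Opens (ℝ × ℝ)) 2))) : Prop :=
  ∀ F, (∀ n, Integrable (fun y => coord (Sobolev ⊤ 2) 0 0 (by norm_num) F y *
      ℓ (ofTest (translateTest (mollifier n) y))) volume) ∧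
    Tendsto (fun n => ∫ y, coord (Sobolev ⊤ 2) 0 0 (by norm_num) F y *
      ℓ (ofTest (translateTest (mollifier n) y))) atTop (𝓝 (ℓ F))

theorem Mollifies.add {ℓ ℓ' : StrongDual ℂ (Space (Sobolev (⊤ : Opens (ℝ × ℝ)) 2))}
    (h : Mollifies ℓ) (h' : Mollifies ℓ') : Mollifies (ℓ + ℓ') := by
  intro F
  simp only [add_apply, mul_add]
  refine ⟨fun n => ((h F).1 n).add ((h' F).1 n), ?_⟩
  refine ((h F).2.add (h' F).2).congr fun n => ?_
  rw [integral_add ((h F).1 n) ((h' F).1 n)]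

theorem Mollifies.smul {ℓ : StrongDual ℂ (Space (Sobolev (⊤ : Opens (ℝ × ℝ)) 2))}
    (h : Mollifies ℓ) (c : ℂ) : Mollifies (c • ℓ) := by
  intro F
  simp only [smul_apply, smul_eq_mul, mul_left_comm _ c]
  refine ⟨fun n => ((h F).1 n).const_mul c, ?_⟩
  refine ((h F).2.const_mul c).congr fun n => ?_
  rw [integral_const_mul]

/-- The derivative `∂^(a,b)` that falls on the mollifier is moved onto `F`. What remains is the
mollifier integrated against the continuous correlation of `c` with `∂^(a,b) F`, whose value at the
origin is the pairing. -/
theorem mollifies_pairing (c : L2 (⊤ : Opens (ℝ × ℝ))) (a b : ℕ) (hab : a + b ≤ 2) :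
    Mollifies (pairing ⊤ c ∘L coord (Sobolev ⊤ 2) a b hab) := by
  intro F
  have e : ∀ n y, (pairing ⊤ c ∘L coord (Sobolev ⊤ 2) a b hab)
      (ofTest (translateTest (mollifier n) y)) =
      ∫ x, c x * testDeriv a b (mollifier n) (x - y) := fun n y => by
    rw [ContinuousLinearMap.comp_apply, coord_ofTest, pairing_toL2, integral_top]
    simp only [testDeriv_translateTest]
  have hi : ∀ ζ : 𝓓((⊤ : Opens (ℝ × ℝ)), ℂ), Integrable ζ volume := fun ζ =>
    ζ.continuous.integrable_of_hasCompactSupport ζ.hasCompactSupport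
  have hF := memLp_top (coord (Sobolev ⊤ 2) 0 0 (by norm_num) F)
  have hc := memLp_top c
  simp only [e]
  refine ⟨fun n => integrable_mul_conv hc hF (hi _), ?_⟩
  have h2 := memLp_top (coord (Sobolev ⊤ 2) a b hab F)
  have h3 := tendsto_integral_mollifier (continuous_corr hc h2)
  rw [corr_zero, ← integral_top, ← pairing_apply] at h3
  refine h3.congr fun n => ?_
  rw [integral_mul_conv hc hF (hi _), ← integral_mul_conv' hc hF (hi _),
    ← integral_mul_conv' hc h2 (hi _)]
  simp only [integral_coord_mul_kernel F _ a b hab]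

theorem mollifies_distDeriv (c : L2 (⊤ : Opens (ℝ × ℝ))) (a b : ℕ) (hab : a + b ≤ 2) :
    Mollifies (distDeriv (Sobolev ⊤ 2) a b hab c) :=
  (mollifies_pairing c a b hab).smul ((-1) ^ (a + b))

theorem mollifies_laplacian (c : L2 (⊤ : Opens (ℝ × ℝ))) : Mollifies (laplacian (Sobolev ⊤ 2) c) :=
  (mollifies_distDeriv c 2 0 _).add (mollifies_distDeriv c 0 2 _)

theorem mollifies_delta : Mollifies delta := by
  have h := fun a b hab => mollifies_pairing ((((memLp_tensor memLp_expRay memLp_expRay).mono_measure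
      Measure.restrict_le_self).toLp fun x : ℝ × ℝ => expRay x.1 * expRay x.2)) a b hab
  have e := (((h 0 0 (by norm_num)).add (h 1 0 (by norm_num))).add (h 0 1 (by norm_num))).add
    (h 1 1 (by norm_num))
  rwa [← ContinuousLinearMap.comp_add, ← ContinuousLinearMap.comp_add,
    ← ContinuousLinearMap.comp_add] at e

/-- This takes the place of the density of test functions in `H²(ℝ²)`: the functionals that occur in
the equation are recovered as limits of averages of their values on translated mollifiers. -/
theorem Mollifies.eq_zero {ℓ : StrongDual ℂ (Space (Sobolev (⊤ : Opens (ℝ × ℝ)) 2))}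
    (h : Mollifies ℓ) (h0 : ∀ ζ, ℓ (ofTest ζ) = 0) : ℓ = 0 := by
  ext F
  have := (h F).2
  simp only [h0, mul_zero, integral_zero] at this
  exact tendsto_nhds_unique this tendsto_const_nhds

end Density

/-! ### The plane equation integrated in time -/

section IntegralForm

/-- The integral from `0` to `t` of the right-hand side `Δ W - 2 u δ` of the equation on the plane. -/
def planePrimitive (u : ℝ → ℂ) (W : ℝ → L2 (⊤ : Opens (ℝ × ℝ))) (t : ℝ) :
    StrongDual ℂ (Space (Sobolev (⊤ : Opens (ℝ × ℝ)) 2)) :=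
  laplacian (Sobolev ⊤ 2) (∫ r in (0 : ℝ)..t, W r) - (2 * ∫ r in (0 : ℝ)..t, u r) • delta

variable {T : ℝ} {u : ℝ → ℂ} {W : ℝ → L2 (⊤ : Opens (ℝ × ℝ))}

theorem intervalIntegrable_control (hT : 0 < T) (hu : MemLp u ∞ (volume.restrict (Ioo 0 T))) :
    IntervalIntegrable u volume 0 T := by
  rw [intervalIntegrable_iff_integrableOn_Ioo_of_le hT.le]
  have : IsFiniteMeasure (volume.restrict (Ioo 0 T)) := ⟨by simp⟩
  exact hu.integrable le_top

theorem exists_ae_bound_control (hu : MemLp u ∞ (volume.restrict (Ioo 0 T))) :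
    ∃ C, 0 ≤ C ∧ ∀ᵐ r, r ∈ Ioo 0 T → ‖u r‖ ≤ C :=
  ⟨lpNorm u ∞ (volume.restrict (Ioo 0 T)), lpNorm_nonneg,
    (ae_restrict_iff' measurableSet_Ioo).1 (ae_le_lpNorm_exponent_top hu)⟩

theorem intervalIntegrable_sub {E : Type*} [NormedAddCommGroup E] {f : ℝ → E} {a b s t : ℝ}
    (hf : IntervalIntegrable f volume a b) (hs : s ∈ uIcc a b) (ht : t ∈ uIcc a b) :
    IntervalIntegrable f volume s t :=
  hf.mono_set (ordConnected_uIcc.uIcc_subset hs ht)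

theorem dist_integral_le {E : Type*} [NormedAddCommGroup E] [NormedSpace ℝ E]
    {f : ℝ → E} (hT : 0 < T) (hf : IntervalIntegrable f volume 0 T) {C : ℝ}
    (hC : ∀ᵐ r, r ∈ Ioo 0 T → ‖f r‖ ≤ C) {s t : ℝ} (hs : s ∈ uIcc 0 T) (ht : t ∈ uIcc 0 T) :
    ‖(∫ r in (0 : ℝ)..s, f r) - ∫ r in (0 : ℝ)..t, f r‖ ≤ C * dist s t := by
  have h0 : (0 : ℝ) ∈ uIcc 0 T := left_mem_uIcc
  rw [intervalIntegral.integral_interval_sub_left (intervalIntegrable_sub hf h0 hs)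
    (intervalIntegrable_sub hf h0 ht), Real.dist_eq]
  refine intervalIntegral.norm_integral_le_of_norm_le_const_ae ?_
  have h1 : ∀ᵐ r : ℝ, r ≠ T := by simp [ae_iff]
  filter_upwards [hC, h1] with r hr h2 h3
  rw [uIcc_of_le hT.le] at hs ht
  have h4 := mem_uIoc.1 h3
  refine hr ⟨?_, lt_of_le_of_ne ?_ h2⟩
  · rcases h4 with h4 | h4
    · linarith [ht.1]
    · linarith [hs.1]
  · rcases h4 with h4 | h4
    · linarith [hs.2]
    · linarith [ht.2]

theorem intervalIntegrable_of_continuousOn (hT : 0 < T) {E : Type*} [NormedAddCommGroup E]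
    {W : ℝ → E} (hW : ContinuousOn W (Icc 0 T)) : IntervalIntegrable W volume 0 T :=
  ContinuousOn.intervalIntegrable (by rwa [uIcc_of_le hT.le])

/-- The primitive is even Lipschitz into `H^(-2)`: `W` is bounded in `L²` on the compact interval
and `u` is essentially bounded. -/
theorem absolutelyContinuous_planePrimitive (hT : 0 < T)
    (hu : MemLp u ∞ (volume.restrict (Ioo 0 T))) (hW : ContinuousOn W (Icc 0 T)) :
    AbsolutelyContinuousOnInterval (planePrimitive u W) 0 T := by
  obtain ⟨C, hC0, hC⟩ := exists_ae_bound_control hu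
  obtain ⟨C', hC'⟩ := isCompact_Icc.exists_bound_of_continuousOn hW
  have hC'0 : 0 ≤ C' := (norm_nonneg _).trans (hC' 0 ⟨le_rfl, hT.le⟩)
  have hid : AbsolutelyContinuousOnInterval (fun x : ℝ => x) 0 T :=
    (LipschitzWith.id.lipschitzOnWith).absolutelyContinuousOnInterval
  refine absolutelyContinuousOnInterval_of_dist_le
    (C := ‖laplacian (Sobolev (⊤ : Opens (ℝ × ℝ)) 2)‖ * C' + 2 * C * ‖delta‖) hid
    fun x hx y hy => ?_
  have e : planePrimitive u W x - planePrimitive u W y =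
      laplacian (Sobolev ⊤ 2) ((∫ r in (0 : ℝ)..x, W r) - ∫ r in (0 : ℝ)..y, W r) -
        (2 * ((∫ r in (0 : ℝ)..x, u r) - ∫ r in (0 : ℝ)..y, u r)) • delta := by
    have e1 := sub_smul (2 * ∫ r in (0 : ℝ)..x, u r) (2 * ∫ r in (0 : ℝ)..y, u r) delta
    rw [planePrimitive, planePrimitive, map_sub, mul_sub]
    refine Eq.trans ?_ (congrArg _ e1.symm)
    abel
  rw [dist_eq_norm, e]
  have h1 := dist_integral_le hT (intervalIntegrable_of_continuousOn hT hW)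
    (Eventually.of_forall fun r hr => hC' r ⟨hr.1.le, hr.2.le⟩) hx hy
  have h2 := dist_integral_le hT (intervalIntegrable_control hT hu) hC hx hy
  have h3 := (laplacian (Sobolev (⊤ : Opens (ℝ × ℝ)) 2)).le_opNorm
    ((∫ r in (0 : ℝ)..x, W r) - ∫ r in (0 : ℝ)..y, W r)
  refine (norm_sub_le _ _).trans ?_
  rw [norm_smul, norm_mul]
  have h4 : ‖(2 : ℂ)‖ = 2 := by simp
  rw [h4]
  have h5 : 0 ≤ dist x y := dist_nonneg
  calc _ ≤ ‖laplacian (Sobolev (⊤ : Opens (ℝ × ℝ)) 2)‖ * (C' * dist x y) +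
        2 * (C * dist x y) * ‖delta‖ := by
        refine add_le_add (h3.trans (mul_le_mul_of_nonneg_left h1 (norm_nonneg _))) ?_
        gcongr
    _ ≤ _ := by
        have h6 : 0 ≤ ‖laplacian (Sobolev (⊤ : Opens (ℝ × ℝ)) 2)‖ * C' + 2 * C * ‖delta‖ := by
          positivity
        refine Eq.trans_le (by ring) (mul_le_mul_of_nonneg_left (b := dist x y) ?_ h6)
        exact le_add_of_nonneg_left dist_nonneg

/-- In the primitive the integrals are taken in `L²` and in `ℂ` before the Laplacian and `delta` are
applied, so Lebesgue differentiation is used only for the integrands `W` and `u`. -/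
theorem hasDerivAt_planePrimitive (hT : 0 < T)
    (hu : MemLp u ∞ (volume.restrict (Ioo 0 T))) (hW : ContinuousOn W (Icc 0 T)) :
    ∀ᵐ t, t ∈ uIcc 0 T → HasDerivAt (planePrimitive u W)
      (laplacian (Sobolev ⊤ 2) (W t) - (2 * u t) • delta) t := by
  filter_upwards [(intervalIntegrable_control hT hu).ae_hasDerivAt_integral,
    (intervalIntegrable_of_continuousOn hT hW).ae_hasDerivAt_integral] with t h1 h2 ht
  have h1' := h1 ht 0 left_mem_uIcc
  have h2' := h2 ht 0 left_mem_uIcc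
  have h3 : HasDerivAt (fun t => laplacian (Sobolev (⊤ : Opens (ℝ × ℝ)) 2) (∫ r in (0 : ℝ)..t, W r))
      (laplacian (Sobolev ⊤ 2) (W t)) t :=
    ((laplacian (Sobolev (⊤ : Opens (ℝ × ℝ)) 2)).restrictScalars ℝ).hasFDerivAt.comp_hasDerivAt t h2'
  exact h3.sub ((h1'.const_mul 2).smul_const delta)

theorem ae_restrict_Ioo_of_ae_uIcc (hT : 0 < T) {p : ℝ → Prop} (h : ∀ᵐ t, t ∈ uIcc 0 T → p t) :
    ∀ᵐ t ∂(volume.restrict (Ioo 0 T)), p t := by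
  rw [ae_restrict_iff' measurableSet_Ioo]
  filter_upwards [h] with t ht h'
  exact ht (by rw [uIcc_of_le hT.le]; exact ⟨h'.1.le, h'.2.le⟩)

theorem ae_uIcc_of_ae_restrict_Ioo (hT : 0 < T) {p : ℝ → Prop}
    (h : ∀ᵐ t ∂(volume.restrict (Ioo 0 T)), p t) : ∀ᵐ t, t ∈ uIcc 0 T → p t := by
  rw [ae_restrict_iff' measurableSet_Ioo] at h
  have h1 : ∀ᵐ r : ℝ, r ≠ T := by simp [ae_iff]
  have h2 : ∀ᵐ r : ℝ, r ≠ 0 := by simp [ae_iff]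
  filter_upwards [h, h1, h2] with t ht h1 h2 h3
  rw [uIcc_of_le hT.le] at h3
  exact ht ⟨lt_of_le_of_ne h3.1 (Ne.symm h2), lt_of_le_of_ne h3.2 h1⟩

/-- The difference of the two sides is absolutely continuous with derivative zero almost everywhere,
hence constant. Without absolute continuity the singular part of the evolution would escape the
equation. -/
theorem IsPlaneSolution.sub_eq_planePrimitive {W₀ : L2 (⊤ : Opens (ℝ × ℝ))} (hT : 0 < T)
    (hu : MemLp u ∞ (volume.restrict (Ioo 0 T))) (h : IsPlaneSolution T u W₀ W) {t : ℝ}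
    (ht : t ∈ Icc 0 T) :
    distDeriv (Sobolev ⊤ 2) 0 0 (by norm_num) (W t) - distDeriv (Sobolev ⊤ 2) 0 0 (by norm_num) (W 0) =
      planePrimitive u W t := by
  have h1 := h.absolutelyContinuous.sub (absolutelyContinuous_planePrimitive hT hu h.continuousOn)
  obtain ⟨C, hC⟩ := h1.const_of_ae_hasDerivAt_zero (by
    filter_upwards [hasDerivAt_planePrimitive hT hu h.continuousOn,
      ae_uIcc_of_ae_restrict_Ioo hT h.heat] with t h2 h3 h4
    simpa using (h3 h4).sub (h2 h4))
  rw [uIcc_of_le hT.le] at hC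
  have e1 := hC t ht
  have e2 := hC 0 ⟨le_rfl, hT.le⟩
  have e3 : planePrimitive u W 0 = 0 := by
    rw [planePrimitive, intervalIntegral.integral_same, intervalIntegral.integral_same, map_zero,
      mul_zero, zero_sub, neg_eq_zero]
    exact zero_smul ℂ delta
  simp only [Pi.sub_apply, e3, sub_zero] at e1 e2
  rw [e2, ← e1]; abel

/-- The increments of `W` in `H^(-2)` are those of the primitive, from which absolute continuity and
the derivative almost everywhere are inherited. -/
theorem isPlaneSolution_of_sub_eq {W₀ : L2 (⊤ : Opens (ℝ × ℝ))} (hT : 0 < T)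
    (hu : MemLp u ∞ (volume.restrict (Ioo 0 T))) (he : ∀ t ∈ Icc 0 T, IsEven (W t))
    (hc : ContinuousOn W (Icc 0 T)) (h0 : W 0 = W₀) (h : ∀ t ∈ Icc 0 T,
    distDeriv (Sobolev ⊤ 2) 0 0 (by norm_num) (W t) - distDeriv (Sobolev ⊤ 2) 0 0 (by norm_num) (W 0) =
      planePrimitive u W t) : IsPlaneSolution T u W₀ W where
  even := he
  continuousOn := hc
  initial := h0
  absolutelyContinuous := by
    refine absolutelyContinuousOnInterval_of_dist_le (C := 1)
      (absolutelyContinuous_planePrimitive hT hu hc) fun x hx y hy => ?_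
    rw [uIcc_of_le hT.le] at hx hy
    rw [← h x hx, ← h y hy, dist_sub_right, one_mul]
    exact le_add_of_nonneg_right dist_nonneg
  heat := by
    have h1 := ae_restrict_Ioo_of_ae_uIcc hT (hasDerivAt_planePrimitive hT hu hc)
    filter_upwards [h1, ae_restrict_mem measurableSet_Ioo] with t h2 h3
    refine (h2.add_const (distDeriv (Sobolev ⊤ 2) 0 0 (by norm_num) (W 0))).congr_of_eventuallyEq ?_
    filter_upwards [Ioo_mem_nhds h3.1 h3.2] with s hs
    rw [← h s ⟨hs.1.le, hs.2.le⟩]; abel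

end IntegralForm

/-! ### Reflection, even extension and restriction -/

section Reflection

/-- The reflection in the line `x₁ = 0`. -/
def reflect (x : ℝ × ℝ) : ℝ × ℝ := (-x.1, x.2)

theorem reflect_reflect (x : ℝ × ℝ) : reflect (reflect x) = x := by simp [reflect]

theorem measurePreserving_reflect : MeasurePreserving reflect volume volume :=
  (Measure.measurePreserving_neg (volume : Measure ℝ)).prod (MeasurePreserving.id volume)

theorem continuous_reflect : Continuous reflect := by unfold reflect; fun_prop

theorem measurableEmbedding_reflect : MeasurableEmbedding reflect :=
  (Homeomorph.mk ⟨reflect, reflect, reflect_reflect, reflect_reflect⟩ continuous_reflect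
    continuous_reflect).measurableEmbedding

theorem measurableSet_halfPlane : MeasurableSet (halfPlane : Set (ℝ × ℝ)) :=
  halfPlane.isOpen.measurableSet

theorem ae_fst_ne_zero : ∀ᵐ x : ℝ × ℝ, x.1 ≠ 0 := by
  have e : {x : ℝ × ℝ | ¬x.1 ≠ 0} = {0} ×ˢ univ := by ext x; simp
  rw [ae_iff, e, Measure.volume_eq_prod, Measure.prod_prod]
  simp

theorem integral_eq_halfPlane {F : ℝ × ℝ → ℂ} (hF : Integrable F volume) :
    ∫ x, F x = ∫ x in (halfPlane : Set (ℝ × ℝ)), (F x + F (reflect x)) := by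
  have hr : Integrable (fun x => F (reflect x)) volume :=
    (measurePreserving_reflect.integrable_comp_emb measurableEmbedding_reflect).2 hF
  rw [← integral_add_compl measurableSet_halfPlane hF,
    integral_add hF.integrableOn hr.integrableOn]
  congr 1
  have h := measurePreserving_reflect.setIntegral_preimage_emb measurableEmbedding_reflect
    (fun x => F (reflect x)) (halfPlane : Set (ℝ × ℝ))
  simp only [reflect_reflect] at h
  rw [← h]
  refine setIntegral_congr_set ?_
  filter_upwards [ae_fst_ne_zero] with x hx
  refine propext ?_
  change ¬(0 < x.1) ↔ 0 < -x.1
  constructor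
  · intro h1
    have := lt_of_le_of_ne (not_lt.1 h1) hx
    linarith
  · intro h1; linarith

theorem evenExtension_ae (f : L2 halfPlane) :
    evenExtension f =ᵐ[volume] fun x : ℝ × ℝ => f (|x.1|, x.2) :=
  ae_top_iff.1 (memLp_fold f).coeFn_toLp

theorem isEven_evenExtension (f : L2 halfPlane) : IsEven (evenExtension f) := by
  have h := measurePreserving_reflect.quasiMeasurePreserving.ae (evenExtension_ae f)
  filter_upwards [evenExtension_ae f, h] with x h1 h2
  change evenExtension f (reflect x) = _
  rw [h1, h2]
  simp [reflect]

theorem integral_evenExtension_mul (f : L2 halfPlane) {Φ : ℝ × ℝ → ℂ} (hΦ : MemLp Φ 2 volume) :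
    ∫ x, evenExtension f x * Φ x =
      ∫ x in (halfPlane : Set (ℝ × ℝ)), f x * (Φ x + Φ (reflect x)) := by
  rw [integral_eq_halfPlane (F := fun x => evenExtension f x * Φ x)
    ((memLp_top (evenExtension f)).integrable_mul hΦ)]
  refine integral_congr_ae ?_
  have h := measurePreserving_reflect.quasiMeasurePreserving.ae (evenExtension_ae f)
  filter_upwards [ae_restrict_of_ae (evenExtension_ae f), ae_restrict_of_ae h,
    ae_restrict_mem measurableSet_halfPlane] with x h1 h2 h3
  have h4 : |x.1| = x.1 := abs_of_pos h3
  simp only [h1, h2]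
  simp only [reflect, abs_neg, h4]
  ring

/-- Folding carries the measure of the plane to twice that of the half-plane. The exact factor is `2
^ (1/2)`; only a Lipschitz bound is needed, and `2` is enough. -/
theorem norm_evenExtension_sub_le (f g : L2 halfPlane) :
    ‖evenExtension f - evenExtension g‖ ≤ 2 * ‖f - g‖ := by
  have h1 : (evenExtension f - evenExtension g : L2 ⊤) =ᵐ[volume]
      (fun x => (f - g : L2 halfPlane) x) ∘ fun x : ℝ × ℝ => (|x.1|, x.2) := by
    have h3 : ∀ᵐ x ∂(Measure.map (fun x : ℝ × ℝ => (|x.1|, x.2)) volume),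
        (f - g : L2 halfPlane) x = f x - g x := by
      rw [map_fold_volume]
      exact Measure.ae_smul_measure (Lp.coeFn_sub f g) _
    have h4 := ae_of_ae_map (by fun_prop) h3
    filter_upwards [evenExtension_ae f, evenExtension_ae g,
      ae_top_iff.1 (Lp.coeFn_sub (evenExtension f) (evenExtension g)), h4] with x a b c d
    rw [c, Pi.sub_apply, a, b, Function.comp_apply, d]
  rw [Lp.norm_def, Lp.norm_def, eLpNorm_restrict_top, eLpNorm_congr_ae h1]
  have hm : AEStronglyMeasurable (f - g : L2 halfPlane)
      (Measure.map (fun x : ℝ × ℝ => (|x.1|, x.2)) volume) := by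
    rw [map_fold_volume]
    exact (Lp.memLp (f - g)).1.smul_measure _
  rw [← eLpNorm_map_measure hm (by fun_prop), map_fold_volume,
    eLpNorm_smul_measure_of_ne_top (by norm_num), smul_eq_mul, ENNReal.toReal_mul]
  refine mul_le_mul_of_nonneg_right ?_ ENNReal.toReal_nonneg
  refine ENNReal.toReal_le_of_le_ofReal (by norm_num) ?_
  calc _ ≤ (2 : ℝ≥0∞) ^ (1 : ℝ) := ENNReal.rpow_le_rpow_of_exponent_le (by norm_num) (by norm_num)
    _ = _ := by simp

theorem restriction_ae (f : L2 (⊤ : Opens (ℝ × ℝ))) :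
    restriction f =ᵐ[volume.restrict (halfPlane : Set (ℝ × ℝ))] f := MemLp.coeFn_toLp _

theorem norm_restriction_sub_le (f g : L2 (⊤ : Opens (ℝ × ℝ))) :
    ‖restriction f - restriction g‖ ≤ ‖f - g‖ := by
  have hle : (volume : Measure (ℝ × ℝ)).restrict (halfPlane : Set (ℝ × ℝ)) ≤
      volume.restrict ((⊤ : Opens (ℝ × ℝ)) : Set (ℝ × ℝ)) :=
    Measure.restrict_mono (subset_univ _) le_rfl
  have h1 : (restriction f - restriction g : L2 halfPlane)
      =ᵐ[volume.restrict (halfPlane : Set (ℝ × ℝ))] (f - g : L2 ⊤) := by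
    filter_upwards [restriction_ae f, restriction_ae g, Lp.coeFn_sub (restriction f) (restriction g),
      ae_mono hle (Lp.coeFn_sub f g)] with x a b c d
    rw [c, d, Pi.sub_apply, Pi.sub_apply, a, b]
  rw [Lp.norm_def, Lp.norm_def, eLpNorm_congr_ae h1]
  exact ENNReal.toReal_mono (Lp.eLpNorm_ne_top _) (eLpNorm_mono_measure _ hle)

theorem integral_restriction_mul (f : L2 (⊤ : Opens (ℝ × ℝ))) (Φ : ℝ × ℝ → ℂ) :
    ∫ x in (halfPlane : Set (ℝ × ℝ)), restriction f x * Φ x =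
      ∫ x in (halfPlane : Set (ℝ × ℝ)), f x * Φ x := by
  refine integral_congr_ae ?_
  filter_upwards [restriction_ae f] with x hx
  rw [hx]

/-- The integral over the half-plane of an even function is half of the integral over the plane. -/
theorem IsEven.integral_restriction_mul {f : L2 (⊤ : Opens (ℝ × ℝ))} (hf : IsEven f)
    {Φ : ℝ × ℝ → ℂ} (hΦ : MemLp Φ 2 volume) (he : ∀ x, Φ (reflect x) = Φ x) :
    2 * ∫ x in (halfPlane : Set (ℝ × ℝ)), restriction f x * Φ x = ∫ x, f x * Φ x := by
  rw [HalfPlaneHeat.integral_restriction_mul,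
    integral_eq_halfPlane (F := fun x => f x * Φ x)
      ((memLp_top f).integrable_mul hΦ), ← integral_const_mul]
  refine integral_congr_ae ?_
  filter_upwards [ae_restrict_of_ae hf] with x hx
  have hx' : f (reflect x) = f x := hx
  simp only [he, hx']
  ring

theorem continuousOn_of_norm_sub_le {X E F : Type*} [TopologicalSpace X] [NormedAddCommGroup E]
    [NormedAddCommGroup F] {W : X → E} {s : Set X} (hW : ContinuousOn W s) {f : E → F} {C : ℝ}
    (hf : ∀ a b, ‖f a - f b‖ ≤ C * ‖a - b‖) : ContinuousOn (fun t => f (W t)) s := by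
  have : Continuous f := (LipschitzWith.of_dist_le' (K := C) fun a b => by
    rw [dist_eq_norm, dist_eq_norm]; exact hf a b).continuous
  exact this.comp_continuousOn hW

end Reflection

/-! ### Tensor products of test functions and vanishing on the line -/

section TestFunctions

theorem testDeriv₁_succ {U : Opens ℝ} (k : ℕ) (η : 𝓓(U, ℂ)) :
    testDeriv₁ (k + 1) η = ∂_{(1 : ℝ)} (testDeriv₁ k η) := by
  simp only [testDeriv₁, Function.iterate_succ', Function.comp_apply]

theorem hasDerivAt_testDeriv₁ {U : Opens ℝ} (k : ℕ) (η : 𝓓(U, ℂ)) (x : ℝ) :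
    HasDerivAt (testDeriv₁ k η) (testDeriv₁ (k + 1) η x) x := by
  rw [testDeriv₁_succ]
  exact hasDerivAt_testFunction _ x

theorem integral_mul_testDeriv₁ {U V : Opens ℝ} (p : 𝓓(V, ℂ)) (η : 𝓓(U, ℂ)) (k : ℕ) :
    ∫ x, p x * testDeriv₁ k η x = (-1) ^ k * ∫ x, testDeriv₁ k p x * η x := by
  have h : ∀ k l, ∫ x, testDeriv₁ l p x * testDeriv₁ k η x =
      (-1) ^ k * ∫ x, testDeriv₁ (l + k) p x * η x := by
    intro k
    induction k with
    | zero => intro l; simp [testDeriv₁]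
    | succ k ih =>
      intro l
      have hi : ∀ (f : 𝓓(V, ℂ)) (g : 𝓓(U, ℂ)), Integrable (⇑f * ⇑g) volume := fun f g =>
        (f.continuous.mul g.continuous).integrable_of_hasCompactSupport g.hasCompactSupport.mul_left
      rw [integral_mul_deriv_eq_deriv_mul_of_integrable (fun x _ => hasDerivAt_testDeriv₁ l p x)
        (fun x _ => hasDerivAt_testDeriv₁ k η x) (hi _ _) (hi _ _) (hi _ _), ih (l + 1),
        show l + 1 + k = l + (k + 1) by omega]
      ring
  have := h k 0
  rw [zero_add] at this
  exact this

/-- A test function on the line as an element of `H^s(ℝ)`. -/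
def ofTest₁ (s : ℕ) (p : 𝓓((⊤ : Opens ℝ), ℂ)) : Space (Sobolev₁ ⊤ s) :=
  ⟨WithLp.toLp 2 fun k => toL2 ⊤ (memLp_testFunction 2 (testDeriv₁ k p) volume), fun k η => by
    have e : ∀ (q η : 𝓓((⊤ : Opens ℝ), ℂ)), ∫ x in ((⊤ : Opens ℝ) : Set ℝ),
        toL2 ⊤ (memLp_testFunction 2 q volume) x * η x = ∫ x, q x * η x := fun q η => by
      rw [integral_top]
      refine integral_congr_ae ?_
      filter_upwards [ae_top_iff.1 (toL2_ae ⊤ (memLp_testFunction 2 q volume))] with x hx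
      rw [hx]
    have h := integral_mul_testDeriv₁ p η k
    rw [← e, ← e] at h
    exact h⟩

theorem coord_ofTest₁ (s : ℕ) (p : 𝓓((⊤ : Opens ℝ), ℂ)) (k : Fin (s + 1)) :
    coord₁ (Sobolev₁ ⊤ s) k (ofTest₁ s p) =
      toL2 ⊤ (memLp_testFunction 2 (testDeriv₁ k p) volume) := rfl

theorem delta₁_ofTest₁ (p : 𝓓((⊤ : Opens ℝ), ℂ)) : delta₁ (ofTest₁ 1 p) = p 0 :=
  delta₁_apply _ _ fun k => by
    rw [coord_ofTest₁]
    exact ae_top_iff.1 (toL2_ae ⊤ _)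

/-- The test function `p(x₁) q(x₂)`. -/
def tensorTest (p q : 𝓓((⊤ : Opens ℝ), ℂ)) : 𝓓((⊤ : Opens (ℝ × ℝ)), ℂ) where
  toFun x := p x.1 * q x.2
  contDiff' := ((contDiff_testFunction p).comp contDiff_fst).mul
    ((contDiff_testFunction q).comp contDiff_snd)
  hasCompactSupport' := HasCompactSupport.intro
    (p.hasCompactSupport.isCompact.prod q.hasCompactSupport.isCompact) fun x hx => by
      by_cases h : x.1 ∈ tsupport p
      · rw [image_eq_zero_of_notMem_tsupport (f := q) fun h' => hx ⟨h, h'⟩, mul_zero]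
      · rw [image_eq_zero_of_notMem_tsupport h, zero_mul]
  tsupport_subset' := subset_univ _

theorem testDeriv_tensorTest (p q : 𝓓((⊤ : Opens ℝ), ℂ)) (a b : ℕ) :
    testDeriv a b (tensorTest p q) = tensorTest (testDeriv₁ a p) (testDeriv₁ b q) := by
  induction a with
  | zero =>
    induction b with
    | zero => rfl
    | succ b ih =>
      rw [testDeriv_succ_right, ih]
      ext x
      refine (hasDerivAt_slice_snd _ x.1 x.2).unique ?_
      exact (hasDerivAt_testDeriv₁ b q x.2).const_mul (testDeriv₁ 0 p x.1)
  | succ a ih =>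
    rw [testDeriv_succ_left, ih]
    ext x
    refine (hasDerivAt_slice_fst _ x.1 x.2).unique ?_
    exact (hasDerivAt_testDeriv₁ a p x.1).mul_const (testDeriv₁ b q x.2)

theorem testDeriv_sub (ζ ξ : 𝓓((⊤ : Opens (ℝ × ℝ)), ℂ)) (a b : ℕ) :
    testDeriv a b (ζ - ξ) = testDeriv a b ζ - testDeriv a b ξ := by
  induction a with
  | zero =>
    induction b with
    | zero => rfl
    | succ b ih =>
      simp only [testDeriv_succ_right, ih]
      ext x
      refine (hasDerivAt_slice_snd _ x.1 x.2).unique ?_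
      exact (hasDerivAt_slice_snd _ x.1 x.2).sub (hasDerivAt_slice_snd _ x.1 x.2)
  | succ a ih =>
    simp only [testDeriv_succ_left, ih]
    ext x
    refine (hasDerivAt_slice_fst _ x.1 x.2).unique ?_
    exact (hasDerivAt_slice_fst _ x.1 x.2).sub (hasDerivAt_slice_fst _ x.1 x.2)

theorem testDeriv_add (ζ ξ : 𝓓((⊤ : Opens (ℝ × ℝ)), ℂ)) (a b : ℕ) :
    testDeriv a b (ζ + ξ) = testDeriv a b ζ + testDeriv a b ξ := by
  induction a with
  | zero =>
    induction b with
    | zero => rfl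
    | succ b ih =>
      simp only [testDeriv_succ_right, ih]
      ext x
      refine (hasDerivAt_slice_snd _ x.1 x.2).unique ?_
      exact (hasDerivAt_slice_snd _ x.1 x.2).add (hasDerivAt_slice_snd _ x.1 x.2)
  | succ a ih =>
    simp only [testDeriv_succ_left, ih]
    ext x
    refine (hasDerivAt_slice_fst _ x.1 x.2).unique ?_
    exact (hasDerivAt_slice_fst _ x.1 x.2).add (hasDerivAt_slice_fst _ x.1 x.2)

/-- By the mean value theorem `‖η x‖ ≤ C |x₁|`. The integral of the square over the strip of width
`ε` is then `O(ε²)`, one power better than required. -/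
theorem vanishesOnLine_of_test {η : 𝓓((⊤ : Opens (ℝ × ℝ)), ℂ)} (h0 : ∀ y, η (0, y) = 0) :
    VanishesOnLine (toL2 halfPlane (memLp_testFunction 2 η volume)) := by
  obtain ⟨C, hC⟩ := (TestFunction.continuous
    (∂_{((1, 0) : ℝ × ℝ)} η : 𝓓((⊤ : Opens (ℝ × ℝ)), ℂ))).bounded_above_of_compact_support
    (TestFunction.hasCompactSupport _)
  have hC0 : 0 ≤ C := (norm_nonneg _).trans (hC 0)
  have hb : ∀ x : ℝ × ℝ, ‖η x‖ ≤ C * |x.1| := fun x => by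
    have := convex_univ.norm_image_sub_le_of_norm_hasDerivWithin_le (s := univ)
      (f := fun t => η (t, x.2)) (C := C) (x := 0) (y := x.1)
      (fun t _ => (hasDerivAt_slice_fst η t x.2).hasDerivWithinAt) (fun t _ => hC _)
      (mem_univ _) (mem_univ _)
    simpa [h0] using this
  have hK : volume (tsupport η) ≠ ∞ := η.hasCompactSupport.isCompact.measure_lt_top.ne
  set V := (volume (tsupport η)).toReal with hV
  have hlim : Tendsto (fun ε : ℝ => ε * (C ^ 2 * V)) (𝓝[>] 0) (𝓝 0) := by
    have : Tendsto (fun ε : ℝ => ε * (C ^ 2 * V)) (𝓝 0) (𝓝 (0 * (C ^ 2 * V))) :=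
      tendsto_id.mul_const _
    rw [zero_mul] at this
    exact this.mono_left nhdsWithin_le_nhds
  refine squeeze_zero' ?_ ?_ hlim
  · filter_upwards [self_mem_nhdsWithin] with ε hε
    have : (0 : ℝ) < ε := hε
    positivity
  · filter_upwards [self_mem_nhdsWithin] with ε hε
    have hε' : (0 : ℝ) < ε := hε
    have hm : MeasurableSet {x : ℝ × ℝ | 0 < x.1 ∧ x.1 < ε} :=
      (measurableSet_lt measurable_const measurable_fst).inter
        (measurableSet_lt measurable_fst measurable_const)
    have h1 : ∫ x in {x : ℝ × ℝ | 0 < x.1 ∧ x.1 < ε},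
        ‖toL2 halfPlane (memLp_testFunction 2 η volume) x‖ ^ 2 ≤
        ∫ x in {x : ℝ × ℝ | 0 < x.1 ∧ x.1 < ε},
          (tsupport η).indicator (fun _ => (C * ε) ^ 2) x := by
      refine integral_mono_ae (integrable_sq_strip _ ε) ?_ ?_
      · exact ((integrable_indicator_iff (isClosed_tsupport η).measurableSet).2
          (integrableOn_const hK)).mono_measure Measure.restrict_le_self
      · filter_upwards [ae_mono (restrict_strip_le ε)
          (toL2_ae halfPlane (memLp_testFunction 2 η volume)), ae_restrict_mem hm] with x hx hxs
        rw [hx]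
        by_cases h : x ∈ tsupport η
        · rw [indicator_of_mem h]
          refine pow_le_pow_left₀ (norm_nonneg _) ((hb x).trans ?_) 2
          rw [abs_of_pos hxs.1]
          exact mul_le_mul_of_nonneg_left hxs.2.le hC0
        · rw [indicator_of_notMem h, image_eq_zero_of_notMem_tsupport h]; simp
    have h2 : ∫ x in {x : ℝ × ℝ | 0 < x.1 ∧ x.1 < ε},
          (tsupport η).indicator (fun _ => (C * ε) ^ 2) x ≤ V * (C * ε) ^ 2 := by
      refine (setIntegral_le_integral ?_ ?_).trans ?_
      · exact (integrable_indicator_iff (isClosed_tsupport η).measurableSet).2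
          (integrableOn_const hK)
      · exact Eventually.of_forall fun x => indicator_nonneg (fun _ _ => by positivity) x
      · rw [integral_indicator (isClosed_tsupport η).measurableSet, setIntegral_const, smul_eq_mul]
        rfl
    calc _ ≤ ε⁻¹ * (V * (C * ε) ^ 2) := mul_le_mul_of_nonneg_left (h1.trans h2) (by positivity)
      _ = _ := by field_simp

end TestFunctions

/-! ### The corrector: even primitives and their dilates -/

section EvenPrimitive

/-- The primitive `x ↦ ∫_0^x ψ`. -/
def primitive (ψ : 𝓓(posRay, ℂ)) (x : ℝ) : ℂ := ∫ r in (0 : ℝ)..x, ψ r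

theorem hasDerivAt_primitive (ψ : 𝓓(posRay, ℂ)) (x : ℝ) : HasDerivAt (primitive ψ) (ψ x) x :=
  intervalIntegral.integral_hasDerivAt_right (ψ.continuous.intervalIntegrable _ _)
    (ψ.continuous.stronglyMeasurableAtFilter _ _) ψ.continuous.continuousAt

theorem contDiff_primitive (ψ : 𝓓(posRay, ℂ)) :
    ContDiff ℝ ((⊤ : ℕ∞) : WithTop ℕ∞) (primitive ψ) := by
  rw [contDiff_infty_iff_deriv]
  refine ⟨fun x => (hasDerivAt_primitive ψ x).differentiableAt, ?_⟩
  rw [show deriv (primitive ψ) = ψ from funext fun x => (hasDerivAt_primitive ψ x).deriv]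
  exact contDiff_testFunction ψ

theorem primitive_of_nonpos (ψ : 𝓓(posRay, ℂ)) {x : ℝ} (hx : x ≤ 0) : primitive ψ x = 0 := by
  rw [primitive, ← intervalIntegral.integral_zero (E := ℂ) (a := 0) (b := x) (μ := volume)]
  refine intervalIntegral.integral_congr fun r hr => ?_
  rw [uIcc_of_ge hx] at hr
  exact testFunction_eq_zero ψ fun h => absurd (show (0 : ℝ) < r from h) (not_lt.2 hr.2)

theorem exists_primitive_eq (ψ : 𝓓(posRay, ℂ)) : ∃ M, 0 < M ∧ ∀ x, M ≤ x → primitive ψ x = ∫ r, ψ r := by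
  obtain ⟨M, hM⟩ := ψ.hasCompactSupport.isCompact.isBounded.subset_closedBall (0 : ℝ)
  refine ⟨max M 1, by positivity, fun x hx => ?_⟩
  have hx0 : 0 ≤ x := (zero_le_one.trans (le_max_right M 1)).trans hx
  rw [primitive, intervalIntegral.integral_of_le hx0]
  refine setIntegral_eq_integral_of_forall_compl_eq_zero fun r hr => ?_
  by_cases h : 0 < r
  · refine image_eq_zero_of_notMem_tsupport fun h' => hr ⟨h, ?_⟩
    have := hM h'
    rw [Metric.mem_closedBall, Real.dist_eq, sub_zero, abs_of_pos h] at this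
    exact this.trans ((le_max_left _ _).trans hx)
  · exact testFunction_eq_zero ψ h

/-- The even test function `g` with `g' = -ψ` for `x > 0`, that is `g(x) = ∫_{|x|}^∞ ψ`. -/
def evenPrimitive (ψ : 𝓓(posRay, ℂ)) : 𝓓((⊤ : Opens ℝ), ℂ) where
  toFun x := (∫ r, ψ r) - primitive ψ x - primitive ψ (-x)
  contDiff' := (contDiff_const.sub (contDiff_primitive ψ)).sub
    ((contDiff_primitive ψ).comp contDiff_neg)
  hasCompactSupport' := by
    obtain ⟨M, hM0, hM⟩ := exists_primitive_eq ψ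
    refine HasCompactSupport.intro (isCompact_Icc (a := -M) (b := M)) fun x hx => ?_
    rcases lt_or_ge x (-M) with h | h
    · rw [primitive_of_nonpos ψ (by linarith), hM (-x) (by linarith)]; simp
    · have h' : M < x := by
        by_contra h'
        exact hx ⟨h, not_lt.1 h'⟩
      rw [primitive_of_nonpos ψ (x := -x) (by linarith), hM x h'.le]; simp
  tsupport_subset' := subset_univ _

theorem evenPrimitive_apply (ψ : 𝓓(posRay, ℂ)) (x : ℝ) :
    evenPrimitive ψ x = (∫ r, ψ r) - primitive ψ x - primitive ψ (-x) := rfl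

theorem evenPrimitive_zero (ψ : 𝓓(posRay, ℂ)) : evenPrimitive ψ 0 = ∫ r, ψ r := by
  simp [evenPrimitive_apply, primitive]

theorem evenPrimitive_deriv_one (ψ : 𝓓(posRay, ℂ)) (x : ℝ) :
    testDeriv₁ 1 (evenPrimitive ψ) x = ψ (-x) - ψ x := by
  refine (hasDerivAt_testDeriv₁ 0 _ x).unique ?_
  have h1 := (hasDerivAt_primitive ψ (-x)).scomp x (hasDerivAt_neg x)
  have h2 := ((hasDerivAt_primitive ψ x).const_sub (∫ r, ψ r)).sub h1
  exact h2.congr_deriv (by simp; ring)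

theorem evenPrimitive_deriv_two (ψ : 𝓓(posRay, ℂ)) (x : ℝ) :
    testDeriv₁ 2 (evenPrimitive ψ) x = -(testDeriv₁ 1 ψ (-x) + testDeriv₁ 1 ψ x) := by
  refine (hasDerivAt_testDeriv₁ 1 _ x).unique ?_
  have h1 := (hasDerivAt_testDeriv₁ 0 ψ (-x)).scomp x (hasDerivAt_neg x)
  have h2 := h1.sub (hasDerivAt_testDeriv₁ 0 ψ x)
  refine (h2.congr_deriv (by simp; ring)).congr_of_eventuallyEq
    (Eventually.of_forall fun t => evenPrimitive_deriv_one ψ t)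

theorem evenPrimitive_deriv_two_of_pos (ψ : 𝓓(posRay, ℂ)) {x : ℝ} (hx : 0 < x) :
    testDeriv₁ 2 (evenPrimitive ψ) x = -testDeriv₁ 1 ψ x := by
  rw [evenPrimitive_deriv_two, testFunction_eq_zero (testDeriv₁ 1 ψ) (x := -x), zero_add]
  intro h
  have : 0 < -x := h
  linarith

theorem dilate_apply {α : ℝ} (hα : 0 < α) (ψ : 𝓓(posRay, ℂ)) (x : ℝ) :
    dilate α ψ x = (α : ℂ)⁻¹ * ψ (α⁻¹ * x) := by
  rw [dilate, dif_pos hα]; rfl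

theorem primitive_dilate {α : ℝ} (hα : 0 < α) (ψ : 𝓓(posRay, ℂ)) (x : ℝ) :
    primitive (dilate α ψ) x = primitive ψ (α⁻¹ * x) := by
  have h := intervalIntegral.integral_comp_mul_left (a := 0) (b := x) ψ (inv_ne_zero hα.ne')
  rw [mul_zero, inv_inv] at h
  simp only [primitive, dilate_apply hα, intervalIntegral.integral_const_mul, h]
  rw [Complex.real_smul, inv_mul_cancel_left₀ (by exact_mod_cast hα.ne')]

theorem integral_dilate {α : ℝ} (hα : 0 < α) (ψ : 𝓓(posRay, ℂ)) :
    ∫ x, dilate α ψ x = ∫ x, ψ x := by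
  have h := Measure.integral_comp_smul volume ψ α⁻¹
  simp only [smul_eq_mul, Module.finrank_self, pow_one, inv_inv, abs_of_pos hα] at h
  simp only [dilate_apply hα, integral_const_mul, h]
  rw [Complex.real_smul, inv_mul_cancel_left₀ (by exact_mod_cast hα.ne')]

theorem evenPrimitive_dilate {α : ℝ} (hα : 0 < α) (ψ : 𝓓(posRay, ℂ)) (x : ℝ) :
    evenPrimitive (dilate α ψ) x = evenPrimitive ψ (α⁻¹ * x) := by
  simp only [evenPrimitive_apply, integral_dilate hα, primitive_dilate hα, mul_neg]

theorem lpNorm_two_sq {E : Type*} {m : MeasurableSpace E} {μ : Measure E} {f : E → ℂ}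
    (hf : MemLp f 2 μ) : lpNorm f 2 μ ^ 2 = ∫ x, ‖f x‖ ^ 2 ∂μ := by
  rw [lpNorm_eq_integral_norm_rpow_toReal (by norm_num) (by norm_num) hf.1]
  simp only [ENNReal.toReal_ofNat, Real.rpow_ofNat]
  rw [← Real.rpow_natCast, ← Real.rpow_mul (integral_nonneg fun _ => by positivity)]
  norm_num

/-- Passing from `ψ` to `α⁻¹ ψ(x/α)` only dilates the even primitive, without changing its height,
so the square of the norm scales like the width `α`. This is why the corrector disappears in `L²`
although its value on the line is fixed. -/
theorem lpNorm_tensor_evenPrimitive_dilate {α : ℝ} (hα : 0 < α) (ψ : 𝓓(posRay, ℂ)) {q : ℝ → ℂ}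
    (hq : MemLp q 2 volume) :
    lpNorm (fun x : ℝ × ℝ => evenPrimitive (dilate α ψ) x.1 * q x.2) 2 volume =
      √α * lpNorm (fun x : ℝ × ℝ => evenPrimitive ψ x.1 * q x.2) 2 volume := by
  have h := fun ψ => memLp_tensor (memLp_testFunction 2 (evenPrimitive ψ) volume) hq
  rw [← sq_eq_sq₀ lpNorm_nonneg (mul_nonneg (Real.sqrt_nonneg _) lpNorm_nonneg), mul_pow, Real.sq_sqrt hα.le,
    lpNorm_two_sq (h _), lpNorm_two_sq (h _)]
  simp only [norm_mul, mul_pow]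
  rw [Measure.volume_eq_prod, integral_prod_mul (fun x => ‖evenPrimitive (dilate α ψ) x‖ ^ 2)
    (fun y => ‖q y‖ ^ 2), integral_prod_mul (fun x => ‖evenPrimitive ψ x‖ ^ 2) (fun y => ‖q y‖ ^ 2),
    ← mul_assoc]
  congr 1
  have h := Measure.integral_comp_smul volume (fun x : ℝ => ‖evenPrimitive ψ x‖ ^ 2) α⁻¹
  simp only [smul_eq_mul, Module.finrank_self, pow_one, inv_inv, abs_of_pos hα] at h
  simp only [evenPrimitive_dilate hα, h]

/-- The pairing of the normal derivative with a tensor, written with the even primitive. -/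
theorem flux_eq (w : L2 halfPlane) (ψ : 𝓓(posRay, ℂ)) (φ : Space (Sobolev₁ ⊤ 1)) :
    distDeriv (SobolevZero 1) 1 0 (by norm_num) w (tensor ψ φ) =
      ∫ x in (halfPlane : Set (ℝ × ℝ)), w x *
        (testDeriv₁ 2 (evenPrimitive ψ) x.1 * coord₁ (Sobolev₁ ⊤ 1) 0 φ x.2) := by
  have e : coord (SobolevZero 1) 1 0 (by norm_num) (tensor ψ φ) =
    tensorCoord ψ φ (multiIndex 1 0 (by norm_num)) := rfl
  rw [distDeriv_apply, e, ← integral_const_mul]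
  refine integral_congr_ae ?_
  filter_upwards [tensorCoord_ae ψ φ (multiIndex 1 0 (by norm_num)),
    ae_restrict_mem measurableSet_halfPlane] with x hx h0
  rw [hx, evenPrimitive_deriv_two_of_pos ψ h0]
  simp only [multiIndex]
  norm_num

end EvenPrimitive

/-! ### The even extension of a half-plane solution -/

section HalfPlaneToPlane

/-- Pairing on the half-plane with a test function on the plane. -/
def halfPairing (η : 𝓓((⊤ : Opens (ℝ × ℝ)), ℂ)) : L2 halfPlane →L[ℂ] ℂ :=
  (pairing halfPlane).flip (toL2 halfPlane (memLp_testFunction 2 η volume))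

theorem halfPairing_apply (η : 𝓓((⊤ : Opens (ℝ × ℝ)), ℂ)) (f : L2 halfPlane) :
    halfPairing η f = ∫ x in (halfPlane : Set (ℝ × ℝ)), f x * η x := by
  rw [halfPairing, ContinuousLinearMap.flip_apply, pairing_toL2]

theorem integrable_mul_memLp {U : Opens (ℝ × ℝ)} (f : L2 U) {g : ℝ × ℝ → ℂ} (hg : MemLp g 2 volume) :
    Integrable (fun x => f x * g x) (volume.restrict (U : Set (ℝ × ℝ))) :=
  (Lp.memLp f).integrable_mul (hg.mono_measure Measure.restrict_le_self)

theorem halfPairing_sub (η ξ : 𝓓((⊤ : Opens (ℝ × ℝ)), ℂ)) (f : L2 halfPlane) :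
    halfPairing (η - ξ) f = halfPairing η f - halfPairing ξ f := by
  rw [halfPairing_apply, halfPairing_apply, halfPairing_apply, ← integral_sub
    (integrable_mul_memLp f (memLp_testFunction 2 η _)) (integrable_mul_memLp f (memLp_testFunction 2 ξ _))]
  congr 1
  ext x
  change _ * (η x - ξ x) = _
  ring

theorem norm_halfPairing_le (η : 𝓓((⊤ : Opens (ℝ × ℝ)), ℂ)) (f : L2 halfPlane) :
    ‖halfPairing η f‖ ≤ ‖f‖ * lpNorm η 2 volume := by
  rw [halfPairing_apply]
  have hη := memLp_testFunction 2 η (volume : Measure (ℝ × ℝ))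
  refine (norm_integral_mul_le (Lp.memLp f) (hη.mono_measure Measure.restrict_le_self)).trans ?_
  rw [Lp.norm_def, toReal_eLpNorm (Lp.aestronglyMeasurable f)]
  refine mul_le_mul_of_nonneg_left ?_ lpNorm_nonneg
  rw [← toReal_eLpNorm hη.1, ← toReal_eLpNorm (hη.1.mono_measure Measure.restrict_le_self)]
  exact ENNReal.toReal_mono hη.2.ne (eLpNorm_mono_measure _ Measure.restrict_le_self)

/-- A test function on `(0, ∞)` with integral one. -/
theorem exists_test_integral_eq_one : ∃ ψ : 𝓓(posRay, ℂ), ∫ x, ψ x = 1 := by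
  let f : ContDiffBump (2 : ℝ) := ⟨1 / 2, 1, by norm_num, by norm_num⟩
  refine ⟨{ toFun := fun x => ((f.normed volume x : ℝ) : ℂ)
            contDiff' := Complex.ofRealCLM.contDiff.comp f.contDiff_normed
            hasCompactSupport' := f.hasCompactSupport_normed.comp_left (g := fun r : ℝ => (r : ℂ)) rfl
            tsupport_subset' := ?_ }, ?_⟩
  · refine (closure_mono (Function.support_comp_subset (g := fun r : ℝ => (r : ℂ)) rfl _)).trans ?_
    change tsupport (f.normed volume) ⊆ _
    rw [f.tsupport_normed_eq]
    intro x hx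
    have := abs_le.1 (mem_closedBall_iff_norm.1 hx)
    change (0 : ℝ) < x
    have h1 : (f.rOut : ℝ) = 1 := rfl
    linarith [this.1]
  · change ∫ x, ((f.normed volume x : ℝ) : ℂ) = 1
    rw [integral_complex_ofReal, f.integral_normed, Complex.ofReal_one]

variable {T : ℝ} {u : ℝ → ℂ} {w₀ : L2 halfPlane} {w : ℝ → L2 halfPlane}

theorem hasDerivAt_dual_apply {X : Type*} [NormedAddCommGroup X] [NormedSpace ℂ X]
    {f : ℝ → StrongDual ℂ X} {f' : StrongDual ℂ X} {t : ℝ} (h : HasDerivAt f f' t) (x : X) :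
    HasDerivAt (fun τ => f τ x) (f' x) t :=
  ((ContinuousLinearMap.apply ℂ ℂ x).restrictScalars ℝ).hasFDerivAt.comp_hasDerivAt t h

/-- Weak form of the heat equation, for functions which vanish on the line to order one. -/
theorem IsHalfPlaneSolution.hasDerivAt_halfPairing (h : IsHalfPlaneSolution T u w₀ w)
    {ξ : 𝓓((⊤ : Opens (ℝ × ℝ)), ℂ)} (h0 : ∀ y, ξ (0, y) = 0) (h1 : ∀ y, testDeriv 1 0 ξ (0, y) = 0)
    {t : ℝ} (ht : t ∈ Ioo 0 T) :
    HasDerivAt (fun τ => halfPairing ξ (w τ))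
      (halfPairing (testDeriv 2 0 ξ) (w t) + halfPairing (testDeriv 0 2 ξ) (w t)) t := by
  have hv : ∀ k (hk : k < 2), VanishesOnLine (toL2 halfPlane
      ((smoothFamily_testDeriv 2 ξ).memLp k 0 (by omega))) := by
    intro k hk
    interval_cases k
    · exact vanishesOnLine_of_test h0
    · exact vanishesOnLine_of_test h1
  have e (a b : ℕ) (hab : a + b ≤ 2) (f : L2 halfPlane) : distDeriv (SobolevZero 2) a b hab f
      ((smoothFamily_testDeriv 2 ξ).zeroElt hv) = (-1) ^ (a + b) * halfPairing (testDeriv a b ξ) f := by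
    rw [distDeriv_apply, halfPairing_apply, ← pairing_apply, SmoothFamily.coord_zeroElt, pairing_toL2]
  have h2 := hasDerivAt_dual_apply (h.heat t ht) ((smoothFamily_testDeriv 2 ξ).zeroElt hv)
  rw [laplacian, add_apply, add_apply, e, e] at h2
  refine (h2.congr_deriv (by norm_num)).congr_of_eventuallyEq (Eventually.of_forall fun τ => ?_)
  dsimp only
  rw [e, add_zero, pow_zero, one_mul]
  rfl

theorem continuousOn_test_mul_clm {F : Type*} [NormedAddCommGroup F] [NormedSpace ℂ F] {v : ℝ → F}
    (hw : ContinuousOn v (Icc 0 T)) (θ : 𝓓(timeInterval T, ℂ)) (L : F →L[ℂ] ℂ) :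
    ContinuousOn (fun r => θ r * L (v r)) (Icc 0 T) :=
  θ.continuous.continuousOn.mul (L.continuous.comp_continuousOn hw)

theorem integrableOn_Ioo_of_continuousOn {F : Type*} [NormedAddCommGroup F] {f : ℝ → F}
    (hf : ContinuousOn f (Icc 0 T)) : IntegrableOn f (Ioo 0 T) :=
  (hf.integrableOn_compact isCompact_Icc).mono_set Ioo_subset_Icc_self

/-- Integration by parts in time: `θ` vanishes at `0` and `T`, and the pairing is continuous on `[0,
T]` with a derivative at every interior time. -/
theorem IsHalfPlaneSolution.integral_halfPairing (h : IsHalfPlaneSolution T u w₀ w) (hT : 0 < T)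
    {ξ : 𝓓((⊤ : Opens (ℝ × ℝ)), ℂ)} (h0 : ∀ y, ξ (0, y) = 0) (h1 : ∀ y, testDeriv 1 0 ξ (0, y) = 0)
    (θ : 𝓓(timeInterval T, ℂ)) :
    ∫ r in Ioo 0 T, (∂_{(1 : ℝ)} θ) r * halfPairing ξ (w r) =
      -∫ r in Ioo 0 T, θ r * (halfPairing (testDeriv 2 0 ξ) (w r) +
        halfPairing (testDeriv 0 2 ξ) (w r)) := by
  set θ' : 𝓓(timeInterval T, ℂ) := ∂_{(1 : ℝ)} θ with hθ'
  have hc (η : 𝓓((⊤ : Opens (ℝ × ℝ)), ℂ)) : ContinuousOn (fun r => halfPairing η (w r)) (Icc 0 T) :=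
    (halfPairing η).continuous.comp_continuousOn h.continuousOn
  have key := intervalIntegral.integral_mul_deriv_eq_deriv_mul_of_hasDeriv_right
    (a := 0) (b := T) (u := θ) (u' := θ') (v := fun r => halfPairing ξ (w r))
    (v' := fun r => halfPairing (testDeriv 2 0 ξ) (w r) + halfPairing (testDeriv 0 2 ξ) (w r))
    θ.continuous.continuousOn (by rw [uIcc_of_le hT.le]; exact hc ξ)
    (fun x _ => (hasDerivAt_testFunction θ x).hasDerivWithinAt)
    (fun x hx => (h.hasDerivAt_halfPairing h0 h1
      (by rwa [min_eq_left hT.le, max_eq_right hT.le] at hx)).hasDerivWithinAt)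
    (θ'.continuous.intervalIntegrable _ _)
    (intervalIntegrable_of_continuousOn hT ((hc _).add (hc _)))
  rw [testFunction_eq_zero θ (x := 0) (fun h => lt_irrefl _ h.1),
    testFunction_eq_zero θ (x := T) (fun h => lt_irrefl _ h.2), zero_mul, zero_mul, sub_zero, zero_sub,
    intervalIntegral.integral_of_le hT.le, intervalIntegral.integral_of_le hT.le,
    integral_Ioc_eq_integral_Ioo, integral_Ioc_eq_integral_Ioo] at key
  rw [key, neg_neg]

/-- The even part `ζ(x₁, x₂) + ζ(-x₁, x₂)`. -/
def evenSum (ζ : 𝓓((⊤ : Opens (ℝ × ℝ)), ℂ)) : 𝓓((⊤ : Opens (ℝ × ℝ)), ℂ) :=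
  ζ + affTest ζ (-1, 1) 0 (by norm_num) (by norm_num)

theorem testDeriv_evenSum (ζ : 𝓓((⊤ : Opens (ℝ × ℝ)), ℂ)) (a b : ℕ) (x : ℝ × ℝ) :
    testDeriv a b (evenSum ζ) x = testDeriv a b ζ x + (-1) ^ a * testDeriv a b ζ (reflect x) := by
  rw [evenSum, testDeriv_add]
  change testDeriv a b ζ x + _ = _
  rw [testDeriv_affTest]
  simp [reflect]

theorem evenSum_apply (ζ : 𝓓((⊤ : Opens (ℝ × ℝ)), ℂ)) (x : ℝ × ℝ) :
    evenSum ζ x = ζ x + ζ (reflect x) := by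
  have := testDeriv_evenSum ζ 0 0 x
  rw [pow_zero, one_mul] at this
  exact this

/-- An even number of derivatives along `x₁` commutes with the reflection, so the pairing unfolds to
the whole plane. -/
theorem halfPairing_evenSum (ζ : 𝓓((⊤ : Opens (ℝ × ℝ)), ℂ)) {a : ℕ} (ha : Even a) (b : ℕ)
    (f : L2 halfPlane) : halfPairing (testDeriv a b (evenSum ζ)) f =
      ∫ x, evenExtension f x * testDeriv a b ζ x := by
  rw [halfPairing_apply, integral_evenExtension_mul f (memLp_testFunction 2 _ _)]
  simp only [testDeriv_evenSum, ha.neg_one_pow, one_mul]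

/-- The norm of the corrector is a multiple of `√α`, with a constant free of time. This removes the
corrector and its second derivative along `x₂` in the limit. -/
theorem tendsto_integral_halfPairing_tensor (hw : ContinuousOn w (Icc 0 T)) (ψ : 𝓓(posRay, ℂ))
    (p : 𝓓((⊤ : Opens ℝ), ℂ)) (θ : 𝓓(timeInterval T, ℂ)) :
    Tendsto (fun α : ℝ => ∫ r in Ioo 0 T,
      θ r * halfPairing (tensorTest (evenPrimitive (dilate α ψ)) p) (w r)) (𝓝[>] 0) (𝓝 0) := by
  set N := lpNorm (fun x : ℝ × ℝ => evenPrimitive ψ x.1 * p x.2) 2 volume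
  have hlim : Tendsto (fun α : ℝ => √α * ∫ r in Ioo 0 T, ‖θ r‖ * (‖w r‖ * N)) (𝓝[>] 0) (𝓝 0) := by
    have : Tendsto (fun α : ℝ => √α * ∫ r in Ioo 0 T, ‖θ r‖ * (‖w r‖ * N)) (𝓝 0)
        (𝓝 (√0 * ∫ r in Ioo 0 T, ‖θ r‖ * (‖w r‖ * N))) :=
      (Real.continuous_sqrt.tendsto 0).mul_const _
    rw [Real.sqrt_zero, zero_mul] at this
    exact this.mono_left nhdsWithin_le_nhds
  refine squeeze_zero_norm' ?_ hlim
  filter_upwards [self_mem_nhdsWithin] with α hα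
  rw [← integral_const_mul]
  refine norm_integral_le_of_norm_le (integrableOn_Ioo_of_continuousOn ?_)
    (Eventually.of_forall fun r => ?_)
  · exact continuousOn_const.mul (θ.continuous.norm.continuousOn.mul (hw.norm.mul continuousOn_const))
  · rw [norm_mul]
    have := norm_halfPairing_le (tensorTest (evenPrimitive (dilate α ψ)) p) (w r)
    have e : lpNorm (tensorTest (evenPrimitive (dilate α ψ)) p) 2 volume = √α * N :=
      lpNorm_tensor_evenPrimitive_dilate hα ψ (memLp_testFunction 2 p _)
    rw [e] at this
    calc ‖θ r‖ * _ ≤ ‖θ r‖ * (‖w r‖ * (√α * N)) := by gcongr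
      _ = _ := by ring

/-- For `x₁ > 0` the second derivative of the even primitive is `-ψ'`; so the one term of the
corrector that survives is the averaged flux, on which the boundary condition bears. -/
theorem flux_ofTest₁ (f : L2 halfPlane) (ψ : 𝓓(posRay, ℂ)) (q : 𝓓((⊤ : Opens ℝ), ℂ)) :
    distDeriv (SobolevZero 1) 1 0 (by norm_num) f (tensor ψ (ofTest₁ 1 q)) =
      halfPairing (testDeriv 2 0 (tensorTest (evenPrimitive ψ) q)) f := by
  have e : (coord₁ (Sobolev₁ ⊤ 1) 0 (ofTest₁ 1 q) : ℝ → ℂ) =ᵐ[volume] q := by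
    rw [coord_ofTest₁]
    exact ae_top_iff.1 (toL2_ae _ _)
  have e2 : ∀ᵐ x : ℝ × ℝ, coord₁ (Sobolev₁ ⊤ 1) 0 (ofTest₁ 1 q) x.2 = q x.2 :=
    Measure.quasiMeasurePreserving_snd.ae e
  rw [flux_eq, halfPairing_apply, testDeriv_tensorTest]
  refine integral_congr_ae (ae_restrict_of_ae ?_)
  filter_upwards [e2] with x hx
  rw [hx]
  rfl

/-- The core of the passage to the plane. The equation is tested with the even sum minus a corrector
of width `α`, and `α → 0`; the boundary flux survives as the point source. -/
theorem IsHalfPlaneSolution.weak_deriv (h : IsHalfPlaneSolution T u w₀ w) (hT : 0 < T)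
    (hu : MemLp u ∞ (volume.restrict (Ioo 0 T))) (ζ : 𝓓((⊤ : Opens (ℝ × ℝ)), ℂ))
    (θ : 𝓓(timeInterval T, ℂ)) :
    ∫ r in Ioo 0 T, halfPairing (evenSum ζ) (w r) * (∂_{(1 : ℝ)} θ) r =
      -∫ r in Ioo 0 T, θ r * (halfPairing (testDeriv 2 0 (evenSum ζ)) (w r) +
        halfPairing (testDeriv 0 2 (evenSum ζ)) (w r) - 2 * u r * ζ 0) := by
  obtain ⟨ψ, hψ⟩ := exists_test_integral_eq_one
  set q : 𝓓((⊤ : Opens ℝ), ℂ) := sliceTest (evenSum ζ) 0 with hq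
  set θ' : 𝓓(timeInterval T, ℂ) := ∂_{(1 : ℝ)} θ with hθ'
  set p : 𝓓((⊤ : Opens ℝ), ℂ) := testDeriv₁ 2 q with hp
  set V : ℝ → ℂ := fun r => halfPairing (testDeriv 2 0 (evenSum ζ)) (w r) +
    halfPairing (testDeriv 0 2 (evenSum ζ)) (w r) with hV
  have hi (ϑ : 𝓓(timeInterval T, ℂ)) (L : L2 halfPlane →L[ℂ] ℂ) :
      IntegrableOn (fun r => ϑ r * L (w r)) (Ioo 0 T) :=
    integrableOn_Ioo_of_continuousOn (continuousOn_test_mul_clm h.continuousOn ϑ L)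
  have hiV : IntegrableOn (fun r => θ r * V r) (Ioo 0 T) := by
    refine ((hi θ (halfPairing (testDeriv 2 0 (evenSum ζ)))).add
      (hi θ (halfPairing (testDeriv 0 2 (evenSum ζ))))).congr (Eventually.of_forall fun r => ?_)
    simp only [hV, Pi.add_apply, mul_add]
  have key : ∀ α : ℝ, 0 < α →
      (∫ r in Ioo 0 T, θ' r * halfPairing (evenSum ζ) (w r)) -
        ∫ r in Ioo 0 T, θ' r * halfPairing (tensorTest (evenPrimitive (dilate α ψ)) q) (w r) =
      -((∫ r in Ioo 0 T, θ r * V r) - (∫ r in Ioo 0 T,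
        θ r * distDeriv (SobolevZero 1) 1 0 (by norm_num) (w r) (tensor (dilate α ψ) (ofTest₁ 1 q))) -
        ∫ r in Ioo 0 T, θ r * halfPairing (tensorTest (evenPrimitive (dilate α ψ)) p) (w r)) := by
    intro α hα
    set g := evenPrimitive (dilate α ψ) with hg
    have hz : dilate α ψ 0 = 0 := testFunction_eq_zero _ fun h => lt_irrefl (0 : ℝ) h
    -- The traces cancel because the even primitive takes the value `∫ ψ = 1` at `0`. Both normal
    -- derivatives vanish on the line since both functions are even in `x₁`.
    have := h.integral_halfPairing hT (ξ := evenSum ζ - tensorTest g q)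
      (fun y => by
        change evenSum ζ (0, y) - g 0 * evenSum ζ (0, y) = 0
        rw [hg, evenPrimitive_zero, integral_dilate hα, hψ, one_mul, sub_self])
      (fun y => by
        rw [testDeriv_sub, testDeriv_tensorTest]
        change testDeriv 1 0 (evenSum ζ) (0, y) - testDeriv₁ 1 g 0 * q y = 0
        rw [hg, evenPrimitive_deriv_one, testDeriv_evenSum]
        simp [reflect, hz]) θ
    simp only [testDeriv_sub, halfPairing_sub] at this
    rw [← hθ'] at this
    have e0 (r : ℝ) : θ r * (halfPairing (testDeriv 2 0 (evenSum ζ)) (w r) -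
        halfPairing (testDeriv 2 0 (tensorTest g q)) (w r) +
        (halfPairing (testDeriv 0 2 (evenSum ζ)) (w r) -
          halfPairing (testDeriv 0 2 (tensorTest g q)) (w r))) =
        θ r * V r - θ r * halfPairing (testDeriv 2 0 (tensorTest g q)) (w r) -
          θ r * halfPairing (testDeriv 0 2 (tensorTest g q)) (w r) := by
      simp only [hV]; ring
    have e1 : testDeriv 0 2 (tensorTest g q) = tensorTest g p := by rw [testDeriv_tensorTest]; rfl
    simp only [e0, mul_sub] at this
    have hi2 : IntegrableOn (fun r => θ r * V r -
      θ r * halfPairing (testDeriv 2 0 (tensorTest g q)) (w r)) (Ioo 0 T) := hiV.sub (hi _ _)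
    rw [integral_sub (hi _ _) (hi _ _), integral_sub hi2 (hi _ _),
      integral_sub hiV (hi _ _), e1] at this
    simp only [flux_ofTest₁]
    exact this
  have l1 := tendsto_integral_halfPairing_tensor h.continuousOn ψ q θ'
  have l2 := tendsto_integral_halfPairing_tensor h.continuousOn ψ p θ
  -- The boundary condition in the sense of distributions in time is what rules out a flux singular
  -- in time.
  have l3 := h.boundary_distrib (ofTest₁ 1 q) ψ θ
  have lim1 := (tendsto_const_nhds
    (x := ∫ r in Ioo 0 T, θ' r * halfPairing (evenSum ζ) (w r))).sub l1
  have lim2 := (((tendsto_const_nhds (x := ∫ r in Ioo 0 T, θ r * V r)).sub l3).sub l2).neg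
  have := tendsto_nhds_unique_of_eventuallyEq lim1 lim2 (by
    filter_upwards [self_mem_nhdsWithin] with α hα using key α hα)
  rw [sub_zero, sub_zero, hψ] at this
  -- The factor `2` of the source: the trace of the even sum at the origin is `2 ζ(0)`.
  have hd (r : ℝ) : (u r • delta₁) (ofTest₁ 1 q) = u r * (2 * ζ 0) := by
    change u r * delta₁ (ofTest₁ 1 q) = _
    rw [delta₁_ofTest₁]
    change u r * evenSum ζ (0, 0) = _
    rw [evenSum_apply, two_mul]
    simp [reflect, ← Prod.zero_eq_mk]
  simp only [hd, mul_one] at this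
  have hui : IntegrableOn (fun r => θ r * (u r * (2 * ζ 0))) (Ioo 0 T) := by
    have := (MemLp.integrable_mul (p := 1) (q := ∞) (θ.continuous.integrable_of_hasCompactSupport
      θ.hasCompactSupport |>.integrableOn (s := Ioo 0 T) |> memLp_one_iff_integrable.2) hu).mul_const (2 * ζ 0)
    refine this.congr (Eventually.of_forall fun r => ?_)
    simp [mul_assoc]
  rw [← integral_sub hiV hui] at this
  simp only [mul_comm _ (θ' _)]
  rw [this]
  congr 2
  ext r
  simp only [hV]
  ring

/-- The even extension of a solution on the half-plane is a solution on the plane. -/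
theorem IsHalfPlaneSolution.isPlaneSolution (h : IsHalfPlaneSolution T u w₀ w) (hT : 0 < T)
    (hu : MemLp u ∞ (volume.restrict (Ioo 0 T))) :
    IsPlaneSolution T u (evenExtension w₀) (fun t => evenExtension (w t)) := by
  have hc : ContinuousOn (fun t => evenExtension (w t)) (Icc 0 T) :=
    continuousOn_of_norm_sub_le h.continuousOn norm_evenExtension_sub_le
  refine isPlaneSolution_of_sub_eq hT hu (fun t _ => isEven_evenExtension _) hc (by rw [h.initial])
    fun t ht => ?_
  -- The integrated equation, written with sums and multiples so that the closure properties of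
  -- `Mollifies` apply; it then suffices to verify it on test functions.
  have hmol : Mollifies (distDeriv (Sobolev ⊤ 2) 0 0 (by norm_num) (evenExtension (w t)) +
      (-1 : ℂ) • distDeriv (Sobolev ⊤ 2) 0 0 (by norm_num) (evenExtension (w 0)) +
      (-1 : ℂ) • (laplacian (Sobolev ⊤ 2) (∫ r in (0 : ℝ)..t, evenExtension (w r)) +
        (-(2 * ∫ r in (0 : ℝ)..t, u r)) • delta)) :=
    ((mollifies_distDeriv _ _ _ _).add ((mollifies_distDeriv _ _ _ _).smul _)).add
      (((mollifies_laplacian _).add (mollifies_delta.smul _)).smul _)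
  have hV (a b : ℕ) (ha : Even a) (hab : a + b ≤ 2) (hb : Even b) (ζ : 𝓓((⊤ : Opens (ℝ × ℝ)), ℂ))
      (f : L2 halfPlane) : distDeriv (Sobolev ⊤ 2) a b hab (evenExtension f) (ofTest ζ) =
        halfPairing (testDeriv a b (evenSum ζ)) f := by
    rw [distDeriv_apply, ← pairing_apply, coord_ofTest, pairing_toL2, halfPairing_evenSum ζ ha,
      integral_top, (ha.add hb).neg_one_pow, one_mul]
  have hz := hmol.eq_zero fun ζ => by
    have hui : IntegrableOn u (Ioo 0 T) := by
      have := intervalIntegrable_control hT hu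
      rwa [intervalIntegrable_iff_integrableOn_Ioo_of_le hT.le] at this
    have hW : IntervalIntegrable (fun r => evenExtension (w r)) volume 0 t :=
      intervalIntegrable_sub (intervalIntegrable_of_continuousOn hT hc) left_mem_uIcc
        (by rwa [uIcc_of_le hT.le])
    have hut : IntervalIntegrable u volume 0 t :=
      intervalIntegrable_sub (intervalIntegrable_control hT hu) left_mem_uIcc
        (by rwa [uIcc_of_le hT.le])
    have hcη (η : 𝓓((⊤ : Opens (ℝ × ℝ)), ℂ)) : ContinuousOn (fun r => halfPairing η (w r)) (Icc 0 T) :=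
      (halfPairing η).continuous.comp_continuousOn h.continuousOn
    have key := sub_eq_integral_of_weak_deriv hT (hcη (evenSum ζ))
      (((integrableOn_Ioo_of_continuousOn (hcη (testDeriv 2 0 (evenSum ζ)))).add
        (integrableOn_Ioo_of_continuousOn (hcη (testDeriv 0 2 (evenSum ζ))))).sub
        ((hui.const_mul 2).mul_const (ζ 0))) (h.weak_deriv hT hu ζ) ht
    have hL : laplacian (Sobolev ⊤ 2) (∫ r in (0 : ℝ)..t, evenExtension (w r)) (ofTest ζ) =
        ∫ r in (0 : ℝ)..t, (halfPairing (testDeriv 2 0 (evenSum ζ)) (w r) +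
          halfPairing (testDeriv 0 2 (evenSum ζ)) (w r)) := by
      have := ((laplacian (Sobolev ⊤ 2)).flip (ofTest ζ)).intervalIntegral_comp_comm hW
      rw [ContinuousLinearMap.flip_apply] at this
      rw [← this]
      refine intervalIntegral.integral_congr fun r _ => ?_
      rw [ContinuousLinearMap.flip_apply, laplacian, add_apply, add_apply, hV 2 0 even_two _ .zero,
        hV 0 2 .zero _ even_two]
    have h00 (r : ℝ) : distDeriv (Sobolev ⊤ 2) 0 0 (by norm_num) (evenExtension (w r)) (ofTest ζ) =
        halfPairing (evenSum ζ) (w r) := hV 0 0 .zero _ .zero ζ (w r)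
    have hcsub : IntervalIntegrable (fun r => halfPairing (testDeriv 2 0 (evenSum ζ)) (w r) +
          halfPairing (testDeriv 0 2 (evenSum ζ)) (w r)) volume 0 t :=
      intervalIntegrable_sub (intervalIntegrable_of_continuousOn hT ((hcη _).add (hcη _)))
        left_mem_uIcc (by rwa [uIcc_of_le hT.le])
    have key2 : (∫ r in (0 : ℝ)..t, (halfPairing (testDeriv 2 0 (evenSum ζ)) (w r) +
          halfPairing (testDeriv 0 2 (evenSum ζ)) (w r) - 2 * u r * ζ 0)) =
        (∫ r in (0 : ℝ)..t, (halfPairing (testDeriv 2 0 (evenSum ζ)) (w r) +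
          halfPairing (testDeriv 0 2 (evenSum ζ)) (w r))) - 2 * (∫ r in (0 : ℝ)..t, u r) * ζ 0 := by
      rw [intervalIntegral.integral_sub hcsub ((hut.const_mul 2).mul_const _),
        intervalIntegral.integral_mul_const, intervalIntegral.integral_const_mul]
    have key3 := key.trans key2
    change distDeriv (Sobolev ⊤ 2) 0 0 (by norm_num) (evenExtension (w t)) (ofTest ζ) +
      (-1 : ℂ) * distDeriv (Sobolev ⊤ 2) 0 0 (by norm_num) (evenExtension (w 0)) (ofTest ζ) +
      (-1 : ℂ) * (laplacian (Sobolev ⊤ 2) (∫ r in (0 : ℝ)..t, evenExtension (w r)) (ofTest ζ) +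
        (-(2 * ∫ r in (0 : ℝ)..t, u r)) * delta (ofTest ζ)) = 0
    rw [hL, h00, h00, delta_ofTest]
    linear_combination key3
  have hz2 : distDeriv (Sobolev ⊤ 2) 0 0 (by norm_num) (evenExtension (w t)) -
      distDeriv (Sobolev ⊤ 2) 0 0 (by norm_num) (evenExtension (w 0)) -
      planePrimitive u (fun r => evenExtension (w r)) t = 0 := by
    rw [← hz]
    ext Φ
    change distDeriv (Sobolev ⊤ 2) 0 0 (by norm_num) (evenExtension (w t)) Φ -
      distDeriv (Sobolev ⊤ 2) 0 0 (by norm_num) (evenExtension (w 0)) Φ -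
      (laplacian (Sobolev ⊤ 2) (∫ r in (0 : ℝ)..t, evenExtension (w r)) Φ -
        (2 * ∫ r in (0 : ℝ)..t, u r) * delta Φ) =
      distDeriv (Sobolev ⊤ 2) 0 0 (by norm_num) (evenExtension (w t)) Φ +
      (-1 : ℂ) * distDeriv (Sobolev ⊤ 2) 0 0 (by norm_num) (evenExtension (w 0)) Φ +
      (-1 : ℂ) * (laplacian (Sobolev ⊤ 2) (∫ r in (0 : ℝ)..t, evenExtension (w r)) Φ +
        (-(2 * ∫ r in (0 : ℝ)..t, u r)) * delta Φ)
    ring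
  exact sub_eq_zero.1 hz2

end HalfPlaneToPlane

/-! ### Extension by zero and the equation on the half-plane -/

section ZeroExtension

theorem measurableSet_strip (ε : ℝ) : MeasurableSet {x : ℝ × ℝ | 0 < x.1 ∧ x.1 < ε} :=
  (measurableSet_lt measurable_const measurable_fst).inter
    (measurableSet_lt measurable_fst measurable_const)

/-- The support is bounded in the direction `x₂`, so it meets the strip in a set of area `O(ε)`. -/
theorem exists_integral_strip_le (ζ : 𝓓((⊤ : Opens (ℝ × ℝ)), ℂ)) : ∃ C, 0 ≤ C ∧ ∀ ε : ℝ, 0 < ε →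
    ∫ x in {x : ℝ × ℝ | 0 < x.1 ∧ x.1 < ε}, ‖ζ x‖ ^ 2 ≤ C * ε := by
  obtain ⟨M, hM⟩ := ζ.continuous.bounded_above_of_compact_support ζ.hasCompactSupport
  obtain ⟨R, hR⟩ := ζ.hasCompactSupport.isCompact.isBounded.subset_closedBall (0 : ℝ × ℝ)
  refine ⟨M ^ 2 * (2 * max R 0), by positivity, fun ε hε => ?_⟩
  set B : Set (ℝ × ℝ) := Ioo 0 ε ×ˢ Icc (-max R 0) (max R 0) with hB
  have hBm : MeasurableSet B := measurableSet_Ioo.prod measurableSet_Icc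
  have hBv : volume B = ENNReal.ofReal ε * ENNReal.ofReal (2 * max R 0) := by
    rw [hB, Measure.volume_eq_prod, Measure.prod_prod, Real.volume_Ioo, Real.volume_Icc]
    congr 2 <;> ring
  have hi : Integrable (B.indicator fun _ => M ^ 2) (volume : Measure (ℝ × ℝ)) :=
    (integrable_indicator_iff hBm).2 (integrableOn_const (by
      rw [hBv]; exact ENNReal.mul_ne_top ENNReal.ofReal_ne_top ENNReal.ofReal_ne_top))
  calc ∫ x in {x : ℝ × ℝ | 0 < x.1 ∧ x.1 < ε}, ‖ζ x‖ ^ 2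
      ≤ ∫ x in {x : ℝ × ℝ | 0 < x.1 ∧ x.1 < ε}, B.indicator (fun _ => M ^ 2) x := by
        refine setIntegral_mono_on ?_ hi.integrableOn (measurableSet_strip ε) fun x hx => ?_
        · exact ((memLp_testFunction 2 ζ volume).norm.integrable_sq).integrableOn
        · by_cases h : x ∈ B
          · rw [indicator_of_mem h]
            exact pow_le_pow_left₀ (norm_nonneg _) (hM x) 2
          · have : x ∉ tsupport ζ := fun hx' => h ⟨hx, by
              have h1 := mem_closedBall_zero_iff.1 (hR hx')
              have h2 : |x.2| ≤ R := (norm_snd_le x).trans h1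
              exact abs_le.1 (h2.trans (le_max_left _ _))⟩
            rw [indicator_of_notMem h, image_eq_zero_of_notMem_tsupport this]; simp
    _ ≤ ∫ x, B.indicator (fun _ => M ^ 2) x := setIntegral_le_integral hi
        (Eventually.of_forall fun x => indicator_nonneg (fun _ _ => by positivity) x)
    _ = M ^ 2 * (2 * max R 0) * ε := by
        rw [integral_indicator hBm, setIntegral_const, smul_eq_mul, measureReal_def, hBv,
          ENNReal.toReal_mul, ENNReal.toReal_ofReal hε.le, ENNReal.toReal_ofReal (by positivity)]
        ring

/-- A smooth cutoff of a test function, supported in `x₁ ≥ ε`. -/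
def cutTest {ε : ℝ} (hε : 0 < ε) (ζ : 𝓓((⊤ : Opens (ℝ × ℝ)), ℂ)) : 𝓓(halfPlane, ℂ) where
  toFun x := (Real.smoothTransition (ε⁻¹ * x.1 - 1) : ℂ) * ζ x
  contDiff' := (Complex.ofRealCLM.contDiff.comp (Real.smoothTransition.contDiff.comp
    (by fun_prop : ContDiff ℝ _ fun x : ℝ × ℝ => ε⁻¹ * x.1 - 1))).mul (contDiff_testFunction ζ)
  hasCompactSupport' := ζ.hasCompactSupport.mul_left
  tsupport_subset' := by
    have hcl : IsClosed {x : ℝ × ℝ | ε ≤ x.1} := isClosed_le continuous_const continuous_fst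
    refine (closure_minimal (fun x hx => ?_) hcl).trans fun x (hx : ε ≤ x.1) => hε.trans_le hx
    by_contra h
    refine hx ?_
    have h1 : ε⁻¹ * x.1 ≤ 1 := by
      rw [inv_mul_le_iff₀ hε, mul_one]
      exact (not_le.1 h).le
    change (Real.smoothTransition (ε⁻¹ * x.1 - 1) : ℂ) * ζ x = 0
    rw [Real.smoothTransition.zero_of_nonpos (by linarith), Complex.ofReal_zero, zero_mul]

theorem cutTest_apply {ε : ℝ} (hε : 0 < ε) (ζ : 𝓓((⊤ : Opens (ℝ × ℝ)), ℂ)) (x : ℝ × ℝ) :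
    cutTest hε ζ x = (Real.smoothTransition (ε⁻¹ * x.1 - 1) : ℂ) * ζ x := rfl

theorem testDeriv_zero_cutTest {ε : ℝ} (hε : 0 < ε) (b : ℕ) (ζ : 𝓓((⊤ : Opens (ℝ × ℝ)), ℂ)) :
    testDeriv 0 b (cutTest hε ζ) = cutTest hε (testDeriv 0 b ζ) := by
  induction b with
  | zero => rfl
  | succ b ih =>
    rw [testDeriv_zero_succ, testDeriv_zero_succ, ih]
    ext x
    refine (hasDerivAt_slice_snd (cutTest hε (testDeriv 0 b ζ)) x.1 x.2).unique ?_
    exact (hasDerivAt_slice_snd (testDeriv 0 b ζ) x.1 x.2).const_mul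
      (Real.smoothTransition (ε⁻¹ * x.1 - 1) : ℂ)

theorem fst_deriv_cutTest {ε : ℝ} (hε : 0 < ε) (ζ : 𝓓((⊤ : Opens (ℝ × ℝ)), ℂ)) (x : ℝ × ℝ) :
    testDeriv 1 0 (cutTest hε ζ) x = cutTest hε (testDeriv 1 0 ζ) x +
      (ε : ℂ)⁻¹ * (transitionDeriv (ε⁻¹ * x.1 - 1) * ζ x) := by
  refine (hasDerivAt_slice_fst (cutTest hε ζ) x.1 x.2).unique ?_
  have h1 : HasDerivAt (fun r : ℝ => ε⁻¹ * r - 1) ε⁻¹ x.1 := by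
    simpa using ((hasDerivAt_id x.1).const_mul ε⁻¹).sub_const 1
  have h2 := (hasDerivAt_smoothTransition (ε⁻¹ * x.1 - 1)).scomp x.1 h1
  rw [Complex.real_smul, Complex.ofReal_inv] at h2
  refine (h2.mul (hasDerivAt_slice_fst ζ x.1 x.2)).congr_deriv ?_
  rw [cutTest_apply]
  simp only [Function.comp_apply]
  change _ + _ * testDeriv 1 0 ζ x = _
  ring

theorem tendsto_integral_cutTest (f : L2 halfPlane) (ζ : 𝓓((⊤ : Opens (ℝ × ℝ)), ℂ)) {ε : ℕ → ℝ}
    (hε : ∀ n, 0 < ε n) (hlim : Tendsto ε atTop (𝓝 0)) :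
    Tendsto (fun n => ∫ x in (halfPlane : Set (ℝ × ℝ)), f x * cutTest (hε n) ζ x) atTop
      (𝓝 (∫ x in (halfPlane : Set (ℝ × ℝ)), f x * ζ x)) := by
  refine tendsto_integral_of_dominated_convergence (fun x => ‖f x * ζ x‖)
    (fun n => (integrable_mul_memLp f (memLp_testFunction 2 (cutTest (hε n) ζ) _)).1)
    (integrable_mul_memLp f (memLp_testFunction 2 ζ _)).norm (fun n => Eventually.of_forall fun x => ?_) ?_
  · rw [cutTest_apply, norm_mul, norm_mul, norm_mul, Complex.norm_real, Real.norm_eq_abs,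
      abs_of_nonneg (Real.smoothTransition.nonneg _)]
    refine mul_le_mul_of_nonneg_left ?_ (norm_nonneg _)
    exact mul_le_of_le_one_left (norm_nonneg _) (Real.smoothTransition.le_one _)
  · filter_upwards [ae_restrict_mem measurableSet_halfPlane] with x hx
    have hx' : 0 < x.1 := hx
    refine tendsto_const_nhds.congr' ?_
    filter_upwards [hlim.eventually_lt_const (show 0 < x.1 / 2 by positivity)] with n hn
    have h1 : 2 ≤ (ε n)⁻¹ * x.1 := by
      rw [le_inv_mul_iff₀ (hε n)]; linarith
    rw [cutTest_apply, Real.smoothTransition.one_of_one_le (by linarith), Complex.ofReal_one, one_mul]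

/-- This is the error from differentiating the cutoff. By Cauchy–Schwarz its square is at most the
integral of `‖f‖²` over the strip, which is `o(ε)` by the trace condition, times that of the squared
cutoff term, which is `O(ε⁻¹)`. -/
theorem tendsto_integral_strip_remainder {f : L2 halfPlane} (hf : VanishesOnLine f)
    (ζ : 𝓓((⊤ : Opens (ℝ × ℝ)), ℂ)) {ε : ℕ → ℝ} (hε : ∀ n, 0 < ε n) (hlim : Tendsto ε atTop (𝓝 0)) :
    Tendsto (fun n => ∫ x in (halfPlane : Set (ℝ × ℝ)),
      f x * ((ε n : ℂ)⁻¹ * (transitionDeriv ((ε n)⁻¹ * x.1 - 1) * ζ x))) atTop (𝓝 0) := by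
  obtain ⟨C, hC0, hC⟩ := exists_integral_strip_le ζ
  obtain ⟨M, hM⟩ : ∃ M, ∀ x, ‖transitionDeriv x‖ ≤ M := by
    obtain ⟨M, hM⟩ := isCompact_Icc.exists_bound_of_continuousOn (s := Icc (0 : ℝ) 1)
      continuous_deriv_smoothTransition.continuousOn
    refine ⟨max M 0, fun x => ?_⟩
    rw [transitionDeriv, Complex.norm_real]
    by_cases hx : x ∈ Icc (0 : ℝ) 1
    · exact (hM x hx).trans (le_max_left _ _)
    · rw [smoothTransition_deriv_zero hx, norm_zero]; exact le_max_right _ _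
  -- The derivative of the cutoff lives on `ε ≤ x₁ ≤ 2 ε`, which the open strip of width `3 ε`
  -- contains.
  have h3 : Tendsto (fun n => 3 * ε n) atTop (𝓝[>] 0) := by
    rw [tendsto_nhdsWithin_iff]
    refine ⟨by simpa using hlim.const_mul 3, Eventually.of_forall fun n => ?_⟩
    have := hε n
    exact mem_Ioi.2 (by positivity)
  have hv := ((hf.comp h3).const_mul (9 * M ^ 2 * C)).sqrt
  rw [mul_zero, Real.sqrt_zero] at hv
  refine squeeze_zero_norm (fun n => ?_) hv
  have hn := hε n
  set S := {x : ℝ × ℝ | 0 < x.1 ∧ x.1 < 3 * ε n} with hS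
  set g : ℝ × ℝ → ℂ := fun x => (ε n : ℂ)⁻¹ * (transitionDeriv ((ε n)⁻¹ * x.1 - 1) * ζ x) with hg
  have hgc : MemLp g 2 volume := by
    refine Continuous.memLp_of_hasCompactSupport ?_ (ζ.hasCompactSupport.mul_left.mul_left)
    refine continuous_const.mul (Continuous.mul ?_ ζ.continuous)
    exact Complex.continuous_ofReal.comp (continuous_deriv_smoothTransition.comp (by fun_prop))
  have e1 : ∫ x in (halfPlane : Set (ℝ × ℝ)), f x * g x = ∫ x in S, f x * g x := by
    refine (setIntegral_eq_of_subset_of_forall_sdiff_eq_zero measurableSet_halfPlane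
      (fun x hx => hx.1) fun x hx => ?_)
    have hx1 : 3 * ε n ≤ x.1 := not_lt.1 fun h => hx.2 ⟨hx.1, h⟩
    have hx2 : 3 ≤ (ε n)⁻¹ * x.1 := by rw [le_inv_mul_iff₀ hn]; linarith
    have : transitionDeriv ((ε n)⁻¹ * x.1 - 1) = 0 := by
      rw [transitionDeriv, smoothTransition_deriv_zero (fun h => by linarith [h.2]), Complex.ofReal_zero]
    simp [hg, this]
  have hfS : MemLp f 2 (volume.restrict S) := (Lp.memLp f).mono_measure (restrict_strip_le _)
  have hgS : MemLp g 2 (volume.restrict S) := hgc.mono_measure Measure.restrict_le_self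
  rw [e1]
  refine (norm_integral_mul_le hfS hgS).trans (Real.le_sqrt_of_sq_le ?_)
  rw [mul_pow, lpNorm_two_sq hfS, lpNorm_two_sq hgS]
  have h4 : ∫ x in S, ‖g x‖ ^ 2 ≤ ∫ x in S, ((ε n)⁻¹ ^ 2 * M ^ 2) * ‖ζ x‖ ^ 2 := by
    refine integral_mono hgS.norm.integrable_sq
      (((memLp_testFunction 2 ζ volume).norm.integrable_sq).integrableOn.const_mul _) fun x => ?_
    simp only [hg, norm_mul, mul_pow, norm_inv, Complex.norm_real, Real.norm_eq_abs, abs_of_pos hn]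
    rw [← mul_assoc]
    gcongr
    exact hM _
  rw [integral_const_mul] at h4
  have h5 := h4.trans (mul_le_mul_of_nonneg_left (hC (3 * ε n) (by positivity)) (by positivity))
  calc (∫ x in S, ‖f x‖ ^ 2) * ∫ x in S, ‖g x‖ ^ 2
      ≤ (∫ x in S, ‖f x‖ ^ 2) * ((ε n)⁻¹ ^ 2 * M ^ 2 * (C * (3 * ε n))) :=
        mul_le_mul_of_nonneg_left h5 (integral_nonneg fun _ => by positivity)
    _ = 9 * M ^ 2 * C * ((3 * ε n)⁻¹ * ∫ x in S, ‖f x‖ ^ 2) := by field_simp; ring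

theorem tendsto_inv_nat_succ : Tendsto (fun n : ℕ => ((n : ℝ) + 1)⁻¹) atTop (𝓝 0) := by
  simpa [one_div] using tendsto_one_div_add_atTop_nhds_zero_nat (𝕜 := ℝ)

/-- A weak derivative along `x₁` extends by zero across the line on which the function vanishes. -/
theorem VanishesOnLine.integral_mul_testDeriv {f g : L2 halfPlane} (hf : VanishesOnLine f)
    (hw : IsWeakDeriv 1 0 f g) (ζ : 𝓓((⊤ : Opens (ℝ × ℝ)), ℂ)) :
    ∫ x in (halfPlane : Set (ℝ × ℝ)), f x * testDeriv 1 0 ζ x =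
      -∫ x in (halfPlane : Set (ℝ × ℝ)), g x * ζ x := by
  have hε : ∀ n : ℕ, 0 < ((n : ℝ) + 1)⁻¹ := fun n => by positivity
  have l1 := (tendsto_integral_cutTest f (testDeriv 1 0 ζ) hε tendsto_inv_nat_succ).add
    (tendsto_integral_strip_remainder hf ζ hε tendsto_inv_nat_succ)
  have l2 := (tendsto_integral_cutTest g ζ hε tendsto_inv_nat_succ).neg
  rw [add_zero] at l1
  refine tendsto_nhds_unique l1 (l2.congr fun n => ?_)
  have h := hw (cutTest (hε n) ζ)
  -- The derivative of the cut test function is the cut derivative plus the strip remainder, which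
  -- tends to zero because `f` vanishes on the line.
  simp only [fst_deriv_cutTest, mul_add, add_zero, pow_one, neg_mul, one_mul] at h
  rw [← h]
  have hi : Integrable (fun x : ℝ × ℝ => f x * ((((n : ℝ) + 1)⁻¹ : ℝ) : ℂ)⁻¹ *
      (transitionDeriv ((((n : ℝ) + 1)⁻¹)⁻¹ * x.1 - 1) * ζ x)) (volume.restrict halfPlane) := by
    have h1 := (integrable_mul_memLp f (memLp_testFunction 2 (testDeriv 1 0 (cutTest (hε n) ζ)) _)).sub
      (integrable_mul_memLp f (memLp_testFunction 2 (cutTest (hε n) (testDeriv 1 0 ζ)) _))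
    refine h1.congr (Eventually.of_forall fun x => ?_)
    simp only [Pi.sub_apply, fst_deriv_cutTest]
    ring
  simp only [mul_assoc] at hi
  exact integral_add (integrable_mul_memLp f (memLp_testFunction 2 (cutTest (hε n) (testDeriv 1 0 ζ)) _)) hi

/-- A weak derivative along `x₂` extends by zero. -/
theorem IsWeakDeriv.integral_mul_testDeriv {f g : L2 halfPlane} {b : ℕ} (hw : IsWeakDeriv 0 b f g)
    (ζ : 𝓓((⊤ : Opens (ℝ × ℝ)), ℂ)) :
    ∫ x in (halfPlane : Set (ℝ × ℝ)), f x * testDeriv 0 b ζ x =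
      (-1) ^ b * ∫ x in (halfPlane : Set (ℝ × ℝ)), g x * ζ x := by
  have hε : ∀ n : ℕ, 0 < ((n : ℝ) + 1)⁻¹ := fun n => by positivity
  have l1 := tendsto_integral_cutTest f (testDeriv 0 b ζ) hε tendsto_inv_nat_succ
  have l2 := (tendsto_integral_cutTest g ζ hε tendsto_inv_nat_succ).const_mul ((-1) ^ b)
  refine tendsto_nhds_unique l1 (l2.congr fun n => ?_)
  have h := hw (cutTest (hε n) ζ)
  rw [testDeriv_zero_cutTest, zero_add] at h
  exact h.symm

theorem memLp_zeroExtension (f : L2 halfPlane) :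
    MemLp ((halfPlane : Set (ℝ × ℝ)).indicator f) 2 volume :=
  (memLp_indicator_iff_restrict measurableSet_halfPlane).2 (Lp.memLp f)

/-- The extension by zero. -/
def zeroExtension (f : L2 halfPlane) : L2 (⊤ : Opens (ℝ × ℝ)) := toL2 ⊤ (memLp_zeroExtension f)

theorem integral_mul_zeroExtension (f : L2 halfPlane) (g : ℝ × ℝ → ℂ) :
    ∫ x in ((⊤ : Opens (ℝ × ℝ)) : Set (ℝ × ℝ)), zeroExtension f x * g x =
      ∫ x in (halfPlane : Set (ℝ × ℝ)), f x * g x := by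
  rw [integral_top, ← integral_indicator measurableSet_halfPlane]
  refine integral_congr_ae ?_
  filter_upwards [ae_top_iff.1 (toL2_ae ⊤ (memLp_zeroExtension f))] with x hx
  rw [zeroExtension, hx]
  exact (indicator_mul_left _ _ _).symm

variable (Φ : Space (SobolevZero 2))

theorem isWeakDeriv_coord {U : Opens (ℝ × ℝ)} {s : ℕ} {F : PiLp 2 fun _ : MultiIndex s => L2 U}
    (hF : F ∈ Sobolev U s) {a b : ℕ} (h : a + b ≤ s) (h0 : a + 0 ≤ s) :
    IsWeakDeriv 0 b (F (multiIndex a 0 h0)) (F (multiIndex a b h)) := by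
  intro η
  have h1 := hF (multiIndex a b h) η
  have h2 := hF (multiIndex a 0 h0) (testDeriv 0 b η)
  have e : testDeriv a 0 (testDeriv 0 b η) = testDeriv a b η := rfl
  simp only [multiIndex] at h1 h2 ⊢
  rw [e, h1, add_zero, pow_add, mul_assoc] at h2
  rw [zero_add]
  exact (mul_left_cancel₀ (pow_ne_zero a (by norm_num)) h2).symm

theorem isWeakDeriv_coord_succ {U : Opens (ℝ × ℝ)} {s : ℕ} {F : PiLp 2 fun _ : MultiIndex s => L2 U}
    (hF : F ∈ Sobolev U s) {a : ℕ} (h : a + 1 + 0 ≤ s) (h0 : a + 0 ≤ s) :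
    IsWeakDeriv 1 0 (F (multiIndex a 0 h0)) (F (multiIndex (a + 1) 0 h)) := by
  intro η
  have h1 := hF (multiIndex (a + 1) 0 h) η
  have h2 := hF (multiIndex a 0 h0) (testDeriv 1 0 η)
  have e : testDeriv a 0 (testDeriv 1 0 η) = testDeriv (a + 1) 0 η := by
    simp only [testDeriv, Function.iterate_succ, Function.comp_apply, Function.iterate_zero, id_eq]
  simp only [multiIndex] at h1 h2 ⊢
  rw [e, h1, add_zero, add_zero, pow_succ, mul_assoc] at h2
  rw [add_zero, pow_one]
  exact (mul_left_cancel₀ (pow_ne_zero a (by norm_num)) h2).symm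

/-- The derivatives along `x₁` cross the line one at a time, each step using the trace condition on
the function being differentiated; orders `0` to `s - 1` are exactly those needed. Derivatives along
`x₂` are tangential and need no condition. -/
theorem SobolevZero.integral_mul_testDeriv {s : ℕ} {F : PiLp 2 fun _ : MultiIndex s => L2 halfPlane}
    (hF : F ∈ SobolevZero s) {a b : ℕ} (h : a + b ≤ s) (ζ : 𝓓((⊤ : Opens (ℝ × ℝ)), ℂ)) :
    ∫ x in (halfPlane : Set (ℝ × ℝ)), F (multiIndex 0 0 (Nat.zero_le s)) x * testDeriv a b ζ x =
      (-1) ^ (a + b) * ∫ x in (halfPlane : Set (ℝ × ℝ)), F (multiIndex a b h) x * ζ x := by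
  have h1 : ∀ (a : ℕ) (ha : a + 0 ≤ s) (ζ : 𝓓((⊤ : Opens (ℝ × ℝ)), ℂ)),
      ∫ x in (halfPlane : Set (ℝ × ℝ)), F (multiIndex 0 0 (Nat.zero_le s)) x * testDeriv a 0 ζ x =
      (-1) ^ a * ∫ x in (halfPlane : Set (ℝ × ℝ)), F (multiIndex a 0 ha) x * ζ x := by
    intro a
    induction a with
    | zero => intro _ ζ; rw [pow_zero, one_mul]; rfl
    | succ a ih =>
      intro ha ζ
      have e : testDeriv a 0 (testDeriv 1 0 ζ) = testDeriv (a + 1) 0 ζ := by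
        simp only [testDeriv, Function.iterate_succ, Function.comp_apply, Function.iterate_zero, id_eq]
      rw [← e, ih (by omega), (hF.2 a (by omega)).integral_mul_testDeriv
        (isWeakDeriv_coord_succ hF.1 ha (by omega))]
      ring
  have h2 := h1 a (by omega) (testDeriv 0 b ζ)
  have h3 := (isWeakDeriv_coord hF.1 h (by omega)).integral_mul_testDeriv ζ
  rw [h3, ← mul_assoc, ← pow_add] at h2
  exact h2

/-- Functions in `H₀^s` of the half-plane, extended by zero. -/
def zeroExtend {s : ℕ} (Φ : Space (SobolevZero s)) : Space (Sobolev (⊤ : Opens (ℝ × ℝ)) s) :=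
  ⟨WithLp.toLp 2 fun α => zeroExtension (Space.incl _ Φ α), fun α ζ => by
    change ∫ x in ((⊤ : Opens (ℝ × ℝ)) : Set (ℝ × ℝ)), zeroExtension _ x * _ =
      _ * ∫ x in ((⊤ : Opens (ℝ × ℝ)) : Set (ℝ × ℝ)), zeroExtension _ x * _
    rw [integral_mul_zeroExtension, integral_mul_zeroExtension]
    exact SobolevZero.integral_mul_testDeriv Φ.2 α.2 ζ⟩

theorem coord_zeroExtend {s : ℕ} (Φ : Space (SobolevZero s)) (a b : ℕ) (h : a + b ≤ s) :
    coord (Sobolev ⊤ s) a b h (zeroExtend Φ) = zeroExtension (coord (SobolevZero s) a b h Φ) := rfl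

theorem distDeriv_zeroExtend {s : ℕ} (f : L2 (⊤ : Opens (ℝ × ℝ))) (Φ : Space (SobolevZero s))
    (a b : ℕ) (h : a + b ≤ s) : distDeriv (Sobolev ⊤ s) a b h f (zeroExtend Φ) =
      distDeriv (SobolevZero s) a b h (restriction f) Φ := by
  rw [distDeriv_apply, distDeriv_apply, coord_zeroExtend, integral_restriction_mul]
  simp only [mul_comm (f _)]
  rw [integral_mul_zeroExtension]

/-- The function representing `delta` is supported in the quadrant `x₁, x₂ ≤ 0`, where the zero
extension and its derivatives vanish almost everywhere. -/
theorem delta_zeroExtend (Φ : Space (SobolevZero 2)) : delta (zeroExtend Φ) = 0 := by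
  have hm := (memLp_tensor memLp_expRay memLp_expRay).mono_measure
      (Measure.restrict_le_self (s := ((⊤ : Opens (ℝ × ℝ)) : Set (ℝ × ℝ))))
  have key (f : L2 halfPlane) : pairing ⊤ (hm.toLp fun x : ℝ × ℝ => expRay x.1 * expRay x.2)
      (zeroExtension f) = 0 := by
    rw [pairing_apply]
    simp only [mul_comm _ (zeroExtension f _)]
    rw [integral_mul_zeroExtension]
    refine integral_eq_zero_of_ae ?_
    filter_upwards [ae_restrict_of_ae (ae_top_iff.1 (MemLp.coeFn_toLp hm)),
      ae_restrict_mem measurableSet_halfPlane] with x hx h0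
    have : x.1 ∉ Iic (0 : ℝ) := fun h => not_le.2 (show 0 < x.1 from h0) h
    rw [hx, expRay, indicator_of_notMem this]
    simp
  have e : delta (zeroExtend Φ) = pairing ⊤ (hm.toLp fun x : ℝ × ℝ => expRay x.1 * expRay x.2)
      (zeroExtension (coord (SobolevZero 2) 0 0 (by norm_num) Φ) +
        zeroExtension (coord (SobolevZero 2) 1 0 (by norm_num) Φ) +
        zeroExtension (coord (SobolevZero 2) 0 1 (by norm_num) Φ) +
        zeroExtension (coord (SobolevZero 2) 1 1 (by norm_num) Φ)) := rfl
  rw [e, map_add, map_add, map_add, key, key, key, key]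
  simp

variable {T : ℝ} {u : ℝ → ℂ} {W₀ : L2 (⊤ : Opens (ℝ × ℝ))} {W : ℝ → L2 (⊤ : Opens (ℝ × ℝ))}

theorem IsPlaneSolution.continuousOn_restriction (h : IsPlaneSolution T u W₀ W) :
    ContinuousOn (fun t => restriction (W t)) (Icc 0 T) :=
  continuousOn_of_norm_sub_le (C := 1) h.continuousOn fun a b => by
    rw [one_mul]; exact norm_restriction_sub_le a b

/-- The integrated equation on the plane is evaluated at zero extensions; the source disappears, and
the pairings reduce to the half-plane. -/
theorem IsPlaneSolution.restriction_sub_eq (h : IsPlaneSolution T u W₀ W) (hT : 0 < T)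
    (hu : MemLp u ∞ (volume.restrict (Ioo 0 T))) {t : ℝ} (ht : t ∈ Icc 0 T) :
    distDeriv (SobolevZero 2) 0 0 (by norm_num) (restriction (W t)) =
      distDeriv (SobolevZero 2) 0 0 (by norm_num) (restriction (W 0)) +
        laplacian (SobolevZero 2) (∫ r in (0 : ℝ)..t, restriction (W r)) := by
  ext Φ
  have h1 := congrArg (fun ℓ => ℓ (zeroExtend Φ)) (h.sub_eq_planePrimitive hT hu ht)
  change distDeriv (Sobolev ⊤ 2) 0 0 (by norm_num) (W t) (zeroExtend Φ) -
    distDeriv (Sobolev ⊤ 2) 0 0 (by norm_num) (W 0) (zeroExtend Φ) =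
    laplacian (Sobolev ⊤ 2) (∫ r in (0 : ℝ)..t, W r) (zeroExtend Φ) -
      (2 * ∫ r in (0 : ℝ)..t, u r) * delta (zeroExtend Φ) at h1
  have hsub {X : Type} [NormedAddCommGroup X] {f : ℝ → X} (hf : ContinuousOn f (Icc 0 T)) :
      IntervalIntegrable f volume 0 t :=
    intervalIntegrable_sub (intervalIntegrable_of_continuousOn hT hf) left_mem_uIcc
      (by rwa [uIcc_of_le hT.le])
  have e1 := ((laplacian (Sobolev ⊤ 2)).flip (zeroExtend Φ)).intervalIntegral_comp_comm
    (hsub h.continuousOn)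
  have e2 := ((laplacian (SobolevZero 2)).flip Φ).intervalIntegral_comp_comm
    (hsub h.continuousOn_restriction)
  have e3 (f : L2 (⊤ : Opens (ℝ × ℝ))) : (laplacian (Sobolev ⊤ 2)).flip (zeroExtend Φ) f =
      (laplacian (SobolevZero 2)).flip Φ (restriction f) := by
    rw [ContinuousLinearMap.flip_apply, ContinuousLinearMap.flip_apply, laplacian, laplacian,
      add_apply, add_apply, add_apply, add_apply, distDeriv_zeroExtend, distDeriv_zeroExtend]
  rw [intervalIntegral.integral_congr fun r _ => e3 (W r), e2, ContinuousLinearMap.flip_apply,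
    ContinuousLinearMap.flip_apply] at e1
  rw [delta_zeroExtend, mul_zero, sub_zero, ← e1, distDeriv_zeroExtend, distDeriv_zeroExtend] at h1
  rw [add_apply, ← h1]
  abel

/-- Once the source is gone the integrand is continuous into `L²`, so the fundamental theorem of
calculus gives the derivative at every interior time and not only almost everywhere. -/
theorem IsPlaneSolution.hasDerivAt_restriction (h : IsPlaneSolution T u W₀ W) (hT : 0 < T)
    (hu : MemLp u ∞ (volume.restrict (Ioo 0 T))) {t : ℝ} (ht : t ∈ Ioo 0 T) :
    HasDerivAt (fun τ => distDeriv (SobolevZero 2) 0 0 (by norm_num) (restriction (W τ)))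
      (laplacian (SobolevZero 2) (restriction (W t))) t := by
  have hc := h.continuousOn_restriction
  have hI : Icc 0 T ∈ 𝓝 t := Icc_mem_nhds ht.1 ht.2
  have hd : HasDerivAt (fun τ => ∫ r in (0 : ℝ)..τ, restriction (W r)) (restriction (W t)) t :=
    intervalIntegral.integral_hasDerivAt_right
      (intervalIntegrable_sub (intervalIntegrable_of_continuousOn hT hc) left_mem_uIcc
        (by rw [uIcc_of_le hT.le]; exact Ioo_subset_Icc_self ht))
      ((hc.mono Ioo_subset_Icc_self).stronglyMeasurableAtFilter isOpen_Ioo t ht)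
      (hc.continuousAt hI)
  have h2 := (((laplacian (SobolevZero 2)).restrictScalars ℝ).hasFDerivAt.comp_hasDerivAt t hd).const_add
    (distDeriv (SobolevZero 2) 0 0 (by norm_num) (restriction (W 0)))
  refine h2.congr_of_eventuallyEq ?_
  filter_upwards [hI] with τ hτ using h.restriction_sub_eq hT hu hτ

end ZeroExtension

/-! ### The heat kernel on the line -/

section GaussianKernel

/-- The polynomial factor of the `j`-th derivative, `j ≤ 2`, of the heat kernel on the line. -/
def heatFactor (j : ℕ) (τ x : ℝ) : ℝ :=
  match j with
  | 0 => 1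
  | 1 => -(x / (2 * τ))
  | _ => x ^ 2 / (4 * τ ^ 2) - 1 / (2 * τ)

/-- The heat kernel on the line. -/
def heatReal (τ x : ℝ) : ℝ := (√(4 * Real.pi * τ))⁻¹ * Real.exp (-(x ^ 2) / (4 * τ))

/-- The `j`-th derivative in `x`, `j ≤ 2`, of the heat kernel on the line. -/
def heatKer (j : ℕ) (τ x : ℝ) : ℂ := ((heatFactor j τ x * heatReal τ x : ℝ) : ℂ)

theorem norm_heatKer (j : ℕ) (τ x : ℝ) : ‖heatKer j τ x‖ = |heatFactor j τ x| * heatReal τ x := by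
  have h : 0 ≤ heatReal τ x := by unfold heatReal; positivity
  rw [heatKer, Complex.norm_real, Real.norm_eq_abs, abs_mul, abs_of_nonneg h]

theorem heatKer_zero (τ x : ℝ) : heatKer 0 τ x = (heatReal τ x : ℂ) := by
  simp [heatKer, heatFactor]

theorem heatReal_nonneg (τ x : ℝ) : 0 ≤ heatReal τ x := by unfold heatReal; positivity

theorem heatReal_neg (τ x : ℝ) : heatReal τ (-x) = heatReal τ x := by simp [heatReal]

theorem heatKer_zero_neg (τ x : ℝ) : heatKer 0 τ (-x) = heatKer 0 τ x := by
  rw [heatKer_zero, heatKer_zero, heatReal_neg]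

theorem heatKer_two_neg (τ x : ℝ) : heatKer 2 τ (-x) = heatKer 2 τ x := by
  simp [heatKer, heatFactor, heatReal_neg]

theorem hasDerivAt_heatReal (τ x : ℝ) :
    HasDerivAt (heatReal τ) (-(x / (2 * τ)) * heatReal τ x) x := by
  have h1 : HasDerivAt (fun x : ℝ => -(x ^ 2) / (4 * τ)) (-(2 * x) / (4 * τ)) x := by
    simpa using ((hasDerivAt_pow 2 x).neg).div_const (4 * τ)
  refine (h1.exp.const_mul (√(4 * Real.pi * τ))⁻¹).congr_deriv ?_
  rw [heatReal]
  have : -(2 * x) / (4 * τ) = -(x / (2 * τ)) := by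
    rw [show (4 : ℝ) * τ = 2 * (2 * τ) by ring, neg_div, mul_div_mul_left _ _ two_ne_zero]
  rw [this]; ring

theorem hasDerivAt_heatKer {τ : ℝ} (hτ : 0 < τ) {j : ℕ} (hj : j ≤ 1) (x : ℝ) :
    HasDerivAt (heatKer j τ) (heatKer (j + 1) τ x) x := by
  have h0 := hasDerivAt_heatReal τ x
  interval_cases j
  · refine HasDerivAt.ofReal_comp (f := fun x => heatFactor 0 τ x * heatReal τ x) ?_
    simpa only [heatFactor, one_mul] using h0
  · refine HasDerivAt.ofReal_comp (f := fun x => heatFactor 1 τ x * heatReal τ x) ?_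
    have h1 : HasDerivAt (fun x => heatFactor 1 τ x) (-(1 / (2 * τ))) x :=
      ((hasDerivAt_id x).div_const (2 * τ)).neg
    refine (h1.mul h0).congr_deriv ?_
    simp only [heatFactor]
    field_simp
    ring

theorem hasDerivAt_heatKer_time {τ : ℝ} (hτ : 0 < τ) (x : ℝ) :
    HasDerivAt (fun σ => heatKer 0 σ x) (heatKer 2 τ x) τ := by
  refine HasDerivAt.ofReal_comp (f := fun σ => heatFactor 0 σ x * heatReal σ x) ?_
  simp only [heatFactor, one_mul, heatReal]
  have hs : (0 : ℝ) < 4 * Real.pi * τ := by positivity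
  have h1 : HasDerivAt (fun σ : ℝ => √(4 * Real.pi * σ)) (4 * Real.pi / (2 * √(4 * Real.pi * τ))) τ := by
    simpa using ((hasDerivAt_id τ).const_mul (4 * Real.pi)).sqrt hs.ne'
  have h2 : HasDerivAt (fun σ : ℝ => (√(4 * Real.pi * σ))⁻¹) _ τ := h1.inv (Real.sqrt_pos.2 hs).ne'
  have h3 : HasDerivAt (fun σ : ℝ => -(x ^ 2) / (4 * σ)) (x ^ 2 / (4 * τ ^ 2)) τ := by
    have := (((hasDerivAt_id τ).const_mul 4).inv (by simp only [id]; positivity)).const_mul (-(x ^ 2))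
    refine (this.congr_deriv ?_).congr_of_eventuallyEq (Eventually.of_forall fun σ => ?_)
    · simp only [id]; field_simp
    · simp [div_eq_mul_inv]
  refine (h2.mul h3.exp).congr_deriv ?_
  have hq : √(4 * Real.pi * τ) ^ 2 = 4 * Real.pi * τ := Real.sq_sqrt hs.le
  have hq0 : √(4 * Real.pi * τ) ≠ 0 := (Real.sqrt_pos.2 hs).ne'
  set q := √(4 * Real.pi * τ)
  have e : -(4 * Real.pi / (2 * q)) / q ^ 2 = -(1 / (2 * τ)) * q⁻¹ := by
    rw [hq]
    field_simp
  rw [e]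
  ring

theorem continuous_heatKer (j : ℕ) (τ : ℝ) : Continuous (heatKer j τ) := by
  refine Complex.continuous_ofReal.comp (Continuous.mul ?_ ?_)
  · rcases j with _ | _ | j
    · exact continuous_const
    · change Continuous fun x => -(x / (2 * τ))
      fun_prop
    · change Continuous fun x => x ^ 2 / (4 * τ ^ 2) - 1 / (2 * τ)
      fun_prop
  · unfold heatReal; fun_prop

theorem continuousAt_heatKer_time (j : ℕ) {τ : ℝ} (hτ : 0 < τ) (x : ℝ) :
    ContinuousAt (fun σ => heatKer j σ x) τ := by
  refine Complex.continuous_ofReal.continuousAt.comp (ContinuousAt.mul ?_ ?_)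
  · rcases j with _ | _ | j
    · exact continuousAt_const
    · simp only [heatFactor]
      exact (continuousAt_const.div (by fun_prop) (by positivity)).neg
    · simp only [heatFactor]
      exact (continuousAt_const.div (by fun_prop) (by positivity)).sub
        (continuousAt_const.div (by fun_prop) (by positivity))
  · unfold heatReal
    refine ContinuousAt.mul (ContinuousAt.inv₀ (by fun_prop) (by positivity)) ?_
    exact (continuousAt_const.div (by fun_prop) (by positivity)).rexp

theorem one_add_le_mul_exp {c y : ℝ} (hc : 0 < c) (hy : 0 ≤ y) :
    1 + y ≤ (1 + c⁻¹) * Real.exp (c * y) := by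
  have h1 : c * y ≤ Real.exp (c * y) := (by linarith [Real.add_one_le_exp (c * y)])
  have h2 : 1 ≤ Real.exp (c * y) := Real.one_le_exp (by positivity)
  have h3 : y ≤ c⁻¹ * Real.exp (c * y) := by
    rw [le_inv_mul_iff₀ hc]; exact h1
  linarith

/-- Gaussian bounds for the heat kernel and its derivatives, uniform for `τ` in a compact set. -/
theorem exists_heatKer_bound {a b : ℝ} (ha : 0 < a) (hab : a ≤ b) :
    ∃ C c, 0 ≤ C ∧ 0 < c ∧ ∀ j τ x, τ ∈ Icc a b → ‖heatKer j τ x‖ ≤ C * Real.exp (-c * x ^ 2) := by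
  have hb : 0 < b := ha.trans_le hab
  set K : ℝ := 1 + 1 / (2 * a) + 1 / (4 * a ^ 2) with hK
  have hK0 : 0 ≤ K := by positivity
  -- Half of the decay rate `1/(4b)` is spent on absorbing the polynomial factor `1 + x²`, at the
  -- cost of the constant `1 + 8b`; the rate `1/(8b)` remains.
  refine ⟨K * (1 + (8 * b)) * (√(4 * Real.pi * a))⁻¹, (8 * b)⁻¹, by positivity, by positivity,
    fun j τ x hτ => ?_⟩
  have hτ0 : 0 < τ := ha.trans_le hτ.1
  have h1 : |heatFactor j τ x| ≤ K * (1 + x ^ 2) := by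
    have i1 : 1 / (2 * τ) ≤ 1 / (2 * a) := by gcongr; exact hτ.1
    have i2 : 1 / (4 * τ ^ 2) ≤ 1 / (4 * a ^ 2) := by gcongr; exact hτ.1
    have p1 : 0 ≤ 1 / (2 * τ) := by positivity
    have p2 : 0 ≤ 1 / (4 * τ ^ 2) := by positivity
    have p3 : 0 ≤ 1 / (2 * a) := by positivity
    have p4 : 0 ≤ 1 / (4 * a ^ 2) := by positivity
    have hx : |x| ≤ 1 + x ^ 2 := by
      rw [← sq_abs x]; nlinarith [sq_nonneg (|x| - 1), abs_nonneg x]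
    rcases j with _ | _ | j
    · simp only [heatFactor, abs_one]; nlinarith [sq_nonneg x]
    · simp only [heatFactor, abs_neg, abs_div, abs_of_pos (show 0 < 2 * τ by positivity)]
      rw [div_eq_mul_one_div, mul_comm]
      exact mul_le_mul (by rw [hK]; linarith) hx (abs_nonneg _) hK0
    · simp only [heatFactor]
      have e : x ^ 2 / (4 * τ ^ 2) = 1 / (4 * τ ^ 2) * x ^ 2 := by ring
      rw [e, abs_le]
      constructor
      · nlinarith [sq_nonneg x, mul_nonneg p2 (sq_nonneg x), mul_nonneg p3 (sq_nonneg x),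
          mul_nonneg p4 (sq_nonneg x)]
      · nlinarith [sq_nonneg x, mul_le_mul_of_nonneg_right i2 (sq_nonneg x), mul_nonneg p3 (sq_nonneg x)]
  have h2 : heatReal τ x ≤ (√(4 * Real.pi * a))⁻¹ * Real.exp (-(x ^ 2) / (4 * b)) := by
    unfold heatReal
    have : -(x ^ 2) / (4 * τ) ≤ -(x ^ 2) / (4 * b) := by
      rw [neg_div, neg_div, neg_le_neg_iff]
      gcongr; exact hτ.2
    gcongr
    exact hτ.1
  have h3 := one_add_le_mul_exp (c := (8 * b)⁻¹) (by positivity) (sq_nonneg x)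
  rw [inv_inv] at h3
  rw [norm_heatKer]
  calc |heatFactor j τ x| * heatReal τ x
      ≤ (K * (1 + x ^ 2)) * ((√(4 * Real.pi * a))⁻¹ * Real.exp (-(x ^ 2) / (4 * b))) :=
        mul_le_mul h1 h2 (heatReal_nonneg _ _) (by positivity)
    _ ≤ (K * ((1 + 8 * b) * Real.exp ((8 * b)⁻¹ * x ^ 2))) *
          ((√(4 * Real.pi * a))⁻¹ * Real.exp (-(x ^ 2) / (4 * b))) := by gcongr
    _ = K * (1 + 8 * b) * (√(4 * Real.pi * a))⁻¹ *
          (Real.exp ((8 * b)⁻¹ * x ^ 2) * Real.exp (-(x ^ 2) / (4 * b))) := by ring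
    _ = _ := by
        rw [← Real.exp_add]
        congr 2
        field_simp
        ring

theorem integrable_heatKer (j : ℕ) {τ : ℝ} (hτ : 0 < τ) : Integrable (heatKer j τ) volume := by
  obtain ⟨C, c, -, hc, h⟩ := exists_heatKer_bound hτ le_rfl
  exact ((integrable_exp_neg_mul_sq hc).const_mul C).mono' (continuous_heatKer j τ).aestronglyMeasurable
    (Eventually.of_forall fun x => h j τ x ⟨le_rfl, le_rfl⟩)

theorem memLp_gaussian {c : ℝ} (hc : 0 < c) (C : ℝ) :
    MemLp (fun x : ℝ => C * Real.exp (-c * x ^ 2)) 2 volume := by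
  have hcont : Continuous fun x : ℝ => C * Real.exp (-c * x ^ 2) := by fun_prop
  rw [memLp_two_iff_integrable_sq hcont.aestronglyMeasurable]
  refine ((integrable_exp_neg_mul_sq (b := 2 * c) (by positivity)).const_mul (C ^ 2)).congr
    (Eventually.of_forall fun x => ?_)
  dsimp only
  rw [mul_pow, ← Real.exp_nat_mul]
  congr 2
  push_cast; ring

theorem memLp_heatKer (j : ℕ) {τ : ℝ} (hτ : 0 < τ) : MemLp (heatKer j τ) 2 volume := by
  obtain ⟨C, c, -, hc, h⟩ := exists_heatKer_bound hτ le_rfl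
  refine (memLp_gaussian hc C).mono (continuous_heatKer j τ).aestronglyMeasurable
    (Eventually.of_forall fun x => ?_)
  exact (h j τ x ⟨le_rfl, le_rfl⟩).trans (le_abs_self _)

theorem integral_heatKer {τ : ℝ} (hτ : 0 < τ) : ∫ x, heatKer 0 τ x = 1 := by
  simp only [heatKer_zero]
  rw [integral_complex_ofReal]
  simp only [heatReal]
  rw [integral_const_mul]
  have e : (fun x : ℝ => Real.exp (-(x ^ 2) / (4 * τ))) = fun x => Real.exp (-(4 * τ)⁻¹ * x ^ 2) := by
    ext x; congr 1; ring
  rw [e, integral_gaussian, div_inv_eq_mul, show Real.pi * (4 * τ) = 4 * Real.pi * τ by ring,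
    inv_mul_cancel₀ (by positivity), Complex.ofReal_one]

theorem integral_norm_heatKer {τ : ℝ} (hτ : 0 < τ) : ∫ x, ‖heatKer 0 τ x‖ = 1 := by
  have h := integral_heatKer hτ
  simp only [heatKer_zero] at h ⊢
  rw [integral_complex_ofReal] at h
  simp only [Complex.norm_real, Real.norm_eq_abs, abs_of_nonneg (heatReal_nonneg _ _)]
  exact_mod_cast h

theorem heatReal_scale {l : ℝ} (hl : 0 < l) (τ x : ℝ) :
    heatReal (l ^ 2 * τ) (l * x) = l⁻¹ * heatReal τ x := by
  unfold heatReal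
  rw [show 4 * Real.pi * (l ^ 2 * τ) = l ^ 2 * (4 * Real.pi * τ) by ring, Real.sqrt_mul (by positivity),
    Real.sqrt_sq hl.le, mul_inv, mul_assoc]
  congr 3
  rw [show -((l * x) ^ 2) = l ^ 2 * -(x ^ 2) by ring, show 4 * (l ^ 2 * τ) = l ^ 2 * (4 * τ) by ring,
    mul_div_mul_left _ _ (by positivity)]

theorem heatKer_scale {l : ℝ} (hl : 0 < l) (τ x : ℝ) :
    heatKer 0 (l ^ 2 * τ) (l * x) = (l : ℂ)⁻¹ * heatKer 0 τ x := by
  rw [heatKer_zero, heatKer_zero, heatReal_scale hl]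
  push_cast; rfl

/-- With `y = x²/(4τ)` the polynomial factor is at most `τ⁻¹ (1 + y)`, which the exponential
absorbs. The rate `τ^(-3/2)`, uniform in `x`, is integrable at infinity. -/
theorem norm_heatKer_two_le {τ : ℝ} (hτ : 0 < τ) (x : ℝ) :
    ‖heatKer 2 τ x‖ ≤ 2 * τ⁻¹ * (√τ)⁻¹ := by
  rw [norm_heatKer]
  set y := x ^ 2 / (4 * τ) with hy
  have hy0 : 0 ≤ y := by positivity
  have h1 : |heatFactor 2 τ x| ≤ τ⁻¹ * (1 + y) := by
    have e : heatFactor 2 τ x = τ⁻¹ * (y - 1 / 2) := by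
      simp only [heatFactor, hy]; field_simp
    rw [e, abs_mul, abs_of_pos (inv_pos.2 hτ)]
    refine mul_le_mul_of_nonneg_left ?_ (inv_pos.2 hτ).le
    rw [abs_le]; constructor <;> linarith
  have h2 : heatReal τ x = (√(4 * Real.pi * τ))⁻¹ * Real.exp (-y) := by
    rw [heatReal, hy, neg_div]
  have h3 : (√(4 * Real.pi * τ))⁻¹ ≤ (√τ)⁻¹ := by
    have : √τ ≤ √(4 * Real.pi * τ) := Real.sqrt_le_sqrt (by nlinarith [Real.pi_gt_three])
    exact inv_anti₀ (Real.sqrt_pos.2 hτ) this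
  have h4 := one_add_le_mul_exp (c := 1) one_pos hy0
  rw [inv_one, one_mul] at h4
  rw [h2]
  calc |heatFactor 2 τ x| * ((√(4 * Real.pi * τ))⁻¹ * Real.exp (-y))
      ≤ (τ⁻¹ * ((1 + 1) * Real.exp y)) * ((√τ)⁻¹ * Real.exp (-y)) := by
        refine mul_le_mul (h1.trans ?_) ?_ (by positivity) (by positivity)
        · exact mul_le_mul_of_nonneg_left h4 (inv_pos.2 hτ).le
        · exact mul_le_mul_of_nonneg_right h3 (Real.exp_pos _).le
    _ = 2 * τ⁻¹ * (√τ)⁻¹ * (Real.exp y * Real.exp (-y)) := by ring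
    _ = _ := by rw [← Real.exp_add, add_neg_cancel, Real.exp_zero, mul_one]

theorem norm_heatKer_zero_le {τ : ℝ} (hτ : 0 < τ) (x : ℝ) : ‖heatKer 0 τ x‖ ≤ (√τ)⁻¹ := by
  rw [norm_heatKer]
  simp only [heatFactor, abs_one, one_mul, heatReal]
  have : √τ ≤ √(4 * Real.pi * τ) := Real.sqrt_le_sqrt (by nlinarith [Real.pi_gt_three])
  calc _ ≤ (√τ)⁻¹ * 1 := by
        refine mul_le_mul (inv_anti₀ (Real.sqrt_pos.2 hτ) this) (Real.exp_le_one_iff.2 ?_)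
          (Real.exp_pos _).le (by positivity)
        rw [neg_div]; exact neg_nonpos.2 (by positivity)
    _ = _ := mul_one _

end GaussianKernel

/-! ### Testing the plane equation with a backward heat flow -/

section Duhamel

variable {T : ℝ} {u : ℝ → ℂ} {W₀ : L2 (⊤ : Opens (ℝ × ℝ))} {W : ℝ → L2 (⊤ : Opens (ℝ × ℝ))}

theorem distDeriv_eq_pairing {U : Opens (ℝ × ℝ)} {s : ℕ}
    (K : Submodule ℂ (PiLp 2 fun _ : MultiIndex s => L2 U)) (a b : ℕ) (h : a + b ≤ s) (f : L2 U)
    (Φ : Space K) : distDeriv K a b h f Φ = (-1) ^ (a + b) * pairing U f (coord K a b h Φ) := by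
  rw [distDeriv_apply, pairing_apply]

/-- The solution tested against a solution of the backward heat equation with values in `H²`. -/
theorem IsPlaneSolution.pairing_sub (h : IsPlaneSolution T u W₀ W) (hT : 0 < T)
    (hu : MemLp u ∞ (volume.restrict (Ioo 0 T))) {Φ : ℝ → Space (Sobolev (⊤ : Opens (ℝ × ℝ)) 2)} {s : ℝ}
    (hs : 0 < s) (hsT : s ≤ T) (hΦ : ContinuousOn Φ (Icc 0 s))
    (hd : ∀ r ∈ Icc 0 s, HasDerivAt (fun r => coord (Sobolev ⊤ 2) 0 0 (by norm_num) (Φ r))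
      (-(coord (Sobolev ⊤ 2) 2 0 (by norm_num) (Φ r) + coord (Sobolev ⊤ 2) 0 2 (by norm_num) (Φ r))) r) :
    pairing ⊤ (W s) (coord (Sobolev ⊤ 2) 0 0 (by norm_num) (Φ s)) -
      pairing ⊤ (W 0) (coord (Sobolev ⊤ 2) 0 0 (by norm_num) (Φ 0)) =
        -2 * ∫ r in (0 : ℝ)..s, u r * delta (Φ r) := by
  have hsub : Icc 0 s ⊆ Icc 0 T := Icc_subset_Icc_right hsT
  set X : ℝ → StrongDual ℂ (Space (Sobolev (⊤ : Opens (ℝ × ℝ)) 2)) :=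
    fun r => distDeriv (Sobolev ⊤ 2) 0 0 (by norm_num) (W r) with hX
  set φ : ℝ → L2 (⊤ : Opens (ℝ × ℝ)) := fun r => coord (Sobolev ⊤ 2) 0 0 (by norm_num) (Φ r) with hφ
  set φ' : ℝ → L2 (⊤ : Opens (ℝ × ℝ)) := fun r => -(coord (Sobolev ⊤ 2) 2 0 (by norm_num) (Φ r) +
    coord (Sobolev ⊤ 2) 0 2 (by norm_num) (Φ r)) with hφ'
  have eX (r : ℝ) (Ψ : Space (Sobolev (⊤ : Opens (ℝ × ℝ)) 2)) : X r Ψ =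
      pairing ⊤ (W r) (coord (Sobolev ⊤ 2) 0 0 (by norm_num) Ψ) := by
    rw [hX]; dsimp only; rw [distDeriv_eq_pairing]
    simp only [add_zero, pow_zero, one_mul]
  have hXac : AbsolutelyContinuousOnInterval X 0 s := h.absolutelyContinuous.mono (by
    rwa [uIcc_of_le hs.le, uIcc_of_le hT.le])
  obtain ⟨B, hB⟩ := isCompact_Icc.exists_bound_of_continuousOn hΦ
  obtain ⟨M, hM⟩ := isCompact_Icc.exists_bound_of_continuousOn (h.continuousOn.mono hsub)
  have hφ'c : ContinuousOn φ' (Icc 0 s) :=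
    (((coord (Sobolev ⊤ 2) 2 0 (by norm_num)).continuous.comp_continuousOn hΦ).add
      ((coord (Sobolev ⊤ 2) 0 2 (by norm_num)).continuous.comp_continuousOn hΦ)).neg
  obtain ⟨L, hL⟩ := isCompact_Icc.exists_bound_of_continuousOn hφ'c
  have h0 : (0 : ℝ) ∈ Icc 0 s := ⟨le_rfl, hs.le⟩
  have hB0 : 0 ≤ B := (norm_nonneg _).trans (hB 0 h0)
  have hM0 : 0 ≤ M := (norm_nonneg _).trans (hM 0 h0)
  have hL0 : 0 ≤ L := (norm_nonneg _).trans (hL 0 h0)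
  have hLip : ∀ x ∈ Icc 0 s, ∀ y ∈ Icc 0 s, ‖φ x - φ y‖ ≤ L * dist x y := fun x hx y hy => by
    have := (convex_Icc 0 s).norm_image_sub_le_of_norm_hasDerivWithin_le (f := φ) (f' := φ')
      (fun r hr => (hd r hr).hasDerivWithinAt) hL hy hx
    rwa [Real.dist_eq]
  set m : ℝ → ℂ := fun r => X r (Φ r) with hm
  have hmac : AbsolutelyContinuousOnInterval m 0 s := by
    set P := ‖pairing (⊤ : Opens (ℝ × ℝ))‖
    have hP0 : 0 ≤ P := norm_nonneg (pairing (⊤ : Opens (ℝ × ℝ)))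
    refine absolutelyContinuousOnInterval_of_dist_le (C := B + P * M * L) hXac fun x hx y hy => ?_
    rw [uIcc_of_le hs.le] at hx hy
    -- `Φ` is only continuous into `H²`. Its increment is therefore paired with `W y` in `L²`, where
    -- `Φ` is Lipschitz thanks to the backward equation; the increment of `X` meets the bounded
    -- family `Φ`.
    have e : m x - m y = (X x - X y) (Φ x) + pairing ⊤ (W y) (φ x - φ y) := by
      rw [map_sub, sub_apply, ← eX, ← eX]; simp only [hm]; ring
    rw [dist_eq_norm, e, dist_eq_norm (X x)]
    have h1 : ‖(X x - X y) (Φ x)‖ ≤ ‖X x - X y‖ * B :=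
      ((X x - X y).le_opNorm _).trans (mul_le_mul_of_nonneg_left (hB x hx) (norm_nonneg _))
    have h2 : ‖pairing ⊤ (W y) (φ x - φ y)‖ ≤ P * M * (L * dist x y) :=
      ((pairing ⊤).le_opNorm₂ _ _).trans (mul_le_mul
        (mul_le_mul_of_nonneg_left (hM y hy) hP0) (hLip x hx y hy) (norm_nonneg _)
        (mul_nonneg hP0 hM0))
    refine (norm_add_le _ _).trans ((add_le_add h1 h2).trans ?_)
    have hP : 0 ≤ P * M * L := mul_nonneg (mul_nonneg hP0 hM0) hL0
    have h3 : 0 ≤ P * M * L * ‖X x - X y‖ := mul_nonneg hP (norm_nonneg _)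
    have h4 : 0 ≤ B * dist x y := mul_nonneg hB0 dist_nonneg
    linarith [mul_add (B + P * M * L) ‖X x - X y‖ (dist x y),
      add_mul B (P * M * L) ‖X x - X y‖, add_mul B (P * M * L) (dist x y), mul_comm B ‖X x - X y‖,
      mul_assoc (P * M) L (dist x y)]
  have hδ : ContinuousOn (fun r => delta (Φ r)) (Icc 0 s) := delta.continuous.comp_continuousOn hΦ
  have hui : IntervalIntegrable u volume 0 s := intervalIntegrable_sub (intervalIntegrable_control hT hu)
    left_mem_uIcc (by rw [uIcc_of_le hT.le]; exact ⟨hs.le, hsT⟩)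
  have hvi : IntervalIntegrable (fun r => u r * delta (Φ r)) volume 0 s :=
    hui.mul_continuousOn (by rwa [uIcc_of_le hs.le])
  set p : ℝ → ℂ := fun τ => ∫ r in (0 : ℝ)..τ, u r * delta (Φ r) with hp
  have hpac : AbsolutelyContinuousOnInterval p 0 s := by
    obtain ⟨C, hC0, hC⟩ := exists_ae_bound_control hu
    obtain ⟨D, hD⟩ := isCompact_Icc.exists_bound_of_continuousOn hδ
    have hid : AbsolutelyContinuousOnInterval (fun x : ℝ => x) 0 s :=
      (LipschitzWith.id.lipschitzOnWith).absolutelyContinuousOnInterval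
    have hD0 : 0 ≤ D := (norm_nonneg _).trans (hD 0 h0)
    refine absolutelyContinuousOnInterval_of_dist_le (C := C * D) hid fun x hx y hy => ?_
    have := dist_integral_le (C := C * D) hs hvi (by
      filter_upwards [hC] with r hr hr'
      rw [norm_mul]
      exact mul_le_mul (hr ⟨hr'.1, hr'.2.trans_le hsT⟩) (hD r ⟨hr'.1.le, hr'.2.le⟩) (norm_nonneg _) hC0) hx hy
    rw [dist_eq_norm]
    refine this.trans (mul_le_mul_of_nonneg_left (le_add_of_nonneg_left dist_nonneg) (mul_nonneg hC0 hD0))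
  have hder : ∀ᵐ r, r ∈ uIcc 0 s → HasDerivAt (m - fun τ => -2 * p τ) 0 r := by
    have hheat := ae_uIcc_of_ae_restrict_Ioo hT h.heat
    have hn1 : ∀ᵐ r : ℝ, r ≠ s := by simp [ae_iff]
    have hn2 : ∀ᵐ r : ℝ, r ≠ 0 := by simp [ae_iff]
    filter_upwards [hheat, hvi.ae_hasDerivAt_integral, hn1, hn2] with r h1 h2 h3 h4 h5
    have h2' := h2 h5 0 left_mem_uIcc
    rw [uIcc_of_le hs.le] at h5
    have hI : Icc 0 s ∈ 𝓝 r := Icc_mem_nhds (lt_of_le_of_ne h5.1 (Ne.symm h4)) (lt_of_le_of_ne h5.2 h3)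
    have h1' := h1 (by rw [uIcc_of_le hT.le]; exact hsub h5)
    have hmd : HasDerivAt m ((laplacian (Sobolev ⊤ 2) (W r) - (2 * u r) • delta) (Φ r) +
        pairing ⊤ (W r) (φ' r)) r := by
      rw [hasDerivAt_iff_tendsto_slope] at h1' ⊢
      have k2 := hasDerivAt_iff_tendsto_slope.1 (hd r h5)
      have k3 : Tendsto Φ (𝓝[≠] r) (𝓝 (Φ r)) := (hΦ.continuousAt hI).tendsto.mono_left nhdsWithin_le_nhds
      -- Product rule for slopes: the slope of `X` is evaluated at the moving `Φ y`, which converges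
      -- in `H²`, and `W r` is paired with the slope of `φ`, which converges in `L²`.
      have k4 := ((isBoundedBilinearMap_apply (𝕜 := ℂ)).continuous.continuousAt.tendsto.comp (h1'.prodMk_nhds k3)).add ((pairing ⊤ (W r)).continuous.continuousAt.tendsto.comp k2)
      refine k4.congr fun y => ?_
      simp only [Function.comp_apply, slope_def_module]
      have e1 : ((y - r)⁻¹ • (X y - X r)) (Φ y) = (y - r)⁻¹ • (X y (Φ y) - X r (Φ y)) := rfl
      have e2 : pairing ⊤ (W r) ((y - r)⁻¹ • (φ y - φ r)) =
          (y - r)⁻¹ • (X r (Φ y) - X r (Φ r)) := by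
        rw [eX, eX, ← map_sub ((pairing ⊤) (W r))]
        exact ((pairing ⊤ (W r)).restrictScalars ℝ).map_smul _ _
      refine (congrArg₂ (· + ·) e1 e2).trans ?_
      rw [← smul_add]
      congr 1
      simp only [hm]
      ring
    -- The Laplacian of `W` is compensated by the backward equation for `Φ`; only the source
    -- remains.
    have e3 : (laplacian (Sobolev ⊤ 2) (W r) - (2 * u r) • delta) (Φ r) + pairing ⊤ (W r) (φ' r) =
        -2 * (u r * delta (Φ r)) := by
      change laplacian (Sobolev ⊤ 2) (W r) (Φ r) - (2 * u r) * delta (Φ r) + _ = _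
      rw [laplacian, add_apply, add_apply, distDeriv_eq_pairing, distDeriv_eq_pairing, hφ']
      dsimp only
      rw [map_neg, map_add]
      ring
    rw [e3] at hmd
    exact (hmd.sub (h2'.const_mul (-2))).congr_deriv (sub_self _)
  have hpac2 : AbsolutelyContinuousOnInterval (fun τ => -2 * p τ) 0 s := by
    refine absolutelyContinuousOnInterval_of_dist_le (C := 2) hpac fun x hx y hy => ?_
    rw [dist_eq_norm, ← mul_sub, norm_mul, dist_eq_norm (p x)]
    have : ‖(-2 : ℂ)‖ = 2 := by simp
    rw [this, mul_add]
    exact le_add_of_nonneg_right (mul_nonneg zero_le_two dist_nonneg)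
  obtain ⟨C, hC⟩ := (hmac.sub hpac2).const_of_ae_hasDerivAt_zero hder
  rw [uIcc_of_le hs.le] at hC
  have c1 := hC s ⟨hs.le, le_rfl⟩
  have c2 := hC 0 h0
  have c3 : p 0 = 0 := intervalIntegral.integral_same
  simp only [Pi.sub_apply, c3, mul_zero, sub_zero] at c1 c2
  have c4 : m s - m 0 = -2 * p s := by rw [c2, ← c1]; ring
  simp only [hm, eX] at c4
  exact c4

end Duhamel

/-! ### The heat kernel on the plane as a curve in H² -/

section PlaneKernel

/-- The derivatives `∂^(a,b)` of the heat kernel on the plane centred at `y`. -/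
def planeKer (τ : ℝ) (y : ℝ × ℝ) (a b : ℕ) (x : ℝ × ℝ) : ℂ :=
  -- The value `0` for `τ ≤ 0` keeps this a smooth family at every `τ`, so that the kernel is
  -- defined as an element of `H²` for all times.
  if 0 < τ then heatKer a τ (x.1 - y.1) * heatKer b τ (x.2 - y.2) else 0

theorem planeKer_of_pos {τ : ℝ} (hτ : 0 < τ) (y : ℝ × ℝ) (a b : ℕ) (x : ℝ × ℝ) :
    planeKer τ y a b x = heatKer a τ (x.1 - y.1) * heatKer b τ (x.2 - y.2) := if_pos hτ

theorem smoothFamily_planeKer (τ : ℝ) (y : ℝ × ℝ) : SmoothFamily 2 (planeKer τ y) := by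
  by_cases hτ : 0 < τ
  · have e : planeKer τ y = fun a b x => heatKer a τ (x.1 - y.1) * heatKer b τ (x.2 - y.2) := by
      ext a b x; exact planeKer_of_pos hτ y a b x
    rw [e]
    refine ⟨fun a b _ => ?_, fun a b _ => ?_, fun a b hab x z => ?_, fun a b hab x z => ?_⟩
    · exact ((continuous_heatKer a τ).comp (by fun_prop)).mul ((continuous_heatKer b τ).comp (by fun_prop))
    · simp only [sub_eq_add_neg]
      exact memLp_tensor (memLp_translate (memLp_heatKer a hτ) (-y.1)) (memLp_translate (memLp_heatKer b hτ) (-y.2))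
    · exact ((hasDerivAt_heatKer hτ (j := a) (by omega) (x - y.1)).comp_sub_const x y.1).mul_const
        (heatKer b τ (z - y.2))
    · exact ((hasDerivAt_heatKer hτ (j := b) (by omega) (z - y.2)).comp_sub_const z y.2).const_mul
        (heatKer a τ (x - y.1))
  · have e : planeKer τ y = fun a b x => 0 := by
      ext a b x; exact if_neg hτ
    rw [e]
    exact ⟨fun _ _ _ => continuous_const, fun _ _ _ => MemLp.zero, fun _ _ _ _ _ => hasDerivAt_const _ _,
      fun _ _ _ _ _ => hasDerivAt_const _ _⟩

/-- The heat kernel centred at `y`, as an element of `H²(ℝ²)`. -/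
def planeHeat (y : ℝ × ℝ) (τ : ℝ) : Space (Sobolev (⊤ : Opens (ℝ × ℝ)) 2) :=
  (smoothFamily_planeKer τ y).elt ⊤

theorem exists_planeKer_bound {a b : ℝ} (ha : 0 < a) (hab : a ≤ b) :
    ∃ C c, 0 ≤ C ∧ 0 < c ∧ ∀ i j τ, τ ∈ Icc a b → ∀ y x, ‖planeKer τ y i j x‖ ≤
      (C * Real.exp (-c * (x.1 - y.1) ^ 2)) * (C * Real.exp (-c * (x.2 - y.2) ^ 2)) := by
  obtain ⟨C, c, hC, hc, h⟩ := exists_heatKer_bound ha hab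
  refine ⟨C, c, hC, hc, fun i j τ hτ y x => ?_⟩
  rw [planeKer_of_pos (ha.trans_le hτ.1), norm_mul]
  exact mul_le_mul (h i τ _ hτ) (h j τ _ hτ) (norm_nonneg _) (by positivity)

theorem memLp_gaussian_prod {c : ℝ} (hc : 0 < c) (C : ℝ) (y : ℝ × ℝ) :
    MemLp (fun x : ℝ × ℝ => (C * Real.exp (-c * (x.1 - y.1) ^ 2)) * (C * Real.exp (-c * (x.2 - y.2) ^ 2)))
      2 volume := by
  have h1 (z : ℝ) : MemLp (fun x : ℝ => ((C * Real.exp (-c * (x - z) ^ 2) : ℝ) : ℂ)) 2 volume := by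
    have := memLp_translate (f := fun x : ℝ => ((C * Real.exp (-c * x ^ 2) : ℝ) : ℂ))
      ((memLp_gaussian hc C).ofReal) (-z)
    simpa only [sub_eq_add_neg] using this
  refine (memLp_tensor (h1 y.1) (h1 y.2)).re.congr_norm (by fun_prop) (Eventually.of_forall fun x => ?_)
  rw [← Complex.ofReal_mul]
  rfl

/-- For times in `[τ/2, 2τ]` all derivatives lie below one fixed Gaussian product, so pointwise
continuity in time becomes continuity in each `L²` component. -/
theorem continuousAt_planeHeat (y : ℝ × ℝ) {τ : ℝ} (hτ : 0 < τ) : ContinuousAt (planeHeat y) τ := by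
  obtain ⟨C, c, -, hc, hb⟩ := exists_planeKer_bound (half_pos hτ) (show τ / 2 ≤ 2 * τ by linarith)
  have hI : Icc (τ / 2) (2 * τ) ∈ 𝓝 τ := Icc_mem_nhds (by linarith) (by linarith)
  have hc' : ContinuousAt (fun σ => Space.incl _ (planeHeat y σ)) τ := by
    refine (PiLp.continuous_toLp 2 (fun _ : MultiIndex 2 => L2 (⊤ : Opens (ℝ × ℝ)))).continuousAt.comp
      (f := fun σ (α : MultiIndex 2) => toL2 ⊤ ((smoothFamily_planeKer σ y).memLp α.1.1 α.1.2 α.2))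
      (continuousAt_pi.2 fun α => ?_)
    refine tendsto_toLp_of_dominated (F := fun σ => planeKer σ y α.1.1 α.1.2)
      (fun σ => ((smoothFamily_planeKer σ y).memLp α.1.1 α.1.2 α.2).mono_measure Measure.restrict_le_self) _
      ((memLp_gaussian_prod hc C y).mono_measure Measure.restrict_le_self) ?_ ?_
    · filter_upwards [hI] with σ hσ using Eventually.of_forall fun x => hb _ _ σ hσ y x
    · refine Eventually.of_forall fun x => ?_
      have : Tendsto (fun σ => heatKer α.1.1 σ (x.1 - y.1) * heatKer α.1.2 σ (x.2 - y.2)) (𝓝 τ)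
          (𝓝 (heatKer α.1.1 τ (x.1 - y.1) * heatKer α.1.2 τ (x.2 - y.2))) :=
        (continuousAt_heatKer_time _ hτ _).mul (continuousAt_heatKer_time _ hτ _)
      rw [← planeKer_of_pos hτ y] at this
      refine this.congr' ?_
      filter_upwards [lt_mem_nhds hτ] with σ hσ using (planeKer_of_pos hσ y _ _ x).symm
  exact Topology.IsInducing.subtypeVal.continuousAt_iff.2 hc'

/-- The heat equation holds pointwise; the mean value inequality and the common Gaussian majorant
turn it into a derivative in `L²`. -/
theorem hasDerivAt_planeHeat (y : ℝ × ℝ) {τ : ℝ} (hτ : 0 < τ) :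
    HasDerivAt (fun σ => coord (Sobolev ⊤ 2) 0 0 (by norm_num) (planeHeat y σ))
      (coord (Sobolev ⊤ 2) 2 0 (by norm_num) (planeHeat y τ) +
        coord (Sobolev ⊤ 2) 0 2 (by norm_num) (planeHeat y τ)) τ := by
  obtain ⟨C, c, hC0, hc, hb⟩ := exists_planeKer_bound (half_pos hτ) (show τ / 2 ≤ 2 * τ by linarith)
  have hI : Icc (τ / 2) (2 * τ) ∈ 𝓝 τ := Icc_mem_nhds (by linarith) (by linarith)
  have hd : ∀ σ, 0 < σ → ∀ x, HasDerivAt (fun σ => planeKer σ y 0 0 x)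
      (planeKer σ y 2 0 x + planeKer σ y 0 2 x) σ := fun σ hσ x => by
    have h1 := (hasDerivAt_heatKer_time hσ (x.1 - y.1)).mul (hasDerivAt_heatKer_time hσ (x.2 - y.2))
    rw [planeKer_of_pos hσ, planeKer_of_pos hσ]
    refine h1.congr_of_eventuallyEq ?_
    filter_upwards [lt_mem_nhds hσ] with ρ hρ using planeKer_of_pos hρ y _ _ x
  have hm := (smoothFamily_planeKer τ y).memLp
  have h2 := hasDerivAt_toLp_of_dominated (μ := volume.restrict ((⊤ : Opens (ℝ × ℝ)) : Set (ℝ × ℝ)))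
    (F := fun σ => planeKer σ y 0 0) (F' := planeKer τ y 2 0 + planeKer τ y 0 2)
    (fun σ => ((smoothFamily_planeKer σ y).memLp 0 0 (by norm_num)).mono_measure Measure.restrict_le_self)
    (((hm 2 0 (by norm_num)).add (hm 0 2 (by norm_num))).mono_measure Measure.restrict_le_self)
    (((memLp_gaussian_prod hc C y).const_mul 2).mono_measure Measure.restrict_le_self) (by
      filter_upwards [hI] with σ hσ x
      have := (convex_Icc (τ / 2) (2 * τ)).norm_image_sub_le_of_norm_hasDerivWithin_le
        (f := fun σ => planeKer σ y 0 0 x) (x := τ) (y := σ)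
        (fun ρ hρ => (hd ρ ((half_pos hτ).trans_le hρ.1) x).hasDerivWithinAt)
        (fun ρ hρ => (norm_add_le _ _).trans (add_le_add (hb _ _ ρ hρ y x) (hb _ _ ρ hρ y x)))
        ⟨by linarith, by linarith⟩ hσ
      rw [Real.norm_eq_abs] at this
      refine this.trans (le_of_eq ?_)
      ring) (fun x => hd τ hτ x)
  exact h2

/-- The integrand is the derivative of `e^x f(x)` on the negative ray. Boundedness of `f` suffices
for the boundary term at `-∞`, so that the heat kernel, which has no compact support, is allowed. -/
theorem integral_expRay_mul_of_bounded {f f' : ℝ → ℂ} {C : ℝ} (hd : ∀ x, HasDerivAt f (f' x) x)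
    (hC : ∀ x, ‖f x‖ ≤ C) (hi : Integrable (fun x => expRay x * (f x + f' x)) volume) :
    ∫ x, expRay x * (f x + f' x) = f 0 := by
  have hg : ∀ x, HasDerivAt (fun x : ℝ => (Real.exp x : ℂ) * f x)
      ((Real.exp x : ℂ) * (f x + f' x)) x := fun x => by
    have := ((Real.hasDerivAt_exp x).ofReal_comp).mul (hd x)
    rw [← mul_add] at this
    exact this
  have he : (fun x => expRay x * (f x + f' x)) =
      (Iic (0 : ℝ)).indicator fun x => (Real.exp x : ℂ) * (f x + f' x) := by
    ext x
    by_cases hx : x ∈ Iic (0 : ℝ)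
    · simp only [expRay, indicator_of_mem hx]
    · simp only [expRay, indicator_of_notMem hx, zero_mul]
  rw [he] at hi ⊢
  rw [integrable_indicator_iff measurableSet_Iic] at hi
  rw [integral_indicator measurableSet_Iic, integral_Iic_of_hasDerivAt_of_tendsto' (fun x _ => hg x) hi
    (m := 0)]
  · simp
  · refine squeeze_zero_norm (a := fun x => Real.exp x * C) (fun x => ?_) ?_
    · rw [norm_mul, Complex.norm_real, Real.norm_eq_abs, Real.abs_exp]
      exact mul_le_mul_of_nonneg_left (hC x) (Real.exp_pos x).le
    · simpa using Real.tendsto_exp_atBot.mul_const C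

theorem integral_expRay_heatKer {τ : ℝ} (hτ : 0 < τ) (z : ℝ) :
    ∫ x, expRay x * (heatKer 0 τ (x - z) + heatKer 1 τ (x - z)) = heatKer 0 τ z := by
  have hm (j : ℕ) : MemLp (fun x => heatKer j τ (x - z)) 2 volume := by
    simpa only [sub_eq_add_neg] using memLp_translate (memLp_heatKer j hτ) (-z)
  have := integral_expRay_mul_of_bounded (f := fun x => heatKer 0 τ (x - z))
    (fun x => (hasDerivAt_heatKer hτ zero_le_one (x - z)).comp_sub_const x z)
    (fun x => norm_heatKer_zero_le hτ (x - z)) (memLp_expRay.integrable_mul ((hm 0).add (hm 1)))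
  rw [this, zero_sub, heatKer_zero_neg]

theorem delta_planeHeat {τ : ℝ} (hτ : 0 < τ) (y : ℝ × ℝ) :
    delta (planeHeat y τ) = heatKer 0 τ y.1 * heatKer 0 τ y.2 := by
  have hm := (memLp_tensor memLp_expRay memLp_expRay).mono_measure
      (Measure.restrict_le_self (s := ((⊤ : Opens (ℝ × ℝ)) : Set (ℝ × ℝ))))
  have hmem := (smoothFamily_planeKer τ y).memLp
  have key (a b : ℕ) (hab : a + b ≤ 2) : pairing ⊤ (hm.toLp fun x : ℝ × ℝ => expRay x.1 * expRay x.2)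
      (coord (Sobolev ⊤ 2) a b hab (planeHeat y τ)) =
      ∫ x : ℝ × ℝ, expRay x.1 * expRay x.2 * planeKer τ y a b x := by
    rw [planeHeat, SmoothFamily.coord_elt, pairing_toL2, integral_top]
    refine integral_congr_ae ?_
    filter_upwards [ae_top_iff.1 (MemLp.coeFn_toLp hm)] with x hx
    rw [hx]
  have hi (a b : ℕ) (hab : a + b ≤ 2) :
      Integrable (fun x : ℝ × ℝ => expRay x.1 * expRay x.2 * planeKer τ y a b x) volume :=
    (memLp_tensor memLp_expRay memLp_expRay).integrable_mul (hmem a b hab)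
  have e : delta (planeHeat y τ) = pairing ⊤ (hm.toLp fun x : ℝ × ℝ => expRay x.1 * expRay x.2)
      (coord (Sobolev ⊤ 2) 0 0 (by norm_num) (planeHeat y τ) +
        coord (Sobolev ⊤ 2) 1 0 (by norm_num) (planeHeat y τ) +
        coord (Sobolev ⊤ 2) 0 1 (by norm_num) (planeHeat y τ) +
        coord (Sobolev ⊤ 2) 1 1 (by norm_num) (planeHeat y τ)) := rfl
  have i1 : Integrable (fun x : ℝ × ℝ => expRay x.1 * expRay x.2 * planeKer τ y 0 0 x +
      expRay x.1 * expRay x.2 * planeKer τ y 1 0 x) volume :=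
    (hi 0 0 (by norm_num)).add (hi 1 0 (by norm_num))
  have i2 : Integrable (fun x : ℝ × ℝ => expRay x.1 * expRay x.2 * planeKer τ y 0 0 x +
      expRay x.1 * expRay x.2 * planeKer τ y 1 0 x +
      expRay x.1 * expRay x.2 * planeKer τ y 0 1 x) volume := i1.add (hi 0 1 (by norm_num))
  rw [e, map_add, map_add, map_add, key, key, key, key, ← integral_add (hi _ _ (by norm_num)) (hi _ _ (by norm_num)),
    ← integral_add i1 (hi _ _ (by norm_num)), ← integral_add i2 (hi _ _ (by norm_num)), ← integral_expRay_heatKer hτ,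
    ← integral_expRay_heatKer hτ y.2, ← integral_prod_mul, ← Measure.volume_eq_prod]
  congr 1
  ext x
  simp only [planeKer_of_pos hτ]
  ring

end PlaneKernel

/-! ### Duhamel's formula -/

section DuhamelFormula

/-- The heat kernel on the plane. -/
def planeK (τ : ℝ) (z : ℝ × ℝ) : ℂ := heatKer 0 τ z.1 * heatKer 0 τ z.2

/-- The value at `0` of the solution of the heat equation on the line with initial value `q`. -/
def heatAverage (q : ℝ → ℂ) (τ : ℝ) : ℂ := ∫ x, q x * heatKer 0 τ x

theorem measurable_heatKer_zero : Measurable fun z : ℝ × ℝ => heatKer 0 z.1 z.2 := by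
  simp only [heatKer_zero, heatReal]
  fun_prop

theorem planeKer_eq_planeK {τ : ℝ} (hτ : 0 < τ) (x y : ℝ × ℝ) :
    planeKer τ y 0 0 x = planeK τ (x - y) := planeKer_of_pos hτ y 0 0 x

theorem integrable_heatKer_prod (i j : ℕ) {τ : ℝ} (hτ : 0 < τ) :
    Integrable (fun z : ℝ × ℝ => heatKer i τ z.1 * heatKer j τ z.2) volume := by
  rw [Measure.volume_eq_prod]
  exact (integrable_heatKer i hτ).mul_prod (integrable_heatKer j hτ)

theorem integrable_planeK {τ : ℝ} (hτ : 0 < τ) : Integrable (planeK τ) volume :=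
  integrable_heatKer_prod 0 0 hτ

theorem integral_planeK {τ : ℝ} (hτ : 0 < τ) : ∫ z, planeK τ z = 1 := by
  simp only [planeK]
  rw [Measure.volume_eq_prod, integral_prod_mul, integral_heatKer hτ, one_mul]

theorem integral_norm_planeK {τ : ℝ} (hτ : 0 < τ) : ∫ z, ‖planeK τ z‖ = 1 := by
  simp only [planeK, norm_mul]
  rw [Measure.volume_eq_prod, integral_prod_mul (fun x => ‖heatKer 0 τ x‖) (fun x => ‖heatKer 0 τ x‖),
    integral_norm_heatKer hτ, one_mul]

theorem integral_planeK_mul {ε : ℝ} (hε : 0 < ε) (R : ℝ × ℝ → ℂ) :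
    ∫ z, planeK ε z * R z = ∫ z, planeK 1 z * R (√ε • z) := by
  have hs : 0 < √ε := Real.sqrt_pos.2 hε
  have h := Measure.integral_comp_smul (volume : Measure (ℝ × ℝ)) (fun z => planeK ε z * R z) √ε
  rw [Module.finrank_prod, Module.finrank_self, one_add_one_eq_two, Real.sq_sqrt hε.le,
    abs_of_pos (inv_pos.2 hε)] at h
  have e (z : ℝ × ℝ) : planeK ε (√ε • z) = (ε : ℂ)⁻¹ * planeK 1 z := by
    have h1 (x : ℝ) : heatKer 0 ε (√ε * x) = (√ε : ℂ)⁻¹ * heatKer 0 1 x := by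
      have := heatKer_scale hs 1 x
      rwa [Real.sq_sqrt hε.le, mul_one] at this
    have h2 : (√ε : ℂ) * √ε = ε := by rw [← Complex.ofReal_mul, Real.mul_self_sqrt hε.le]
    simp only [planeK, Prod.smul_fst, Prod.smul_snd, smul_eq_mul, h1]
    rw [← h2, mul_inv]
    ring
  simp only [e, mul_assoc, integral_const_mul] at h
  rw [Complex.real_smul, Complex.ofReal_inv] at h
  exact (mul_left_cancel₀ (inv_ne_zero (by exact_mod_cast hε.ne')) h).symm

variable {T : ℝ} {u : ℝ → ℂ} {W₀ : L2 (⊤ : Opens (ℝ × ℝ))} {W : ℝ → L2 (⊤ : Opens (ℝ × ℝ))}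

/-- The test curve is the heat kernel run backwards, `r ↦ K_{t-r}(· - y)`. Stopping at `s < t` keeps
it away from its singularity, hence in `H²`. -/
theorem IsPlaneSolution.integral_mul_planeK (h : IsPlaneSolution T u W₀ W) (hT : 0 < T)
    (hu : MemLp u ∞ (volume.restrict (Ioo 0 T))) {s t : ℝ} (hs : 0 < s) (hst : s < t) (ht : t ≤ T)
    (y : ℝ × ℝ) : ∫ x, W s x * planeK (t - s) (x - y) = (∫ x, W 0 x * planeK t (x - y)) -
      2 * ∫ r in (0 : ℝ)..s, u r * planeK (t - r) y := by
  have hpos : ∀ r ∈ Icc 0 s, 0 < t - r := fun r hr => by linarith [hr.2]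
  have key := h.pairing_sub hT hu hs (hst.le.trans ht) (Φ := fun r => planeHeat y (t - r))
    (fun r hr => (ContinuousAt.comp (g := planeHeat y) (continuousAt_planeHeat y (hpos r hr))
      (by fun_prop : ContinuousAt (fun r => t - r) r)).continuousWithinAt)
    (fun r hr => (hasDerivAt_planeHeat y (hpos r hr)).comp_const_sub t r)
  have e (r : ℝ) (hr : r < t) (f : L2 (⊤ : Opens (ℝ × ℝ))) :
      pairing ⊤ f (coord (Sobolev ⊤ 2) 0 0 (by norm_num) (planeHeat y (t - r))) =
      ∫ x, f x * planeK (t - r) (x - y) := by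
    rw [planeHeat, SmoothFamily.coord_elt, pairing_toL2, integral_top]
    simp only [planeKer_eq_planeK (sub_pos.2 hr)]
  rw [e s hst, e 0 (hs.trans hst), sub_zero] at key
  have e2 : ∫ r in (0 : ℝ)..s, u r * delta (planeHeat y (t - r)) =
      ∫ r in (0 : ℝ)..s, u r * planeK (t - r) y := by
    refine intervalIntegral.integral_congr fun r hr => ?_
    rw [uIcc_of_le hs.le] at hr
    rw [delta_planeHeat (hpos r hr), planeK]
  rw [e2] at key
  linear_combination key

variable {p q : ℝ → ℂ}

theorem integral_tensor_planeK (p q : ℝ → ℂ) (τ : ℝ) :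
    ∫ y : ℝ × ℝ, p y.1 * q y.2 * planeK τ y = heatAverage p τ * heatAverage q τ := by
  rw [heatAverage, heatAverage, ← integral_prod_mul, ← Measure.volume_eq_prod]
  congr 1
  ext y
  simp only [planeK]
  ring

theorem intervalIntegral_eq_Ioo {E : Type*} [NormedAddCommGroup E] [NormedSpace ℝ E] {f : ℝ → E}
    {s : ℝ} (hs : 0 ≤ s) : ∫ r in (0 : ℝ)..s, f r = ∫ r in Ioo 0 s, f r := by
  rw [intervalIntegral.integral_of_le hs, integral_Ioc_eq_integral_Ioo]

/-- Duhamel's formula up to time `s < t`, tested with a tensor product. -/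
theorem IsPlaneSolution.integral_corr (h : IsPlaneSolution T u W₀ W) (hT : 0 < T)
    (hu : MemLp u ∞ (volume.restrict (Ioo 0 T))) (hp : MemLp p 2 volume) (hq : MemLp q 2 volume)
    {s t : ℝ} (hs : 0 < s) (hst : s < t) (ht : t ≤ T) :
    ∫ z, planeK (t - s) z * corr (W s) (fun x : ℝ × ℝ => p x.1 * q x.2) z =
      (∫ z, planeK t z * corr (W 0) (fun x : ℝ × ℝ => p x.1 * q x.2) z) -
        2 * ∫ r in (0 : ℝ)..s, u r * (heatAverage p (t - r) * heatAverage q (t - r)) := by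
  set g : ℝ × ℝ → ℂ := fun x => p x.1 * q x.2 with hg
  have hgm : MemLp g 2 volume := memLp_tensor hp hq
  have ht0 : 0 < t := hs.trans hst
  rw [← integral_mul_conv (memLp_top (W s)) hgm (integrable_planeK (sub_pos.2 hst)),
    ← integral_mul_conv (memLp_top (W 0)) hgm (integrable_planeK ht0)]
  have i1 := integrable_mul_conv (memLp_top (W s)) hgm (integrable_planeK (sub_pos.2 hst))
  have i2 := integrable_mul_conv (memLp_top (W 0)) hgm (integrable_planeK ht0)
  have e (y : ℝ × ℝ) := h.integral_mul_planeK hT hu hs hst ht y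
  obtain ⟨C, c, hC, hc, hb⟩ := exists_planeKer_bound (sub_pos.2 hst) (show t - s ≤ t by linarith)
  obtain ⟨M, hM0, hM⟩ := exists_ae_bound_control hu
  -- For `r < s` the kernel times stay in `[t - s, t]`, so one Gaussian product dominates and Fubini
  -- applies.
  have hF : Integrable (Function.uncurry fun (y : ℝ × ℝ) (r : ℝ) => g y * (u r * planeK (t - r) y))
      ((volume : Measure (ℝ × ℝ)).prod (volume.restrict (Ioo 0 s))) := by
    have hfin : IsFiniteMeasure (volume.restrict (Ioo 0 s)) := ⟨by simp⟩
    have hG : Integrable (fun y : ℝ × ℝ => ‖g y‖ *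
        ((C * Real.exp (-c * (y.1 - (0 : ℝ × ℝ).1) ^ 2)) * (C * Real.exp (-c * (y.2 - (0 : ℝ × ℝ).2) ^ 2)))) volume :=
      hgm.norm.integrable_mul (memLp_gaussian_prod hc C 0)
    have hD := hG.mul_prod (integrable_const (μ := volume.restrict (Ioo 0 s)) M)
    refine hD.mono' ?_ ?_
    · have hum : AEStronglyMeasurable u (volume.restrict (Ioo 0 s)) :=
        hu.1.mono_measure (Measure.restrict_mono (Ioo_subset_Ioo_right (hst.le.trans ht)) le_rfl)
      have hk : Measurable fun z : (ℝ × ℝ) × ℝ => planeK (t - z.2) z.1 := by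
        refine Measurable.mul ?_ ?_
        · exact measurable_heatKer_zero.comp (by fun_prop : Measurable fun z : (ℝ × ℝ) × ℝ => (t - z.2, z.1.1))
        · exact measurable_heatKer_zero.comp (by fun_prop : Measurable fun z : (ℝ × ℝ) × ℝ => (t - z.2, z.1.2))
      exact hgm.1.comp_fst.mul ((hum.comp_snd).mul hk.aestronglyMeasurable)
    · have h1 : ∀ᵐ r ∂(volume.restrict (Ioo 0 s)), ‖u r‖ ≤ M ∧ r ∈ Ioo 0 s := by
        filter_upwards [ae_restrict_of_ae hM, ae_restrict_mem measurableSet_Ioo] with r hr hr'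
        exact ⟨hr ⟨hr'.1, hr'.2.trans (hst.trans_le ht)⟩, hr'⟩
      filter_upwards [Measure.quasiMeasurePreserving_snd.ae h1] with z hz
      have h2 := hb 0 0 (t - z.2) ⟨by linarith [hz.2.2], by linarith [hz.2.1]⟩ 0 z.1
      rw [planeKer_eq_planeK (by linarith [hz.2.2]), sub_zero] at h2
      simp only [Function.uncurry, norm_mul]
      calc ‖g z.1‖ * (‖u z.2‖ * ‖planeK (t - z.2) z.1‖) ≤ ‖g z.1‖ * (M * _) := by
            refine mul_le_mul_of_nonneg_left ?_ (norm_nonneg _)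
            exact mul_le_mul hz.1 h2 (norm_nonneg _) hM0
        _ = _ := by ring
  have i3 := hF.integral_prod_left
  have swap := integral_integral_swap hF
  have e3 : ∀ y, ∫ r in Ioo 0 s, g y * (u r * planeK (t - r) y) =
      g y * ∫ r in (0 : ℝ)..s, u r * planeK (t - r) y := fun y => by
    rw [intervalIntegral_eq_Ioo hs.le, integral_const_mul]
  have e4 : ∀ r, ∫ y, g y * (u r * planeK (t - r) y) =
      u r * (heatAverage p (t - r) * heatAverage q (t - r)) := fun r => by
    rw [← integral_tensor_planeK, ← integral_const_mul]
    congr 1; ext y; ring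
  simp only [e3, e4] at swap
  simp only [Function.uncurry, e3] at i3
  rw [intervalIntegral_eq_Ioo hs.le, ← swap, ← integral_const_mul, ← integral_sub i2 (i3.const_mul 2)]
  congr 1
  ext y
  rw [e y]
  ring

theorem corr_sub (f f' g : ℝ × ℝ → ℂ) (hf : MemLp f 2 volume) (hf' : MemLp f' 2 volume)
    (hg : MemLp g 2 volume) (z : ℝ × ℝ) : corr f g z - corr f' g z = corr (f - f') g z := by
  have h1 : Integrable (fun y => f (y + z) * g y) volume := (memLp_translate hf z).integrable_mul hg
  have h2 : Integrable (fun y => f' (y + z) * g y) volume := (memLp_translate hf' z).integrable_mul hg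
  rw [corr, corr, corr, ← integral_sub h1 h2]
  congr 1; ext y
  rw [Pi.sub_apply, sub_mul]

/-- Two effects are separated: for the fixed function `W t` the kernels concentrate at the origin,
and replacing `W t` by `W (s n)` costs at most `‖W (s n) - W t‖ ‖g‖`, since the kernels have
integral one. -/
theorem tendsto_integral_planeK_corr {t : ℝ} {s : ℕ → ℝ} (hW : ContinuousOn W (Icc 0 T))
    (ht : t ∈ Icc 0 T) (hs : ∀ n, s n ∈ Icc 0 T) (hst : ∀ n, s n < t) (hlim : Tendsto s atTop (𝓝 t))
    {g : ℝ × ℝ → ℂ} (hg : MemLp g 2 volume) :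
    Tendsto (fun n => ∫ z, planeK (t - s n) z * corr (W (s n)) g z) atTop (𝓝 (∫ x, W t x * g x)) := by
  have hmem := fun r => memLp_top (W r)
  have l1 : Tendsto (fun n => ∫ z, planeK (t - s n) z * corr (W t) g z) atTop (𝓝 (∫ x, W t x * g x)) := by
    have h0 : Tendsto (fun n => √(t - s n)) atTop (𝓝 0) := by
      simpa using (tendsto_const_nhds.sub hlim).sqrt (x := t - t)
    have := tendsto_integral_approx (integrable_planeK one_pos) (continuous_corr (hmem t) hg)
      (norm_corr_le (hmem t) hg) h0
    rw [integral_planeK one_pos, one_mul, corr_zero] at this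
    refine this.congr fun n => ?_
    rw [integral_planeK_mul (sub_pos.2 (hst n))]
  have hWs : Tendsto (fun n => W (s n)) atTop (𝓝 (W t)) :=
    (hW t ht).tendsto.comp (tendsto_nhdsWithin_iff.2 ⟨hlim, Eventually.of_forall hs⟩)
  have l2 : Tendsto (fun n => ∫ z, planeK (t - s n) z * (corr (W (s n)) g z - corr (W t) g z)) atTop
      (𝓝 0) := by
    have h1 : Tendsto (fun n => ‖W (s n) - W t‖ * lpNorm g 2 volume) atTop (𝓝 0) := by
      have := ((tendsto_iff_norm_sub_tendsto_zero.1 hWs).mul_const (lpNorm g 2 volume))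
      rwa [zero_mul] at this
    refine squeeze_zero_norm (fun n => ?_) h1
    have hb : ∀ z, ‖corr (W (s n)) g z - corr (W t) g z‖ ≤ ‖W (s n) - W t‖ * lpNorm g 2 volume := by
      intro z
      rw [corr_sub _ _ _ (hmem _) (hmem _) hg]
      refine (norm_corr_le ((hmem _).sub (hmem _)) hg z).trans (le_of_eq ?_)
      rw [← lpNorm_top]
      congr 1
      rw [← toReal_eLpNorm ((hmem (s n)).sub (hmem t)).1, ← toReal_eLpNorm (memLp_top (W (s n) - W t)).1,
        eLpNorm_congr_ae (ae_top_iff.1 (Lp.coeFn_sub (W (s n)) (W t)))]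
    have hi := (integrable_planeK (sub_pos.2 (hst n))).norm.mul_const (‖W (s n) - W t‖ * lpNorm g 2 volume)
    refine (norm_integral_le_of_norm_le hi (Eventually.of_forall fun z => ?_)).trans (le_of_eq ?_)
    · rw [norm_mul]
      exact mul_le_mul_of_nonneg_left (hb z) (norm_nonneg _)
    · rw [integral_mul_const, integral_norm_planeK (sub_pos.2 (hst n)), one_mul]
  have l3 := l2.add l1
  rw [zero_add] at l3
  refine l3.congr fun n => ?_
  have hi (r : ℝ) : Integrable (fun z => planeK (t - s n) z * corr (W r) g z) volume :=
    (integrable_planeK (sub_pos.2 (hst n))).mul_bdd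
      (continuous_corr (hmem r) hg).aestronglyMeasurable
      (Eventually.of_forall (norm_corr_le (hmem r) hg))
  have hi2 : Integrable (fun z => planeK (t - s n) z * (corr (W (s n)) g z - corr (W t) g z)) volume :=
    ((hi (s n)).sub (hi t)).congr (Eventually.of_forall fun z => by simp only [Pi.sub_apply, mul_sub])
  rw [← integral_add hi2 (hi t)]
  congr 1; ext z; ring

theorem aestronglyMeasurable_heatAverage (hq : MemLp q 2 volume) {μ : Measure ℝ} [SFinite μ] :
    AEStronglyMeasurable (heatAverage q) μ := by
  have h : AEStronglyMeasurable (fun z : ℝ × ℝ => q z.2 * heatKer 0 z.1 z.2) (μ.prod volume) :=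
    hq.1.comp_snd.mul measurable_heatKer_zero.aestronglyMeasurable
  exact h.integral_prod_right'

/-- Duhamel's formula, tested with a tensor product. -/
theorem IsPlaneSolution.integral_mul_tensor (h : IsPlaneSolution T u W₀ W) (hT : 0 < T)
    (hu : MemLp u ∞ (volume.restrict (Ioo 0 T))) (hp : MemLp p 2 volume) (hq : MemLp q 2 volume)
    {A B : ℝ} (hA : ∀ τ, 0 < τ → ‖heatAverage p τ‖ ≤ A) (hB : ∀ τ, 0 < τ → ‖heatAverage q τ‖ ≤ B)
    {t : ℝ} (ht : t ∈ Ioo 0 T) :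
    ∫ x : ℝ × ℝ, W t x * (p x.1 * q x.2) =
      (∫ z, planeK t z * corr (W 0) (fun x : ℝ × ℝ => p x.1 * q x.2) z) -
        2 * ∫ r in Ioo 0 t, u (t - r) * (heatAverage p r * heatAverage q r) := by
  -- Times in `(0, t)` converging to `t` from below.
  set s : ℕ → ℝ := fun n => t - t / 2 * ((n : ℝ) + 1)⁻¹ with hs
  have hpos : ∀ n : ℕ, 0 < ((n : ℝ) + 1)⁻¹ := fun n => by positivity
  have hle : ∀ n : ℕ, ((n : ℝ) + 1)⁻¹ ≤ 1 := fun n => inv_le_one_of_one_le₀ (by linarith [n.cast_nonneg (α := ℝ)])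
  have ht0 := ht.1
  have hst : ∀ n, s n < t := fun n => by
    have := mul_pos (half_pos ht0) (hpos n)
    simp only [hs]; linarith
  have hs0 : ∀ n, 0 < s n := fun n => by
    have := mul_le_mul_of_nonneg_left (hle n) (half_pos ht0).le
    simp only [hs]; linarith
  have hlim : Tendsto s atTop (𝓝 t) := by
    simpa using (tendsto_inv_nat_succ.const_mul (t / 2)).const_sub t
  have l1 := tendsto_integral_planeK_corr h.continuousOn (Ioo_subset_Icc_self ht)
    (fun n => ⟨(hs0 n).le, (hst n).le.trans ht.2.le⟩) hst hlim (memLp_tensor hp hq)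
  set v : ℝ → ℂ := fun r => u r * (heatAverage p (t - r) * heatAverage q (t - r)) with hv
  -- The uniform bounds on the two heat averages make the Duhamel integrand integrable up to `r =
  -- t`, where the kernel itself is singular.
  have hvi : IntervalIntegrable v volume 0 t := by
    have hut : IntervalIntegrable u volume 0 t := intervalIntegrable_sub (intervalIntegrable_control hT hu)
      left_mem_uIcc (by rw [uIcc_of_le hT.le]; exact Ioo_subset_Icc_self ht)
    rw [intervalIntegrable_iff_integrableOn_Ioo_of_le ht0.le] at hut ⊢
    refine hut.mul_bdd (c := A * B) ?_ ?_
    · have hm : Measure.QuasiMeasurePreserving (fun r : ℝ => t - r) volume volume :=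
        (Measure.measurePreserving_sub_left volume t).quasiMeasurePreserving
      exact (((aestronglyMeasurable_heatAverage hp).comp_quasiMeasurePreserving hm).mul
        ((aestronglyMeasurable_heatAverage hq).comp_quasiMeasurePreserving hm)).mono_measure
        Measure.restrict_le_self
    · filter_upwards [ae_restrict_mem measurableSet_Ioo] with r hr
      rw [norm_mul]
      have hr' : 0 < t - r := sub_pos.2 hr.2
      exact mul_le_mul (hA _ hr') (hB _ hr') (norm_nonneg _) ((norm_nonneg _).trans (hA _ hr'))
  have l2 : Tendsto (fun n => ∫ r in (0 : ℝ)..s n, v r) atTop (𝓝 (∫ r in (0 : ℝ)..t, v r)) := by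
    have hc := intervalIntegral.continuousOn_primitive_interval (f := v) (a := 0) (b := t)
      (by rw [uIcc_of_le ht0.le]; exact (intervalIntegrable_iff_integrableOn_Icc_of_le ht0.le).1 hvi)
    refine (hc t right_mem_uIcc).tendsto.comp (tendsto_nhdsWithin_iff.2 ⟨hlim, Eventually.of_forall fun n => ?_⟩)
    rw [uIcc_of_le ht0.le]
    exact ⟨(hs0 n).le, (hst n).le⟩
  have l3 := (l2.const_mul 2).const_sub
    (∫ z, planeK t z * corr (W 0) (fun x : ℝ × ℝ => p x.1 * q x.2) z)
  have := tendsto_nhds_unique l1 (l3.congr fun n =>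
    (h.integral_corr hT hu hp hq (hs0 n) (hst n) ht.2.le).symm)
  rw [this, ← intervalIntegral_eq_Ioo ht0.le]
  have e := intervalIntegral.integral_comp_sub_left (fun r => v r) t (a := 0) (b := t)
  rw [sub_self, sub_zero] at e
  rw [← e]
  simp only [hv, sub_sub_cancel]

theorem integral_mul_testDeriv₁_of_smooth {f f' : ℝ → ℂ} (hd : ∀ x, HasDerivAt f (f' x) x)
    (hf' : Continuous f') {U : Opens ℝ} (η : 𝓓(U, ℂ)) (k : ℕ) :
    ∫ x, testDeriv₁ (k + 1) η x * f x = -∫ x, testDeriv₁ k η x * f' x := by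
  have hf : Continuous f := continuous_iff_continuousAt.2 fun x => (hd x).continuousAt
  have := integral_mul_deriv_eq_deriv_mul_of_integrable (fun x _ => hd x)
    (fun x _ => hasDerivAt_testDeriv₁ k η x)
    ((hf.mul (testDeriv₁ (k + 1) η).continuous).integrable_of_hasCompactSupport
      (testDeriv₁ (k + 1) η).hasCompactSupport.mul_left)
    ((hf'.mul (testDeriv₁ k η).continuous).integrable_of_hasCompactSupport
      (testDeriv₁ k η).hasCompactSupport.mul_left)
    ((hf.mul (testDeriv₁ k η).continuous).integrable_of_hasCompactSupport
      (testDeriv₁ k η).hasCompactSupport.mul_left)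
  simpa only [mul_comm] using this

theorem integral_testDeriv₁_two_mul_heatKer {τ : ℝ} (hτ : 0 < τ) {U : Opens ℝ} (η : 𝓓(U, ℂ)) (x : ℝ) :
    ∫ y, testDeriv₁ 2 η y * heatKer 0 τ (x - y) = ∫ y, testDeriv₁ 0 η y * heatKer 2 τ (x - y) := by
  rw [integral_mul_testDeriv₁_of_smooth (f' := fun y => -heatKer 1 τ (x - y))
    (fun y => (hasDerivAt_heatKer hτ zero_le_one (x - y)).comp_const_sub x y)
    ((continuous_heatKer 1 τ).comp (by fun_prop)).neg,
    integral_mul_testDeriv₁_of_smooth (f := fun y => -heatKer 1 τ (x - y))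
    (f' := fun y => heatKer 2 τ (x - y))
    (fun y => ((hasDerivAt_heatKer hτ le_rfl (x - y)).comp_const_sub x y).neg.congr_deriv (neg_neg _))
    ((continuous_heatKer 2 τ).comp (by fun_prop)), neg_neg]

/-- Both derivatives pass from `g` to the heat kernel, which is smooth at positive times. Afterwards
only the `L²` norm of `g q` matters, and this is small for a narrow corrector. -/
theorem integral_planeK_mul_corr_deriv {t : ℝ} (ht : 0 < t) {f : ℝ × ℝ → ℂ} (hf : MemLp f 2 volume)
    (g : 𝓓((⊤ : Opens ℝ), ℂ)) (hq : MemLp q 2 volume) :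
    ∫ z, planeK t z * corr f (fun x : ℝ × ℝ => testDeriv₁ 2 g x.1 * q x.2) z =
      ∫ z : ℝ × ℝ, heatKer 2 t z.1 * heatKer 0 t z.2 * corr f (fun x : ℝ × ℝ => g x.1 * q x.2) z := by
  have h1 := memLp_tensor (memLp_testFunction 2 (testDeriv₁ 2 g) volume) hq
  have h2 := memLp_tensor (memLp_testFunction 2 g volume) hq
  rw [← integral_mul_conv' hf h1 (integrable_planeK ht),
    ← integral_mul_conv' hf h2 (integrable_heatKer_prod 2 0 ht)]
  congr 1
  ext x
  congr 1
  have e1 : ∫ y : ℝ × ℝ, testDeriv₁ 2 g y.1 * q y.2 * planeK t (x - y) =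
      (∫ y, testDeriv₁ 2 g y * heatKer 0 t (x.1 - y)) * ∫ y, q y * heatKer 0 t (x.2 - y) := by
    rw [← integral_prod_mul, ← Measure.volume_eq_prod]
    congr 1; ext y
    simp only [planeK, Prod.fst_sub, Prod.snd_sub]; ring
  have e2 : ∫ y : ℝ × ℝ, g y.1 * q y.2 * (heatKer 2 t (x - y).1 * heatKer 0 t (x - y).2) =
      (∫ y, testDeriv₁ 0 g y * heatKer 2 t (x.1 - y)) * ∫ y, q y * heatKer 0 t (x.2 - y) := by
    rw [← integral_prod_mul, ← Measure.volume_eq_prod]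
    congr 1; ext y
    simp only [Prod.fst_sub, Prod.snd_sub]
    change _ = g y.1 * _ * _
    ring
  rw [e1, e2, integral_testDeriv₁_two_mul_heatKer ht]

/-- The contribution of the initial value is bounded by the norm of the test function. -/
theorem exists_norm_initial_le {a b : ℝ} (ha : 0 < a) (hab : a ≤ b) : ∃ C, 0 ≤ C ∧
    ∀ t ∈ Icc a b, ∀ (f : L2 (⊤ : Opens (ℝ × ℝ))) (g : 𝓓((⊤ : Opens ℝ), ℂ)) (q : ℝ → ℂ),
      MemLp q 2 volume →
      ‖∫ z, planeK t z * corr f (fun x : ℝ × ℝ => testDeriv₁ 2 g x.1 * q x.2) z‖ ≤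
        C * (‖f‖ * lpNorm (fun x : ℝ × ℝ => g x.1 * q x.2) 2 volume) := by
  obtain ⟨C, c, hC, hc, hb⟩ := exists_heatKer_bound ha hab
  refine ⟨∫ x : ℝ, C * Real.exp (-c * x ^ 2), integral_nonneg fun x => by positivity,
    fun t ht f g q hq => ?_⟩
  have ht0 : 0 < t := ha.trans_le ht.1
  have hg := memLp_tensor (memLp_testFunction 2 g volume) hq
  set N := ‖f‖ * lpNorm (fun x : ℝ × ℝ => g x.1 * q x.2) 2 volume with hN
  have hN0 : 0 ≤ N := mul_nonneg (norm_nonneg _) lpNorm_nonneg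
  rw [integral_planeK_mul_corr_deriv ht0 (memLp_top f) g hq]
  have hi := (integrable_heatKer_prod 2 0 ht0).norm.mul_const N
  refine (norm_integral_le_of_norm_le hi (Eventually.of_forall fun z => ?_)).trans ?_
  · rw [norm_mul]
    refine mul_le_mul_of_nonneg_left ?_ (norm_nonneg _)
    rw [hN, ← lpNorm_top f]
    exact norm_corr_le (memLp_top f) hg z
  · rw [integral_mul_const]
    refine mul_le_mul_of_nonneg_right ?_ hN0
    simp only [norm_mul]
    rw [Measure.volume_eq_prod, integral_prod_mul (fun x => ‖heatKer 2 t x‖) (fun x => ‖heatKer 0 t x‖),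
      integral_norm_heatKer ht0, mul_one]
    exact integral_mono (integrable_heatKer 2 ht0).norm ((integrable_exp_neg_mul_sq hc).const_mul C)
      fun x => hb 2 t x ht

end DuhamelFormula

/-! ### Heat averages of H¹ functions and their value at the origin -/

section Trace

theorem tendsto_sqrt_nhdsGT_zero : Tendsto (fun α : ℝ => √α) (𝓝[>] 0) (𝓝 0) := by
  have := (Real.continuous_sqrt.tendsto 0).mono_left (nhdsWithin_le_nhds (s := Ioi (0 : ℝ)))
  rwa [Real.sqrt_zero] at this

theorem tendsto_mul_nhdsGT_zero {r : ℝ} (hr : 0 < r) :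
    Tendsto (fun l : ℝ => l * r) (𝓝[>] 0) (𝓝[>] 0) := by
  refine tendsto_nhdsWithin_iff.2 ⟨?_, ?_⟩
  · have := ((continuous_mul_const r).tendsto 0).mono_left (nhdsWithin_le_nhds (s := Ioi (0 : ℝ)))
    rwa [zero_mul] at this
  · filter_upwards [self_mem_nhdsWithin] with l hl using mul_pos hl hr

theorem contDiff_heatReal (τ : ℝ) : ContDiff ℝ ((⊤ : ℕ∞) : WithTop ℕ∞) (heatReal τ) := by
  unfold heatReal
  fun_prop

/-- A smooth function equal to `1` near the origin. -/
def cutoff : ContDiffBump (0 : ℝ) := ⟨1, 2, zero_lt_one, one_lt_two⟩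

/-- The test function `y ↦ χ(c y) k_τ(x - y)`, with `χ` a cutoff function. -/
def cutHeat (τ x c : ℝ) (hc : c ≠ 0) : 𝓓((⊤ : Opens ℝ), ℂ) where
  toFun y := ((cutoff (c * y) : ℝ) : ℂ) * heatKer 0 τ (x - y)
  contDiff' := by
    simp only [heatKer_zero]
    exact (Complex.ofRealCLM.contDiff.comp (cutoff.contDiff.comp (by fun_prop))).mul
      (Complex.ofRealCLM.contDiff.comp ((contDiff_heatReal τ).comp (by fun_prop)))
  hasCompactSupport' := by
    have h : HasCompactSupport fun y : ℝ => ((cutoff (c * y) : ℝ) : ℂ) :=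
      (cutoff.hasCompactSupport.comp_homeomorph (Homeomorph.mulLeft₀ c hc)).comp_left
        (g := fun r : ℝ => (r : ℂ)) rfl
    exact h.mul_right
  tsupport_subset' := subset_univ _

theorem cutHeat_apply (τ x c : ℝ) (hc : c ≠ 0) (y : ℝ) :
    cutHeat τ x c hc y = ((cutoff (c * y) : ℝ) : ℂ) * heatKer 0 τ (x - y) := rfl

theorem testDeriv₁_cutHeat {τ : ℝ} (hτ : 0 < τ) (x c : ℝ) (hc : c ≠ 0) (y : ℝ) :
    testDeriv₁ 1 (cutHeat τ x c hc) y =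
      c * (((deriv cutoff (c * y) : ℝ) : ℂ) * heatKer 0 τ (x - y)) -
        ((cutoff (c * y) : ℝ) : ℂ) * heatKer 1 τ (x - y) := by
  have h1 : HasDerivAt (fun y : ℝ => ((cutoff (c * y) : ℝ) : ℂ))
      ((deriv cutoff (c * y) * c : ℝ) : ℂ) y := by
    have hd : DifferentiableAt ℝ cutoff (c * y) :=
      (cutoff.contDiff (n := 1)).differentiable (by simp) _
    have h0 : HasDerivAt (fun y : ℝ => c * y) c y := by
      simpa using (hasDerivAt_id y).const_mul c
    exact (hd.hasDerivAt.comp y h0).ofReal_comp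
  have h2 : HasDerivAt (fun y : ℝ => heatKer 0 τ (x - y)) (-heatKer 1 τ (x - y)) y :=
    (hasDerivAt_heatKer hτ zero_le_one (x - y)).comp_const_sub x y
  have h3 := hasDerivAt_testDeriv₁ 0 (cutHeat τ x c hc) y
  refine h3.unique ((h1.mul h2).congr_deriv ?_)
  push_cast
  ring

/-- The heat kernel is not a test function, so it is multiplied by a cutoff `χ(c y)`. The term with
`χ'` carries a factor `c` and disappears as `c → 0`. -/
theorem integral_coord₁_mul_heatKer (φ : Space (Sobolev₁ ⊤ 1)) {τ : ℝ} (hτ : 0 < τ) (x : ℝ) :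
    ∫ y, coord₁ (Sobolev₁ ⊤ 1) 0 φ y * heatKer 1 τ (x - y) =
      ∫ y, coord₁ (Sobolev₁ ⊤ 1) 1 φ y * heatKer 0 τ (x - y) := by
  have hm (j : ℕ) : MemLp (fun y => heatKer j τ (x - y)) 2 volume :=
    (memLp_heatKer j hτ).comp_measurePreserving (Measure.measurePreserving_sub_left volume x)
  have hint (k : Fin 2) (j : ℕ) :
      Integrable (fun y => coord₁ (Sobolev₁ ⊤ 1) k φ y * heatKer j τ (x - y)) volume :=
    (memLp_line _).integrable_mul (hm j)
  have hd : Continuous (deriv (cutoff : ℝ → ℝ)) := (cutoff.contDiff (n := 1)).continuous_deriv le_rfl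
  obtain ⟨C, hC⟩ := hd.bounded_above_of_compact_support cutoff.hasCompactSupport.deriv
  have hc0 : Continuous fun z : ℝ => ((cutoff z : ℝ) : ℂ) :=
    Complex.continuous_ofReal.comp cutoff.continuous
  have hc1 : Continuous fun z : ℝ => ((deriv cutoff z : ℝ) : ℂ) := Complex.continuous_ofReal.comp hd
  have hb0 (z : ℝ) : ‖((cutoff z : ℝ) : ℂ)‖ ≤ 1 := by
    rw [Complex.norm_real, Real.norm_eq_abs, abs_of_nonneg cutoff.nonneg]
    exact cutoff.le_one
  have hb1 (z : ℝ) : ‖((deriv cutoff z : ℝ) : ℂ)‖ ≤ C := by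
    rw [Complex.norm_real]; exact hC z
  have hlim := tendsto_inv_nat_succ
  have l1 := tendsto_integral_approx (hint 0 1) hc0 hb0 hlim
  have l2 := tendsto_integral_approx (hint 0 0) hc1 hb1 hlim
  have l3 := tendsto_integral_approx (hint 1 0) hc0 hb0 hlim
  have hcl := (Complex.continuous_ofReal.tendsto 0).comp hlim
  have hone : cutoff (0 : ℝ) = 1 := cutoff.one_of_mem_closedBall (by simp [cutoff])
  rw [hone, Complex.ofReal_one, mul_one] at l1 l3
  have key (n : ℕ) : ((((n : ℝ) + 1)⁻¹ : ℝ) : ℂ) *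
        (∫ y, coord₁ (Sobolev₁ ⊤ 1) 0 φ y * heatKer 0 τ (x - y) *
          ((deriv cutoff (((n : ℝ) + 1)⁻¹ • y) : ℝ) : ℂ)) -
        ∫ y, coord₁ (Sobolev₁ ⊤ 1) 0 φ y * heatKer 1 τ (x - y) *
          ((cutoff (((n : ℝ) + 1)⁻¹ • y) : ℝ) : ℂ) =
      -∫ y, coord₁ (Sobolev₁ ⊤ 1) 1 φ y * heatKer 0 τ (x - y) *
        ((cutoff (((n : ℝ) + 1)⁻¹ • y) : ℝ) : ℂ) := by
    set c : ℝ := ((n : ℝ) + 1)⁻¹ with hcd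
    have hc : c ≠ 0 := by positivity
    have h := φ.2 (1 : Fin 2) (cutHeat τ x c hc)
    rw [integral_top, integral_top] at h
    have i1 : Integrable (fun y => coord₁ (Sobolev₁ ⊤ 1) 0 φ y * heatKer 0 τ (x - y) *
        ((deriv cutoff (c • y) : ℝ) : ℂ)) volume :=
      (hint 0 0).mul_bdd (c := C) (hc1.comp (by fun_prop)).aestronglyMeasurable
        (Eventually.of_forall fun y => hb1 _)
    have i2 : Integrable (fun y => coord₁ (Sobolev₁ ⊤ 1) 0 φ y * heatKer 1 τ (x - y) *
        ((cutoff (c • y) : ℝ) : ℂ)) volume :=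
      (hint 0 1).mul_bdd (c := 1) (hc0.comp (by fun_prop)).aestronglyMeasurable
        (Eventually.of_forall fun y => hb0 _)
    rw [← integral_const_mul, ← integral_sub (i1.const_mul (c : ℂ)) i2]
    have h' : ∫ y, coord₁ (Sobolev₁ ⊤ 1) 0 φ y * testDeriv₁ 1 (cutHeat τ x c hc) y =
        -∫ y, coord₁ (Sobolev₁ ⊤ 1) 1 φ y * cutHeat τ x c hc y := by
      refine h.trans ?_
      change (-1) ^ 1 * _ = _
      rw [pow_one, neg_one_mul]
      rfl
    refine Eq.trans ?_ (h'.trans (congrArg Neg.neg ?_))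
    · congr 1
      ext y
      rw [testDeriv₁_cutHeat hτ, smul_eq_mul]
      ring
    · congr 1
      ext y
      rw [cutHeat_apply, smul_eq_mul]
      ring
  have hL := ((hcl.mul l2).sub l1)
  rw [Complex.ofReal_zero, zero_mul, zero_sub] at hL
  exact neg_injective (tendsto_nhds_unique (hL.congr key) l3.neg)

/-- The continuous representative of an element of `H¹(ℝ)`, reflected. -/
def reflRep (φ : Space (Sobolev₁ ⊤ 1)) (z : ℝ) : ℂ :=
  corr expRay (fun x => coord₁ (Sobolev₁ ⊤ 1) 0 φ x + coord₁ (Sobolev₁ ⊤ 1) 1 φ x) z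

theorem memLp_coord₁_add (φ : Space (Sobolev₁ ⊤ 1)) :
    MemLp (fun x => coord₁ (Sobolev₁ ⊤ 1) 0 φ x + coord₁ (Sobolev₁ ⊤ 1) 1 φ x) 2 volume :=
  (memLp_line _).add (memLp_line _)

theorem continuous_reflRep (φ : Space (Sobolev₁ ⊤ 1)) : Continuous (reflRep φ) :=
  continuous_corr memLp_expRay (memLp_coord₁_add φ)

theorem exists_norm_reflRep_le (φ : Space (Sobolev₁ ⊤ 1)) : ∃ D, ∀ z, ‖reflRep φ z‖ ≤ D :=
  ⟨_, norm_corr_le memLp_expRay (memLp_coord₁_add φ)⟩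

theorem reflRep_zero (φ : Space (Sobolev₁ ⊤ 1)) : reflRep φ 0 = delta₁ φ := by
  have e : delta₁ φ = pairing ⊤ ((memLp_expRay.mono_measure Measure.restrict_le_self).toLp expRay)
      (coord₁ (Sobolev₁ ⊤ 1) 0 φ + coord₁ (Sobolev₁ ⊤ 1) 1 φ) := rfl
  rw [e, pairing_apply, integral_top, reflRep, corr_zero]
  refine integral_congr_ae ?_
  filter_upwards [ae_top_iff.1 (Lp.coeFn_add (coord₁ (Sobolev₁ ⊤ 1) 0 φ) (coord₁ (Sobolev₁ ⊤ 1) 1 φ)),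
    ae_top_iff.1 (MemLp.coeFn_toLp (memLp_expRay.mono_measure Measure.restrict_le_self))] with x h0 h1
  rw [h0, h1, Pi.add_apply]

/-- The heat kernel is written as an integral of `e^x (k + k')` over a ray and the derivative is
moved onto `φ`. This replaces the `L²` class of `φ` by its reflected continuous representative,
whose value at `0` is `delta₁ φ`. -/
theorem heatAverage_coord₁ (φ : Space (Sobolev₁ ⊤ 1)) {τ : ℝ} (hτ : 0 < τ) :
    heatAverage (coord₁ (Sobolev₁ ⊤ 1) 0 φ) τ = ∫ z, heatKer 0 τ z * reflRep φ z := by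
  have hm (x : ℝ) (j : ℕ) : MemLp (fun y => heatKer j τ (x - y)) 2 volume :=
    (memLp_heatKer j hτ).comp_measurePreserving (Measure.measurePreserving_sub_left volume x)
  have hint (x : ℝ) (k : Fin 2) (j : ℕ) :
      Integrable (fun y => coord₁ (Sobolev₁ ⊤ 1) k φ y * heatKer j τ (x - y)) volume :=
    (memLp_line _).integrable_mul (hm x j)
  have hK : Integrable (fun z => heatKer 0 τ z + heatKer 1 τ z) volume :=
    (integrable_heatKer 0 hτ).add (integrable_heatKer 1 hτ)
  have h1 := integral_mul_conv memLp_expRay (memLp_line (coord₁ (Sobolev₁ ⊤ 1) 0 φ)) hK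
  have h2 := integral_mul_conv' memLp_expRay (memLp_line (coord₁ (Sobolev₁ ⊤ 1) 0 φ)) hK
  have h3 := integral_mul_conv' memLp_expRay (memLp_coord₁_add φ) (integrable_heatKer 0 hτ)
  simp only [integral_expRay_heatKer hτ] at h1
  rw [heatAverage, h1, ← h2]
  unfold reflRep
  rw [← h3]
  congr 1
  ext x
  have a1 : ∫ y, coord₁ (Sobolev₁ ⊤ 1) 0 φ y * (heatKer 0 τ (x - y) + heatKer 1 τ (x - y)) =
      (∫ y, coord₁ (Sobolev₁ ⊤ 1) 0 φ y * heatKer 0 τ (x - y)) +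
        ∫ y, coord₁ (Sobolev₁ ⊤ 1) 0 φ y * heatKer 1 τ (x - y) := by
    rw [← integral_add (hint x 0 0) (hint x 0 1)]
    simp only [mul_add]
  have a2 : ∫ y, (coord₁ (Sobolev₁ ⊤ 1) 0 φ y + coord₁ (Sobolev₁ ⊤ 1) 1 φ y) * heatKer 0 τ (x - y) =
      (∫ y, coord₁ (Sobolev₁ ⊤ 1) 0 φ y * heatKer 0 τ (x - y)) +
        ∫ y, coord₁ (Sobolev₁ ⊤ 1) 1 φ y * heatKer 0 τ (x - y) := by
    rw [← integral_add (hint x 0 0) (hint x 1 0)]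
    simp only [add_mul]
  rw [a1, a2, integral_coord₁_mul_heatKer φ hτ]

theorem norm_integral_heatKer_mul_le {R : ℝ → ℂ} {C : ℝ} (hC : ∀ z, ‖R z‖ ≤ C) {τ : ℝ} (hτ : 0 < τ) :
    ‖∫ z, heatKer 0 τ z * R z‖ ≤ C := by
  have h := norm_integral_le_of_norm_le ((integrable_heatKer 0 hτ).norm.mul_const C)
    (f := fun z => heatKer 0 τ z * R z) (Eventually.of_forall fun z => by
      rw [norm_mul]
      exact mul_le_mul_of_nonneg_left (hC z) (norm_nonneg _))
  rwa [integral_mul_const, integral_norm_heatKer hτ, one_mul] at h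

theorem integral_heatKer_sq_mul {l : ℝ} (hl : 0 < l) (τ : ℝ) (R : ℝ → ℂ) :
    ∫ z, heatKer 0 (l ^ 2 * τ) z * R z = ∫ z, heatKer 0 τ z * R (l • z) := by
  have h := Measure.integral_comp_mul_left (fun z => heatKer 0 (l ^ 2 * τ) z * R z) l
  simp only [heatKer_scale hl, mul_assoc, integral_const_mul] at h
  rw [abs_of_pos (inv_pos.2 hl), Complex.real_smul, Complex.ofReal_inv] at h
  exact (mul_left_cancel₀ (inv_ne_zero (Complex.ofReal_ne_zero.2 hl.ne')) h).symm

theorem tendsto_integral_heatKer_mul {R : ℝ → ℂ} (hR : Continuous R) {C : ℝ} (hC : ∀ z, ‖R z‖ ≤ C) :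
    Tendsto (fun τ => ∫ z, heatKer 0 τ z * R z) (𝓝[>] 0) (𝓝 (R 0)) := by
  have h := tendsto_integral_approx (integrable_heatKer 0 zero_lt_one) hR hC tendsto_sqrt_nhdsGT_zero
  rw [integral_heatKer zero_lt_one, one_mul] at h
  refine h.congr' ?_
  filter_upwards [self_mem_nhdsWithin] with τ hτ
  rw [← integral_heatKer_sq_mul (Real.sqrt_pos.2 hτ), Real.sq_sqrt (le_of_lt hτ), mul_one]

theorem exists_norm_heatAverage_coord₁_le (φ : Space (Sobolev₁ ⊤ 1)) :
    ∃ D, 0 ≤ D ∧ ∀ τ, 0 < τ → ‖heatAverage (coord₁ (Sobolev₁ ⊤ 1) 0 φ) τ‖ ≤ D := by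
  obtain ⟨D, hD⟩ := exists_norm_reflRep_le φ
  refine ⟨D, (norm_nonneg _).trans (hD 0), fun τ hτ => ?_⟩
  rw [heatAverage_coord₁ φ hτ]
  exact norm_integral_heatKer_mul_le hD hτ

theorem tendsto_heatAverage_coord₁ (φ : Space (Sobolev₁ ⊤ 1)) :
    Tendsto (heatAverage (coord₁ (Sobolev₁ ⊤ 1) 0 φ)) (𝓝[>] 0) (𝓝 (delta₁ φ)) := by
  obtain ⟨D, hD⟩ := exists_norm_reflRep_le φ
  rw [← reflRep_zero]
  refine (tendsto_integral_heatKer_mul (continuous_reflRep φ) hD).congr' ?_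
  filter_upwards [self_mem_nhdsWithin] with τ hτ
  rw [heatAverage_coord₁ φ hτ]

end Trace

/-! ### Heat averages of test functions and their integral in time -/

section HeatTest

variable (g : 𝓓((⊤ : Opens ℝ), ℂ))

theorem heatAverage_comm (q : ℝ → ℂ) (τ : ℝ) : heatAverage q τ = ∫ x, heatKer 0 τ x * q x := by
  simp only [heatAverage, mul_comm]

theorem heatAverage_testDeriv₁_two {τ : ℝ} (hτ : 0 < τ) :
    heatAverage (testDeriv₁ 2 g) τ = ∫ x, g x * heatKer 2 τ x := by
  have h := integral_testDeriv₁_two_mul_heatKer hτ g 0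
  simp only [zero_sub, heatKer_zero_neg, heatKer_two_neg] at h
  exact h

theorem exists_norm_heatAverage_test_le :
    ∃ A, 0 ≤ A ∧ ∀ τ, 0 < τ → ‖heatAverage g τ‖ ≤ A := by
  obtain ⟨A, hA⟩ := g.continuous.bounded_above_of_compact_support g.hasCompactSupport
  refine ⟨A, (norm_nonneg _).trans (hA 0), fun τ hτ => ?_⟩
  rw [heatAverage_comm]
  exact norm_integral_heatKer_mul_le hA hτ

/-- The time derivative of the kernel is its second space derivative, which two integrations by
parts return to `g`. -/
theorem hasDerivAt_heatAverage {τ : ℝ} (hτ : 0 < τ) :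
    HasDerivAt (heatAverage g) (heatAverage (testDeriv₁ 2 g) τ) τ := by
  rw [heatAverage_testDeriv₁_two g hτ]
  obtain ⟨C, c, hC, hc, h⟩ := exists_heatKer_bound (half_pos hτ) (by linarith : τ / 2 ≤ 2 * τ)
  have hb (σ x : ℝ) (hσ : σ ∈ Icc (τ / 2) (2 * τ)) : ‖heatKer 2 σ x‖ ≤ C :=
    (h 2 σ x hσ).trans (mul_le_of_le_one_right hC (Real.exp_le_one_iff.2 (by nlinarith [sq_nonneg x])))
  have hi : Integrable g volume := g.continuous.integrable_of_hasCompactSupport g.hasCompactSupport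
  refine (hasDerivAt_integral_of_dominated_loc_of_deriv_le (F := fun σ x => g x * heatKer 0 σ x)
    (F' := fun σ x => g x * heatKer 2 σ x) (bound := fun x => ‖g x‖ * C)
    (s := Icc (τ / 2) (2 * τ)) (Icc_mem_nhds (by linarith) (by linarith))
    (Eventually.of_forall fun σ => (g.continuous.mul (continuous_heatKer 0 σ)).aestronglyMeasurable)
    ((g.continuous.mul (continuous_heatKer 0 τ)).integrable_of_hasCompactSupport
      g.hasCompactSupport.mul_right)
    (g.continuous.mul (continuous_heatKer 2 τ)).aestronglyMeasurable
    (Eventually.of_forall fun x σ hσ => ?_) (hi.norm.mul_const C)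
    (Eventually.of_forall fun x σ hσ => ?_)).2
  · rw [norm_mul]
    exact mul_le_mul_of_nonneg_left (hb σ x hσ) (norm_nonneg _)
  · exact (hasDerivAt_heatKer_time (by linarith [hσ.1] : 0 < σ) x).const_mul (g x)

theorem tendsto_heatAverage_test_zero : Tendsto (heatAverage g) (𝓝[>] 0) (𝓝 (g 0)) := by
  obtain ⟨A, hA⟩ := g.continuous.bounded_above_of_compact_support g.hasCompactSupport
  exact (tendsto_integral_heatKer_mul g.continuous hA).congr fun τ => (heatAverage_comm g τ).symm

theorem norm_integral_test_mul_le {K : ℝ → ℂ} {C : ℝ} (hK : ∀ x, ‖K x‖ ≤ C) :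
    ‖∫ x, g x * K x‖ ≤ (∫ x, ‖g x‖) * C := by
  have hi : Integrable g volume := g.continuous.integrable_of_hasCompactSupport g.hasCompactSupport
  rw [← integral_mul_const]
  refine norm_integral_le_of_norm_le (hi.norm.mul_const C) (Eventually.of_forall fun x => ?_)
  rw [norm_mul]
  exact mul_le_mul_of_nonneg_left (hK x) (norm_nonneg _)

theorem tendsto_heatAverage_test_atTop : Tendsto (heatAverage g) atTop (𝓝 0) := by
  have h : Tendsto (fun τ : ℝ => (∫ x, ‖g x‖) * (√τ)⁻¹) atTop (𝓝 0) := by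
    simpa using (tendsto_inv_atTop_zero.comp Real.tendsto_sqrt_atTop).const_mul (∫ x, ‖g x‖)
  refine squeeze_zero_norm' ?_ h
  filter_upwards [eventually_gt_atTop 0] with τ hτ
  exact norm_integral_test_mul_le g fun x => norm_heatKer_zero_le hτ x

/-- The average is bounded for small times because `g''` is bounded. For large times the derivatives
are put on the kernel, whose decay `τ^(-3/2)` is integrable. -/
theorem integrableOn_heatAverage_testDeriv₁_two :
    IntegrableOn (heatAverage (testDeriv₁ 2 g)) (Ioi 0) := by
  obtain ⟨A, hA0, hA⟩ := exists_norm_heatAverage_test_le (testDeriv₁ 2 g)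
  have hm (s : Set ℝ) : AEStronglyMeasurable (heatAverage (testDeriv₁ 2 g)) (volume.restrict s) :=
    aestronglyMeasurable_heatAverage (memLp_testFunction 2 (testDeriv₁ 2 g) volume)
  rw [← Ioc_union_Ioi_eq_Ioi (zero_le_one (α := ℝ))]
  refine IntegrableOn.union ?_ ?_
  · refine Measure.integrableOn_of_bounded (M := A) (by simp) (hm univ |>.mono_measure (by simp)) ?_
    filter_upwards [ae_restrict_mem measurableSet_Ioc] with τ hτ using hA τ hτ.1
  · have hi := ((integrableOn_Ioi_rpow_of_lt (a := -(3 / 2)) (by norm_num) zero_lt_one).const_mul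
      ((∫ x, ‖g x‖) * 2))
    refine Integrable.mono' hi (hm _) ?_
    filter_upwards [ae_restrict_mem measurableSet_Ioi] with τ hτ
    have h0 : 0 < τ := zero_lt_one.trans hτ
    rw [heatAverage_testDeriv₁_two g h0]
    refine (norm_integral_test_mul_le g fun x => norm_heatKer_two_le h0 x).trans (le_of_eq ?_)
    have e : τ ^ (-(3 / 2) : ℝ) = τ⁻¹ * (√τ)⁻¹ := by
      rw [show (-(3 / 2) : ℝ) = -1 + -(1 / 2) by norm_num, Real.rpow_add h0, Real.rpow_neg_one,
        Real.rpow_neg h0.le, ← Real.sqrt_eq_rpow]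
    rw [e]
    ring

/-- The integrand is the derivative of the heat average of `g`, which runs from `g 0` at time `0⁺`
to `0` at infinity. -/
theorem integral_heatAverage_testDeriv₁_two :
    ∫ τ in Ioi 0, heatAverage (testDeriv₁ 2 g) τ = -g 0 := by
  -- At `τ = 0` the formula for the kernel gives `0`, so the value `g 0` has to be prescribed for
  -- continuity.
  set F : ℝ → ℂ := fun τ => if τ ≤ 0 then g 0 else heatAverage g τ with hF
  have hp {τ : ℝ} (hτ : 0 < τ) : F τ = heatAverage g τ := if_neg (not_le.2 hτ)
  have h0 : F 0 = g 0 := if_pos le_rfl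
  have h := integral_Ioi_of_hasDerivAt_of_tendsto (f := F) (a := 0) (m := 0) ?_ (fun τ hτ => ?_)
    (integrableOn_heatAverage_testDeriv₁_two g) ?_
  · rw [h, h0, zero_sub]
  · rw [continuousWithinAt_Ioi_iff_Ici.symm, ContinuousWithinAt, h0]
    refine (tendsto_heatAverage_test_zero g).congr' ?_
    filter_upwards [self_mem_nhdsWithin] with τ hτ using (hp hτ).symm
  · refine (hasDerivAt_heatAverage g hτ).congr_of_eventuallyEq ?_
    filter_upwards [lt_mem_nhds hτ] with σ hσ using hp hσ
  · refine (tendsto_heatAverage_test_atTop g).congr' ?_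
    filter_upwards [eventually_gt_atTop 0] with τ hτ using (hp hτ).symm

/-- Parabolic scaling: the averages of `h` at time `l² σ` and of `g` at time `σ` agree, and this
identity is differentiated in `σ`. -/
theorem heatAverage_testDeriv₁_two_scale {g h : 𝓓((⊤ : Opens ℝ), ℂ)} {l : ℝ} (hl : 0 < l)
    (hg : ∀ x, h (l * x) = g x) {τ : ℝ} (hτ : 0 < τ) :
    (l : ℂ) ^ 2 * heatAverage (testDeriv₁ 2 h) (l ^ 2 * τ) = heatAverage (testDeriv₁ 2 g) τ := by
  have e (σ : ℝ) : heatAverage h (l ^ 2 * σ) = heatAverage g σ := by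
    rw [heatAverage_comm, integral_heatKer_sq_mul hl, heatAverage_comm]
    simp only [smul_eq_mul, hg]
  have h1 : HasDerivAt (fun σ : ℝ => l ^ 2 * σ) (l ^ 2) τ := by
    simpa using (hasDerivAt_id τ).const_mul (l ^ 2)
  have h2 := (hasDerivAt_heatAverage h (τ := l ^ 2 * τ) (by positivity)).scomp τ h1
  have h3 := h2.congr_of_eventuallyEq (f₁ := heatAverage g) (Eventually.of_forall fun σ => (e σ).symm)
  have h4 := h3.unique (hasDerivAt_heatAverage g hτ)
  rw [← h4, Complex.real_smul, Complex.ofReal_pow]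

end HeatTest

/-! ### Averages at Lebesgue points -/

section Lebesgue

/-- Averages of a bounded function against dilates of an integrable kernel, at a Lebesgue point. -/
theorem tendsto_integral_norm_dilate_sub {v n : ℝ → ℂ} {c : ℂ} {M P : ℝ}
    (hv : StronglyMeasurable v) (hM : ∀ r, ‖v r‖ ≤ M)
    (hc : Tendsto (fun l : ℝ => l⁻¹ * ∫ r in Ioc 0 l, ‖v r - c‖) (𝓝[>] 0) (𝓝 0))
    (hn : IntegrableOn n (Ioi 0)) (hP : ∀ r, 0 < r → ‖n r‖ ≤ P) :
    Tendsto (fun l : ℝ => ∫ r in Ioi 0, ‖v (l * r) - c‖ * ‖n r‖) (𝓝[>] 0) (𝓝 0) := by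
  have hM0 : 0 ≤ M + ‖c‖ := add_nonneg ((norm_nonneg _).trans (hM 0)) (norm_nonneg c)
  have hb (r : ℝ) : ‖v r - c‖ ≤ M + ‖c‖ := (norm_sub_le _ _).trans (add_le_add_left (hM r) _)
  have hm (l : ℝ) : Measurable fun r => ‖v (l * r) - c‖ :=
    (((hv.comp_measurable (measurable_const_mul l)).sub stronglyMeasurable_const).norm).measurable
  have hi (l : ℝ) : IntegrableOn (fun r => ‖v (l * r) - c‖ * ‖n r‖) (Ioi 0) :=
    hn.norm.bdd_mul (c := M + ‖c‖) (hm l).aestronglyMeasurable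
      (Eventually.of_forall fun r => by rw [norm_norm]; exact hb _)
  have htail : Tendsto (fun R : ℝ => ∫ r in Ioi R, ‖n r‖) atTop (𝓝 0) := by
    have h := tendsto_setIntegral_of_antitone (f := fun r => ‖n r‖) (s := fun R : ℝ => Ioi R)
      (μ := volume) (fun R => measurableSet_Ioi) (fun a b hab => Ioi_subset_Ioi hab) ⟨0, hn.norm⟩
    have e : ⋂ R : ℝ, Ioi R = ∅ := eq_empty_of_forall_notMem fun x hx => lt_irrefl x (mem_iInter.1 hx x)
    rwa [e, setIntegral_empty] at h
  -- Splitting at `R`: the near part is a Lebesgue mean over `(0, l R]`, weighted by the bound on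
  -- `n`; the far part is controlled by the tail of `n`. Then `R` is fixed first, and `l` tends to
  -- zero.
  have hle (l R : ℝ) (hl : 0 < l) (hR : 0 < R) : ∫ r in Ioi 0, ‖v (l * r) - c‖ * ‖n r‖ ≤
      P * R * ((l * R)⁻¹ * ∫ r in Ioc 0 (l * R), ‖v r - c‖) + (M + ‖c‖) * ∫ r in Ioi R, ‖n r‖ := by
    have h1 := hi l
    rw [← Ioc_union_Ioi_eq_Ioi hR.le] at h1 ⊢
    rw [setIntegral_union (Ioc_disjoint_Ioi le_rfl) measurableSet_Ioi h1.left_of_union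
      h1.right_of_union]
    refine add_le_add ?_ ?_
    · have hbd : IntegrableOn (fun r => ‖v (l * r) - c‖) (Ioc 0 R) :=
        Measure.integrableOn_of_bounded (M := M + ‖c‖) (by simp) (hm l).aestronglyMeasurable
          (Eventually.of_forall fun r => by rw [norm_norm]; exact hb _)
      have e1 : ∫ r in Ioc 0 R, ‖v (l * r) - c‖ = l⁻¹ * ∫ r in Ioc 0 (l * R), ‖v r - c‖ := by
        rw [← intervalIntegral.integral_of_le hR.le, ← intervalIntegral.integral_of_le (by positivity),
          intervalIntegral.integral_comp_mul_left (fun r => ‖v r - c‖) hl.ne', mul_zero, smul_eq_mul]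
      calc _ ≤ ∫ r in Ioc 0 R, ‖v (l * r) - c‖ * P :=
            setIntegral_mono_on h1.left_of_union (hbd.mul_const P) measurableSet_Ioc fun r hr =>
              mul_le_mul_of_nonneg_left (hP r hr.1) (norm_nonneg _)
        _ = _ := by
            rw [integral_mul_const, e1]
            field_simp
    · rw [← integral_const_mul]
      exact setIntegral_mono_on h1.right_of_union ((hn.mono_set (Ioi_subset_Ioi hR.le)).norm.const_mul _)
        measurableSet_Ioi fun r _ => mul_le_mul_of_nonneg_right (hb _) (norm_nonneg _)
  refine Metric.tendsto_nhds.2 fun ε hε => ?_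
  have ht2 := htail.const_mul (M + ‖c‖)
  rw [mul_zero] at ht2
  obtain ⟨R, hR1, hR0⟩ := ((ht2.eventually_lt_const (half_pos hε)).and (eventually_gt_atTop 0)).exists
  have h3 := (hc.comp (tendsto_mul_nhdsGT_zero hR0)).const_mul (P * R)
  rw [mul_zero] at h3
  filter_upwards [h3.eventually_lt_const (half_pos hε), self_mem_nhdsWithin] with l h4 hl
  have h5 : 0 ≤ ∫ r in Ioi 0, ‖v (l * r) - c‖ * ‖n r‖ :=
    integral_nonneg fun r => mul_nonneg (norm_nonneg _) (norm_nonneg _)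
  rw [Real.dist_eq, sub_zero, abs_of_nonneg h5]
  have h6 := hle l R hl hR0
  simp only [Function.comp_apply] at h4
  linarith

/-- Almost every point is a Lebesgue point from the left. -/
theorem ae_tendsto_average_left {f : ℝ → ℂ} (hf : LocallyIntegrable f volume) :
    ∀ᵐ t, Tendsto (fun l : ℝ => l⁻¹ * ∫ r in Ioc 0 l, ‖f (t - r) - f t‖) (𝓝[>] 0) (𝓝 0) := by
  filter_upwards [IsUnifLocDoublingMeasure.ae_tendsto_average_norm_sub volume hf 1] with t ht
  -- The factor `2` compares the one-sided interval of length `l` with the ball of length `2 l`.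
  have h := (ht (fun _ : ℝ => t) (fun l : ℝ => l) (l := 𝓝[>] 0) tendsto_id (by
    filter_upwards [self_mem_nhdsWithin] with l hl
    exact Metric.mem_closedBall_self (by rw [one_mul]; exact le_of_lt hl))).const_mul 2
  rw [mul_zero] at h
  refine squeeze_zero' ?_ ?_ h
  · filter_upwards [self_mem_nhdsWithin] with l hl
    exact mul_nonneg (inv_nonneg.2 (le_of_lt hl)) (integral_nonneg fun r => norm_nonneg _)
  · filter_upwards [self_mem_nhdsWithin] with l hl
    have hl0 : (0 : ℝ) < l := hl
    have e : ∫ r in Ioc 0 l, ‖f (t - r) - f t‖ = ∫ r in Ioc (t - l) t, ‖f r - f t‖ := by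
      rw [← intervalIntegral.integral_of_le hl0.le, ← intervalIntegral.integral_of_le (by linarith),
        intervalIntegral.integral_comp_sub_left (fun r => ‖f r - f t‖), sub_zero]
    have hi : IntegrableOn (fun r => ‖f r - f t‖) (Metric.closedBall t l) :=
      (((hf.integrableOn_isCompact (isCompact_closedBall t l)).sub
        ((locallyIntegrable_const (f t)).integrableOn_isCompact (isCompact_closedBall t l))).norm)
    have h1 : ∫ r in Ioc (t - l) t, ‖f r - f t‖ ≤ ∫ r in Metric.closedBall t l, ‖f r - f t‖ :=
      setIntegral_mono_set hi (Eventually.of_forall fun r => norm_nonneg _)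
        (Eventually.of_forall fun r hr => by
          rw [Real.closedBall_eq_Icc]; exact ⟨hr.1.le, hr.2.trans (by linarith)⟩)
    rw [setAverage_eq, e, Real.closedBall_eq_Icc, Real.volume_real_Icc_of_le (by linarith), smul_eq_mul,
      ← Real.closedBall_eq_Icc, show t + l - (t - l) = 2 * l by ring, mul_inv]
    calc _ ≤ l⁻¹ * _ := mul_le_mul_of_nonneg_left h1 (inv_nonneg.2 hl0.le)
      _ = _ := by ring

end Lebesgue

/-! ### The boundary flux of a plane solution -/

section Flux

variable {T : ℝ} {u v : ℝ → ℂ} {W₀ : L2 (⊤ : Opens (ℝ × ℝ))} {W : ℝ → L2 (⊤ : Opens (ℝ × ℝ))}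

/-- `v` is a bounded representative on the line of the control `u` on `(0, T)`. -/
structure IsBoundedRep (T : ℝ) (u v : ℝ → ℂ) (M : ℝ) : Prop where
  stronglyMeasurable : StronglyMeasurable v
  norm_le : ∀ r, ‖v r‖ ≤ M
  eq_zero : ∀ r, r ∉ Ioo 0 T → v r = 0
  ae_eq : ∀ᵐ r, r ∈ Ioo 0 T → v r = u r

/-- Truncating a measurable version makes the bound hold everywhere. Setting it to zero off `(0, T)`
lets the Duhamel integral run over the whole ray, where the kernel scales. -/
theorem exists_isBoundedRep (hu : MemLp u ∞ (volume.restrict (Ioo 0 T))) :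
    ∃ v M, IsBoundedRep T u v M := by
  obtain ⟨M, hM0, hM⟩ := exists_ae_bound_control hu
  set u' := hu.1.mk u with hu'
  have hm : StronglyMeasurable u' := hu.1.stronglyMeasurable_mk
  have hS : MeasurableSet (Ioo 0 T ∩ {r | ‖u' r‖ ≤ M}) :=
    measurableSet_Ioo.inter (measurableSet_le hm.norm.measurable measurable_const)
  refine ⟨(Ioo 0 T ∩ {r | ‖u' r‖ ≤ M}).indicator u', M, hm.indicator hS, fun r => ?_, fun r hr => ?_, ?_⟩
  · by_cases h : r ∈ Ioo 0 T ∩ {r | ‖u' r‖ ≤ M}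
    · rw [indicator_of_mem h]; exact h.2
    · rw [indicator_of_notMem h, norm_zero]; exact hM0
  · exact indicator_of_notMem (fun h => hr h.1) _
  · filter_upwards [hM, (ae_restrict_iff' measurableSet_Ioo).1 hu.1.ae_eq_mk] with r h1 h2 hr
    rw [indicator_of_mem, hu', h2 hr]
    refine ⟨hr, ?_⟩
    change ‖u' r‖ ≤ M
    rw [hu', ← h2 hr]
    exact h1 hr

theorem IsBoundedRep.locallyIntegrable {M : ℝ} (h : IsBoundedRep T u v M) : LocallyIntegrable v volume :=
  (memLp_top_of_bound h.stronglyMeasurable.aestronglyMeasurable M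
    (Eventually.of_forall h.norm_le)).locallyIntegrable le_top

theorem aestronglyMeasurable_heatAverage_comp_mul {q : ℝ → ℂ} (hq : MemLp q 2 volume) (l : ℝ)
    (s : Set ℝ) : AEStronglyMeasurable (fun r => heatAverage q (l * r)) (volume.restrict s) :=
  (aestronglyMeasurable_heatAverage hq).comp_aemeasurable (measurable_const_mul l).aemeasurable

/-- Replacing `v (l r)` by the constant `c` costs nothing in the limit at a Lebesgue point, even
with the bounded factor `b`. What is left converges by dominated convergence with majorant `D ‖n‖`.
-/
theorem tendsto_integral_dilate_mul {v n b : ℝ → ℂ} {c β : ℂ} {M P D : ℝ}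
    (hv : StronglyMeasurable v) (hM : ∀ r, ‖v r‖ ≤ M)
    (hc : Tendsto (fun l : ℝ => l⁻¹ * ∫ r in Ioc 0 l, ‖v r - c‖) (𝓝[>] 0) (𝓝 0))
    (hn : IntegrableOn n (Ioi 0)) (hP : ∀ r, 0 < r → ‖n r‖ ≤ P) (hD : ∀ r, 0 < r → ‖b r‖ ≤ D)
    (hb : ∀ l, AEStronglyMeasurable (fun r => b (l * r)) (volume.restrict (Ioi 0)))
    (hlim : Tendsto b (𝓝[>] 0) (𝓝 β)) :
    Tendsto (fun l : ℝ => ∫ r in Ioi 0, v (l * r) * (n r * b (l * r))) (𝓝[>] 0)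
      (𝓝 (c * ((∫ r in Ioi 0, n r) * β))) := by
  have hbd (l : ℝ) (hl : 0 < l) : ∀ᵐ r ∂(volume.restrict (Ioi 0)), ‖b (l * r)‖ ≤ D := by
    filter_upwards [ae_restrict_mem measurableSet_Ioi] with r hr using hD _ (mul_pos hl hr)
  have hi (l : ℝ) (hl : 0 < l) : IntegrableOn (fun r => n r * b (l * r)) (Ioi 0) :=
    hn.mul_bdd (c := D) (hb l) (hbd l hl)
  have hm (l : ℝ) : AEStronglyMeasurable (fun r => v (l * r)) (volume.restrict (Ioi 0)) :=
    (hv.comp_measurable (measurable_const_mul l)).aestronglyMeasurable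
  have l1 : Tendsto (fun l : ℝ => ∫ r in Ioi 0, n r * b (l * r)) (𝓝[>] 0)
      (𝓝 ((∫ r in Ioi 0, n r) * β)) := by
    rw [← integral_mul_const]
    refine tendsto_integral_filter_of_dominated_convergence (fun r => ‖n r‖ * D) ?_ ?_
      (hn.norm.mul_const D) ?_
    · exact Eventually.of_forall fun l => hn.1.mul (hb l)
    · filter_upwards [self_mem_nhdsWithin] with l hl
      filter_upwards [hbd l hl] with r hr
      rw [norm_mul]
      exact mul_le_mul_of_nonneg_left hr (norm_nonneg _)
    · filter_upwards [ae_restrict_mem measurableSet_Ioi] with r hr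
      exact (hlim.comp (tendsto_mul_nhdsGT_zero hr)).const_mul (n r)
  have l2 := (tendsto_integral_norm_dilate_sub hv hM hc hn hP).mul_const D
  rw [zero_mul] at l2
  have l3 : Tendsto (fun l : ℝ => ∫ r in Ioi 0, (v (l * r) - c) * (n r * b (l * r))) (𝓝[>] 0) (𝓝 0) := by
    refine squeeze_zero_norm' ?_ l2
    filter_upwards [self_mem_nhdsWithin] with l hl
    rw [← integral_mul_const]
    refine norm_integral_le_of_norm_le ?_ ?_
    · refine (hn.norm.bdd_mul (c := M + ‖c‖) ((hm l).sub aestronglyMeasurable_const).norm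
        (Eventually.of_forall fun r => ?_)).mul_const D
      simp only [Pi.sub_apply, norm_norm]
      exact (norm_sub_le _ _).trans (add_le_add_left (hM _) _)
    · filter_upwards [hbd l hl] with r hr
      rw [norm_mul, norm_mul, mul_assoc]
      exact mul_le_mul_of_nonneg_left (mul_le_mul_of_nonneg_left hr (norm_nonneg _)) (norm_nonneg _)
  have l4 := l3.add (l1.const_mul c)
  rw [zero_add] at l4
  refine l4.congr' ?_
  filter_upwards [self_mem_nhdsWithin] with l hl
  have i1 : IntegrableOn (fun r => v (l * r) * (n r * b (l * r))) (Ioi 0) :=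
    (hi l hl).bdd_mul (c := M) (hm l) (Eventually.of_forall fun r => hM _)
  have i2 : IntegrableOn (fun r => c * (n r * b (l * r))) (Ioi 0) := (hi l hl).const_mul c
  simp only [sub_mul]
  rw [integral_sub i1 i2, integral_const_mul, sub_add_cancel]

theorem testDeriv₁_two_evenPrimitive_neg (ψ : 𝓓(posRay, ℂ)) (x : ℝ) :
    testDeriv₁ 2 (evenPrimitive ψ) (-x) = testDeriv₁ 2 (evenPrimitive ψ) x := by
  rw [evenPrimitive_deriv_two, evenPrimitive_deriv_two, neg_neg, add_comm]

/-- The flux through the line `x₁ = α`, averaged with the test functions. -/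
theorem IsPlaneSolution.flux_restriction (h : IsPlaneSolution T u W₀ W) (hT : 0 < T)
    (hu : MemLp u ∞ (volume.restrict (Ioo 0 T))) {M : ℝ} (hv : IsBoundedRep T u v M) {t : ℝ}
    (ht : t ∈ Ioo 0 T) (φ : Space (Sobolev₁ ⊤ 1)) (ψ : 𝓓(posRay, ℂ)) {α : ℝ} (hα : 0 < α) :
    distDeriv (SobolevZero 1) 1 0 (by norm_num) (restriction (W t)) (tensor (dilate α ψ) φ) =
      1 / 2 * (∫ z, planeK t z * corr (W 0) (fun x : ℝ × ℝ =>
        testDeriv₁ 2 (evenPrimitive (dilate α ψ)) x.1 * coord₁ (Sobolev₁ ⊤ 1) 0 φ x.2) z) -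
      ∫ r in Ioi 0, v (t - α ^ 2 * r) * (heatAverage (testDeriv₁ 2 (evenPrimitive ψ)) r *
        heatAverage (coord₁ (Sobolev₁ ⊤ 1) 0 φ) (α ^ 2 * r)) := by
  set p := testDeriv₁ 2 (evenPrimitive (dilate α ψ)) with hp
  set q := coord₁ (Sobolev₁ ⊤ 1) 0 φ with hq
  have hpm : MemLp p 2 volume := memLp_testFunction 2 p volume
  have hqm : MemLp q 2 volume := memLp_line q
  obtain ⟨A, -, hA⟩ := exists_norm_heatAverage_test_le p
  obtain ⟨D, -, hD⟩ := exists_norm_heatAverage_coord₁_le φ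
  -- The second derivative of the even primitive is even, so the half-plane pairing is half of the
  -- plane pairing; this cancels the factor `2` of the source.
  have h1 := (h.even t ⟨ht.1.le, ht.2.le⟩).integral_restriction_mul (memLp_tensor hpm hqm)
    (fun x => by
      simp only [reflect, hp]
      rw [testDeriv₁_two_evenPrimitive_neg])
  rw [h.integral_mul_tensor hT hu hpm hqm hA hD ht, ← flux_eq] at h1
  have hpos : (0 : ℝ) < α ^ 2 := by positivity
  have h2 : ∫ r in Ioo 0 t, u (t - r) * (heatAverage p r * heatAverage q r) =
      ∫ r in Ioi 0, v (t - r) * (heatAverage p r * heatAverage q r) := by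
    refine Eq.trans ?_ (setIntegral_eq_of_subset_of_forall_sdiff_eq_zero measurableSet_Ioi
      (Ioo_subset_Ioi_self : Ioo 0 t ⊆ Ioi 0) fun r hr => ?_).symm
    · refine setIntegral_congr_ae measurableSet_Ioo ?_
      filter_upwards [(Measure.measurePreserving_sub_left volume t).quasiMeasurePreserving.ae hv.ae_eq]
        with r h3 hr
      rw [h3 ⟨by linarith [hr.2], by linarith [hr.1, ht.2]⟩]
    · have h4 : t ≤ r := by
        by_contra h5
        exact hr.2 ⟨hr.1, not_le.1 h5⟩
      rw [hv.eq_zero (t - r) fun h5 => by linarith [h5.1], zero_mul]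
  -- Substitution `r ↦ α² r`: by parabolic scaling the dilated corrector becomes a kernel
  -- independent of `α`, and `α` remains only in `v` and in the average of `φ`.
  have h3 : ∫ r in Ioi 0, v (t - r) * (heatAverage p r * heatAverage q r) =
      ∫ r in Ioi 0, v (t - α ^ 2 * r) * (heatAverage (testDeriv₁ 2 (evenPrimitive ψ)) r *
        heatAverage q (α ^ 2 * r)) := by
    have h4 := integral_comp_mul_left_Ioi' (fun r => v (t - r) * (heatAverage p r * heatAverage q r)) 0 hpos
    rw [mul_zero] at h4
    rw [← h4, Complex.real_smul, ← integral_const_mul]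
    refine setIntegral_congr_fun measurableSet_Ioi fun r hr => ?_
    have h5 := heatAverage_testDeriv₁_two_scale (g := evenPrimitive ψ) (h := evenPrimitive (dilate α ψ))
      hα (fun x => by rw [evenPrimitive_dilate hα, inv_mul_cancel_left₀ hα.ne']) (mem_Ioi.1 hr)
    rw [← h5]
    push_cast
    ring
  rw [h2, h3] at h1
  linear_combination h1 / 2

/-- The contribution of the initial value to the flux is `O(√α)`. -/
theorem exists_norm_initial_dilate_le (f : L2 (⊤ : Opens (ℝ × ℝ))) (φ : Space (Sobolev₁ ⊤ 1))
    (ψ : 𝓓(posRay, ℂ)) {a b : ℝ} (ha : 0 < a) (hab : a ≤ b) :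
    ∃ C, 0 ≤ C ∧ ∀ t ∈ Icc a b, ∀ α, 0 < α → ‖∫ z, planeK t z * corr f (fun x : ℝ × ℝ =>
        testDeriv₁ 2 (evenPrimitive (dilate α ψ)) x.1 * coord₁ (Sobolev₁ ⊤ 1) 0 φ x.2) z‖ ≤ C * √α := by
  obtain ⟨C, hC, h⟩ := exists_norm_initial_le ha hab
  refine ⟨C * (‖f‖ * lpNorm (fun x : ℝ × ℝ => evenPrimitive ψ x.1 * coord₁ (Sobolev₁ ⊤ 1) 0 φ x.2)
    2 volume), mul_nonneg hC (mul_nonneg (norm_nonneg _) lpNorm_nonneg), fun t ht α hα => ?_⟩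
  have h1 := h t ht f (evenPrimitive (dilate α ψ)) _ (memLp_line (coord₁ (Sobolev₁ ⊤ 1) 0 φ))
  rw [lpNorm_tensor_evenPrimitive_dilate hα ψ (memLp_line (coord₁ (Sobolev₁ ⊤ 1) 0 φ))] at h1
  exact h1.trans (le_of_eq (by ring))

theorem tendsto_sq_nhdsGT_zero : Tendsto (fun α : ℝ => α ^ 2) (𝓝[>] 0) (𝓝[>] 0) := by
  refine tendsto_nhdsWithin_iff.2 ⟨?_, ?_⟩
  · have := ((continuous_pow 2).tendsto (0 : ℝ)).mono_left (nhdsWithin_le_nhds (s := Ioi (0 : ℝ)))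
    rwa [zero_pow two_ne_zero] at this
  · filter_upwards [self_mem_nhdsWithin] with α hα using pow_pos (mem_Ioi.1 hα) 2

/-- The limit is taken at Lebesgue points of the bounded representative, where it agrees with `u`.
These points do not depend on `φ` or `ψ`, so one null set serves for all test functions. -/
theorem IsPlaneSolution.boundary_ae (h : IsPlaneSolution T u W₀ W) (hT : 0 < T)
    (hu : MemLp u ∞ (volume.restrict (Ioo 0 T))) : ∀ᵐ t ∂(volume.restrict (Ioo 0 T)),
    HasValueOnLine (distDeriv (SobolevZero 1) 1 0 (by norm_num) (restriction (W t))) (u t • delta₁) := by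
  obtain ⟨v, M, hv⟩ := exists_isBoundedRep hu
  refine (ae_restrict_iff' measurableSet_Ioo).2 ?_
  filter_upwards [hv.ae_eq, ae_tendsto_average_left hv.locallyIntegrable] with t h1 h2 ht φ ψ
  obtain ⟨P, -, hP⟩ := exists_norm_heatAverage_test_le (testDeriv₁ 2 (evenPrimitive ψ))
  obtain ⟨D, -, hD⟩ := exists_norm_heatAverage_coord₁_le φ
  obtain ⟨C, -, hC⟩ := exists_norm_initial_dilate_le (W 0) φ ψ ht.1 le_rfl
  have l1 := (tendsto_integral_dilate_mul (v := fun r => v (t - r)) (c := v t)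
    (hv.stronglyMeasurable.comp_measurable (by fun_prop)) (fun r => hv.norm_le _) h2
    (integrableOn_heatAverage_testDeriv₁_two (evenPrimitive ψ)) hP hD
    (fun l => aestronglyMeasurable_heatAverage_comp_mul (memLp_line _) l _)
    (tendsto_heatAverage_coord₁ φ)).comp tendsto_sq_nhdsGT_zero
  have l2 : Tendsto (fun α : ℝ => ∫ z, planeK t z * corr (W 0) (fun x : ℝ × ℝ =>
      testDeriv₁ 2 (evenPrimitive (dilate α ψ)) x.1 * coord₁ (Sobolev₁ ⊤ 1) 0 φ x.2) z)
      (𝓝[>] 0) (𝓝 0) := by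
    have l3 := tendsto_sqrt_nhdsGT_zero.const_mul C
    rw [mul_zero] at l3
    refine squeeze_zero_norm' ?_ l3
    filter_upwards [self_mem_nhdsWithin] with α hα using hC t ⟨le_rfl, le_rfl⟩ α hα
  have l4 := (l2.const_mul (1 / 2)).sub l1
  -- The kernel has total mass `-∫ ψ`, whose sign cancels the minus sign in the flux formula.
  rw [integral_heatAverage_testDeriv₁_two, evenPrimitive_zero, h1 ht] at l4
  have e : (1 / 2 : ℂ) * 0 - u t * (-(∫ r, ψ r) * delta₁ φ) = (u t • delta₁) φ * ∫ r, ψ r := by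
    rw [smul_apply, smul_eq_mul]; ring
  rw [e] at l4
  refine l4.congr' ?_
  filter_upwards [self_mem_nhdsWithin] with α hα
  exact (h.flux_restriction hT hu hv ht φ ψ hα).symm

/-- A majorant uniform in `α`. The term from the initial value is controlled only for times bounded
below by a positive constant, hence the restriction `a ≤ t`. -/
theorem IsPlaneSolution.exists_norm_flux_le (h : IsPlaneSolution T u W₀ W) (hT : 0 < T)
    (hu : MemLp u ∞ (volume.restrict (Ioo 0 T))) (φ : Space (Sobolev₁ ⊤ 1)) (ψ : 𝓓(posRay, ℂ)) {a : ℝ}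
    (ha : 0 < a) (haT : a ≤ T) : ∃ B, ∀ t ∈ Ioo 0 T, a ≤ t → ∀ α, 0 < α → α ≤ 1 →
      ‖distDeriv (SobolevZero 1) 1 0 (by norm_num) (restriction (W t)) (tensor (dilate α ψ) φ)‖ ≤ B := by
  obtain ⟨v, M, hv⟩ := exists_isBoundedRep hu
  obtain ⟨D, -, hD⟩ := exists_norm_heatAverage_coord₁_le φ
  obtain ⟨C, hC0, hC⟩ := exists_norm_initial_dilate_le (W 0) φ ψ ha haT
  have hM0 : 0 ≤ M := (norm_nonneg _).trans (hv.norm_le 0)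
  have hn := integrableOn_heatAverage_testDeriv₁_two (evenPrimitive ψ)
  refine ⟨1 / 2 * C + ∫ r in Ioi 0, M * (‖heatAverage (testDeriv₁ 2 (evenPrimitive ψ)) r‖ * D),
    fun t ht hat α hα hα1 => ?_⟩
  rw [h.flux_restriction hT hu hv ht φ ψ hα]
  refine (norm_sub_le _ _).trans (add_le_add ?_ ?_)
  · rw [norm_mul]
    have e : ‖(1 / 2 : ℂ)‖ = 1 / 2 := by norm_num
    rw [e]
    refine mul_le_mul_of_nonneg_left ((hC t ⟨hat, ht.2.le⟩ α hα).trans ?_) (by norm_num)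
    exact mul_le_of_le_one_right hC0 (Real.sqrt_le_one.2 hα1)
  · refine norm_integral_le_of_norm_le ((hn.norm.mul_const D).const_mul M) ?_
    filter_upwards [ae_restrict_mem measurableSet_Ioi] with r hr
    rw [norm_mul, norm_mul]
    exact mul_le_mul (hv.norm_le _) (mul_le_mul_of_nonneg_left (hD _ (mul_pos (by positivity) hr))
      (norm_nonneg _)) (by positivity) hM0

theorem exists_pos_le_of_mem_support {T : ℝ} (θ : 𝓓(timeInterval T, ℂ)) (hT : 0 < T) :
    ∃ a, 0 < a ∧ a ≤ T ∧ ∀ t, θ t ≠ 0 → a ≤ t := by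
  by_cases hne : (tsupport θ).Nonempty
  · obtain ⟨a, ha, hmin⟩ := θ.hasCompactSupport.isCompact.exists_isMinOn hne continuousOn_id
    have h := θ.tsupport_subset ha
    exact ⟨a, h.1, h.2.le, fun t ht => hmin (subset_tsupport _ ht)⟩
  · exact ⟨T, hT, le_rfl, fun t ht => (hne ⟨t, subset_tsupport _ ht⟩).elim⟩

/-- Dominated convergence on top of the almost everywhere limit: the support of `θ` stays away from
time `0`, so the uniform flux bound provides the majorant. -/
theorem IsPlaneSolution.boundary_distrib (h : IsPlaneSolution T u W₀ W) (hT : 0 < T)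
    (hu : MemLp u ∞ (volume.restrict (Ioo 0 T))) (φ : Space (Sobolev₁ ⊤ 1)) (ψ : 𝓓(posRay, ℂ))
    (θ : 𝓓(timeInterval T, ℂ)) :
    Tendsto (fun α : ℝ => ∫ t in Ioo 0 T, θ t * distDeriv (SobolevZero 1) 1 0 (by norm_num)
        (restriction (W t)) (tensor (dilate α ψ) φ))
      (𝓝[>] 0) (𝓝 (∫ t in Ioo 0 T, θ t * ((u t • delta₁) φ * ∫ x : ℝ, ψ x))) := by
  obtain ⟨a, ha, haT, hsupp⟩ := exists_pos_le_of_mem_support θ hT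
  obtain ⟨B, hB⟩ := h.exists_norm_flux_le hT hu φ ψ ha haT
  have hθ : IntegrableOn (fun t => ‖θ t‖ * B) (Ioo 0 T) :=
    ((θ.continuous.integrable_of_hasCompactSupport θ.hasCompactSupport).norm.mul_const B).integrableOn
  refine tendsto_integral_filter_of_dominated_convergence (fun t => ‖θ t‖ * B) ?_ ?_ hθ ?_
  · refine Eventually.of_forall fun α => ContinuousOn.aestronglyMeasurable ?_ measurableSet_Ioo
    have hc := h.continuousOn_restriction.mono (Ioo_subset_Icc_self)
    refine θ.continuous.continuousOn.mul ?_
    exact ((ContinuousLinearMap.apply ℂ ℂ (tensor (dilate α ψ) φ)).continuous.comp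
      (distDeriv (SobolevZero 1) 1 0 (by norm_num)).continuous).comp_continuousOn hc
  · filter_upwards [self_mem_nhdsWithin, mem_nhdsWithin_of_mem_nhds (gt_mem_nhds zero_lt_one)]
      with α h0 h1
    filter_upwards [ae_restrict_mem measurableSet_Ioo] with t ht
    by_cases hz : θ t = 0
    · rw [hz, zero_mul, norm_zero, zero_mul]
    · rw [norm_mul]
      exact mul_le_mul_of_nonneg_left (hB t ht (hsupp t hz) α h0 h1.le) (norm_nonneg _)
  · filter_upwards [h.boundary_ae hT hu] with t ht
    exact (ht φ ψ).const_mul (θ t)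

theorem IsPlaneSolution.isHalfPlaneSolution (h : IsPlaneSolution T u W₀ W) (hT : 0 < T)
    (hu : MemLp u ∞ (volume.restrict (Ioo 0 T))) :
    IsHalfPlaneSolution T u (restriction W₀) fun t => restriction (W t) where
  continuousOn := h.continuousOn_restriction
  heat t ht := h.hasDerivAt_restriction hT hu ht
  boundary_ae := h.boundary_ae hT hu
  boundary_distrib := h.boundary_distrib hT hu
  initial := by rw [h.initial]

end Flux

end HalfPlaneHeat

end

theorem theorem3p1 (T : ℝ) (hT : 0 < T) (u : ℝ → ℂ)
    (hu : MemLp u ∞ (volume.restrict (Ioo 0 T))) :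
    (∀ (w₀ : L2 halfPlane) (w : ℝ → L2 halfPlane), IsHalfPlaneSolution T u w₀ w →
      IsPlaneSolution T u (evenExtension w₀) (fun t => evenExtension (w t))) ∧
    (∀ (W₀ : L2 (⊤ : Opens (ℝ × ℝ))) (W : ℝ → L2 (⊤ : Opens (ℝ × ℝ))), IsEven W₀ →
      IsPlaneSolution T u W₀ W →
      IsHalfPlaneSolution T u (restriction W₀) (fun t => restriction (W t))) := by
  exact ⟨fun w₀ w h => h.isPlaneSolution hT hu, fun W₀ W _ h => h.isHalfPlaneSolution hT hu⟩
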